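/- Let $\Delta\ge 1$ be an integer, $K=\mathbb Q(\sqrt{-\Delta})$, let $p$ be a prime with $\left(\frac{-\Delta}{p}\right)=-1$ (so $p$ is odd and inert in $K$), and let $N\ge 1$ be an integer prime to $p$. Write $J=\begin{pmatrix}0&-1\\1&0\end{pmatrix}$ ($3\times3$ blocks), let $GSp_6^+(\mathbb R)$ be the group of real $M$ with $MJM^t=cJ$, $c>0$, acting on the Siegel upper half space $\mathcal H_3$ by $Z\mapsto (AZ+B)(CZ+D)^{-1}$, let $\Gamma=\Gamma_0(N)\subset Sp_6(\mathbb Z)$ be the subgroup of matrices $\begin{pmatrix}A&B\\C&D\end{pmatrix}$ with $C\equiv 0 \bmod N$, and let $X=\Gamma\backslash\mathcal H_3$ be the Siegel variety of genus $3$ and level $N$. Let $E=\mathrm{diag}(1,1,-1)$. For a commutative ring $R$ let $GU(2,1)(R)$ be the group of $\mathfrak g=h+k\sqrt{-\Delta}$, $h,k\in M_3(R)$, with $hEh^t+\Delta kEk^t=\lambda E$, $kEh^t=hEk^t$, $\lambda\in R^*$, and put $$\alpha(h+k\sqrt{-\Delta})=\begin{pmatrix}h&kE\\-\Delta Ek&EhE\end{pmatrix}.$$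 Let $\mathcal D_V\subset\mathcal H_3$ be the orbit of $\frac{i}{\sqrt\Delta}\cdot 1_3$ under $\alpha(GU(2,1)(\mathbb R))$, and let $V\subset X$ be the image of $\mathcal D_V$ (a Picard modular surface: abelian threefolds with multiplication by $K$ of signature $(2,1)$). Let $T=\Gamma\,\mathrm{diag}(1,1,1,p,p,p)\,\Gamma$, so that the Hecke correspondence $T_p$ sends the class $[Z]$ to the classes $[\sigma Z]$, $\sigma\in\Gamma\backslash T$. For $\sigma\in T$ let $W_\sigma\subset\mathbb F_p^6$ be the span of the rows of $\sigma \bmod p$; $\mathbb F_{p^2}=O_K/p$ acts on $\mathbb F_p^6$, $\sqrt{-\Delta}$ acting as right multiplication by $\alpha(\sqrt{-\Delta})$. Call $\sigma$ bad if $j=\dim_{\mathbb F_p}(\mathbb F_{p^2}W_\sigma)$ is neither $g=3$ nor $2g=6$ (i.e. $j=4$). Call $\sigma,\sigma'\in T$ D-equivalent if $\sigma\,\alpha(\mathfrak g)\,\sigma'^{-1}\in GSp_6(\mathbb Z_p)$ for some $\mathfrak g\in GU(2,1)(\mathbb Z_p)$. For a set $\Sigma\subset T$ let $V_\Sigma=\{[\sigma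 t] : t\in\mathcal D_V,\ \sigma\in\Sigma\}\subset X$, let $\Gamma_\Sigma=\{([t],[\sigma t]) : t\in\mathcal D_V,\ \sigma\in\Sigma\}\subset V\times V_\Sigma$, and let $\pi_2:\Gamma_\Sigma\to V_\Sigma$ be the second projection. Its degree is the number of points of a general fibre: $\pi_2$ has degree $d$ if all its fibres over some dense open subset of $V_\Sigma$ have exactly $d$ points. If $\Sigma$ is the D-equivalence class of a bad $\sigma$, then $V_\Sigma$ is called a bad component of $T_p(V)$; if $\Sigma=\{\sigma\}$ with $\sigma$ bad, $V_\Sigma$ is an irreducible component of it. **Proposition.** Bad elements $\sigma\in T$ exist, and for every bad $\sigma\in T$ the degree of $\pi_2$ for the bad component of $T_p(V)$ defined by $\sigma$ (the case where $\Sigma$ is the D-equivalence class of $\sigma$) is $p+1$; the same holds for the irreducible component defined by $\sigma$ (the case $\Sigma=\{\sigma\}$). -/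

import Mathlib

open Matrix

/-! ### Siegel upper half space and the group of positive symplectic similitudes -/

/-- The Siegel upper half space: complex symmetric matrices with positive definite imaginary part
(with the topology of the space of complex matrices). -/
abbrev SiegelSpace (n : Type) [Fintype n] [DecidableEq n] : Type :=
  {Z : Matrix n n ℂ // Z.IsSymm ∧ (Z.map Complex.im).PosDef}

theorem symp_transpose {n : Type} [Fintype n] [DecidableEq n] {M : Matrix (n ⊕ n) (n ⊕ n) ℝ}
    {c : ℝ} (hc : c ≠ 0) (h : M * J n ℝ * Mᵀ = c • J n ℝ) : Mᵀ * J n ℝ * M = c • J n ℝ := by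
  have h1 : M * (c⁻¹ • (J n ℝ * Mᵀ * (-J n ℝ))) = 1 := by
    rw [Matrix.mul_smul, ← Matrix.mul_assoc, ← Matrix.mul_assoc, h, Matrix.smul_mul, smul_smul,
      inv_mul_cancel₀ hc, one_smul, Matrix.mul_neg, J_squared, neg_neg]
  have h2 := mul_eq_one_comm.1 h1
  have h3 : J n ℝ * Mᵀ * J n ℝ * M = -(c • (1 : Matrix (n ⊕ n) (n ⊕ n) ℝ)) := by
    rw [← h2, Matrix.smul_mul, smul_smul, mul_inv_cancel₀ hc, one_smul]
    simp
  have h4 : J n ℝ * (J n ℝ * Mᵀ * J n ℝ * M) = J n ℝ * -(c • (1 : Matrix (n ⊕ n) (n ⊕ n) ℝ)) := by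
    rw [h3]
  rw [← Matrix.mul_assoc, ← Matrix.mul_assoc, ← Matrix.mul_assoc, J_squared] at h4
  simpa using h4

/-- `GSp⁺`: invertible real matrices `M` with `M J Mᵀ = c J` for some `c > 0`. -/
def GSpPos (n : Type) [Fintype n] [DecidableEq n] : Subgroup (GL (n ⊕ n) ℝ) where
  carrier := {M | ∃ c : ℝ, 0 < c ∧ M.val * J n ℝ * M.valᵀ = c • J n ℝ}
  one_mem' := ⟨1, one_pos, by simp⟩
  mul_mem' := by
    rintro a b ⟨c, hc, h⟩ ⟨d, hd, h'⟩
    refine ⟨d * c, mul_pos hd hc, ?_⟩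
    rw [Units.val_mul, transpose_mul]
    calc a.val * b.val * J n ℝ * (b.valᵀ * a.valᵀ)
        = a.val * (b.val * J n ℝ * b.valᵀ) * a.valᵀ := by simp only [Matrix.mul_assoc]
      _ = (d * c) • J n ℝ := by
        rw [h', Matrix.mul_smul, Matrix.smul_mul, h, smul_smul]
  inv_mem' := by
    rintro a ⟨c, hc, h⟩
    refine ⟨c⁻¹, inv_pos.2 hc, ?_⟩
    have e1 : (a⁻¹).val * a.val = 1 := by rw [← Units.val_mul]; simp
    have e2 : a.valᵀ * (a⁻¹).valᵀ = 1 := by rw [← transpose_mul, e1, transpose_one]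
    have h' : J n ℝ = c⁻¹ • (a.val * J n ℝ * a.valᵀ) := by
      rw [h, smul_smul, inv_mul_cancel₀ hc.ne', one_smul]
    calc (a⁻¹).val * J n ℝ * (a⁻¹).valᵀ
        = (a⁻¹).val * (c⁻¹ • (a.val * J n ℝ * a.valᵀ)) * (a⁻¹).valᵀ := by rw [← h']
      _ = c⁻¹ • (((a⁻¹).val * a.val) * J n ℝ * (a.valᵀ * (a⁻¹).valᵀ)) := by
        simp only [Matrix.mul_smul, Matrix.smul_mul, Matrix.mul_assoc]
      _ = c⁻¹ • J n ℝ := by rw [e1, e2]; simp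

section Action

open scoped ComplexOrder

variable {n : Type} [Fintype n] [DecidableEq n]

set_option linter.unusedSectionVars false

/-- `A Z + B` for the block matrix `M = (A B; C D)`. -/
def moebNum (M : Matrix (n ⊕ n) (n ⊕ n) ℝ) (Z : Matrix n n ℂ) : Matrix n n ℂ :=
  M.toBlocks₁₁.map Complex.ofReal * Z + M.toBlocks₁₂.map Complex.ofReal

/-- `C Z + D` for the block matrix `M = (A B; C D)`. -/
def moebDenom (M : Matrix (n ⊕ n) (n ⊕ n) ℝ) (Z : Matrix n n ℂ) : Matrix n n ℂ :=
  M.toBlocks₂₁.map Complex.ofReal * Z + M.toBlocks₂₂.map Complex.ofReal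

theorem moeb_fromRows (M : Matrix (n ⊕ n) (n ⊕ n) ℝ) (Z : Matrix n n ℂ) :
    M.map Complex.ofReal * (fromRows Z 1 : Matrix (n ⊕ n) n ℂ) =
      fromRows (moebNum M Z) (moebDenom M Z) := by
  conv_lhs => rw [← fromBlocks_toBlocks M, fromBlocks_map, fromBlocks_mul_fromRows]
  simp [moebNum, moebDenom]

theorem moeb_mul (M M' : Matrix (n ⊕ n) (n ⊕ n) ℝ) (Z : Matrix n n ℂ)
    (hu : IsUnit (moebDenom M' Z).det) :
    moebNum (M * M') Z = moebNum M (moebNum M' Z * (moebDenom M' Z)⁻¹) * moebDenom M' Z ∧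
    moebDenom (M * M') Z = moebDenom M (moebNum M' Z * (moebDenom M' Z)⁻¹) * moebDenom M' Z := by
  have h1 : fromRows (moebNum M' Z) (moebDenom M' Z)
      = (fromRows (moebNum M' Z * (moebDenom M' Z)⁻¹) 1 : Matrix (n ⊕ n) n ℂ)
        * moebDenom M' Z := by
    rw [fromRows_mul, Matrix.nonsing_inv_mul_cancel_right _ _ hu, Matrix.one_mul]
  have h2 := moeb_fromRows (M * M') Z
  have hm : (M * M').map Complex.ofReal = M.map Complex.ofReal * M'.map Complex.ofReal :=
    Matrix.map_mul (f := Complex.ofRealHom)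
  rw [hm, Matrix.mul_assoc, moeb_fromRows, h1, ← Matrix.mul_assoc, moeb_fromRows, fromRows_mul,
    fromRows_ext_iff] at h2
  exact ⟨h2.1.symm, h2.2.symm⟩

theorem posDef_ofReal_iff {Y : Matrix n n ℝ} :
    (Y.map Complex.ofReal).PosDef ↔ Y.PosDef := by
  constructor
  · intro h
    have hs : Y.IsHermitian := by
      ext i j
      have := congrFun (congrFun h.1 i) j
      simpa using this
    refine PosDef.of_dotProduct_mulVec_pos hs fun x hx => ?_
    have hx' : (fun i => (x i : ℂ)) ≠ 0 := fun h0 => hx <| by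
      ext i
      have := congrFun h0 i
      simpa using this
    have h1 := h.dotProduct_mulVec_pos hx'
    have h2 : star (fun i => (x i : ℂ)) ⬝ᵥ (Y.map Complex.ofReal *ᵥ fun i => (x i : ℂ))
        = ((star x ⬝ᵥ (Y *ᵥ x) : ℝ) : ℂ) := by
      simp [dotProduct, mulVec]
    rw [h2] at h1
    exact_mod_cast h1
  · intro h
    have hsym : ∀ i j, Y i j = Y j i := fun i j => by
      have := congrFun (congrFun h.1 j) i
      simpa using this
    have hs : (Y.map Complex.ofReal).IsHermitian := by
      ext i j
      simp [hsym i j]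
    refine PosDef.of_dotProduct_mulVec_pos hs fun x hx => ?_
    have key : star x ⬝ᵥ (Y.map Complex.ofReal *ᵥ x)
        = (((star fun i => (x i).re) ⬝ᵥ (Y *ᵥ fun i => (x i).re)
          + (star fun i => (x i).im) ⬝ᵥ (Y *ᵥ fun i => (x i).im) : ℝ) : ℂ) := by
      have hsw : ∑ i, ∑ j, (x i).re * (Y i j * (x j).im)
          = ∑ i, ∑ j, (x i).im * (Y i j * (x j).re) := by
        rw [Finset.sum_comm]
        refine Finset.sum_congr rfl fun i _ => Finset.sum_congr rfl fun j _ => ?_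
        rw [hsym j i]; ring
      apply Complex.ext
      · simp [dotProduct, mulVec, Finset.mul_sum, Finset.sum_add_distrib]
      · simp [dotProduct, mulVec, Finset.mul_sum, Finset.sum_add_distrib, hsw]
    rw [key]
    have h0 : (fun i => (x i).re) ≠ 0 ∨ (fun i => (x i).im) ≠ 0 := by
      by_contra hcon
      push Not at hcon
      exact hx (funext fun i => Complex.ext (congrFun hcon.1 i) (congrFun hcon.2 i))
    have hre := h.posSemidef.dotProduct_mulVec_nonneg (fun i => (x i).re)
    have him := h.posSemidef.dotProduct_mulVec_nonneg (fun i => (x i).im)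
    have : 0 < (star fun i => (x i).re) ⬝ᵥ (Y *ᵥ fun i => (x i).re)
          + (star fun i => (x i).im) ⬝ᵥ (Y *ᵥ fun i => (x i).im) := by
      rcases h0 with h0 | h0
      · exact add_pos_of_pos_of_nonneg (h.dotProduct_mulVec_pos h0) him
      · exact add_pos_of_nonneg_of_pos hre (h.dotProduct_mulVec_pos h0)
    exact_mod_cast this

theorem sub_conjTranspose_of_isSymm {Z : Matrix n n ℂ} (hZ : Z.IsSymm) :
    Z - Zᴴ = (2 * Complex.I) • (Z.map Complex.im).map Complex.ofReal := by
  ext i j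
  have h : Z j i = Z i j := congrFun (congrFun hZ i) j
  simp only [Matrix.sub_apply, conjTranspose_apply, h, Matrix.smul_apply, map_apply, smul_eq_mul]
  apply Complex.ext
  · simp
  · simp; ring

theorem fromRows_J (P Q P' Q' : Matrix n n ℂ) :
    fromCols P' Q' * (J n ℂ * (fromRows P Q : Matrix (n ⊕ n) n ℂ)) = Q' * P - P' * Q := by
  rw [J, fromBlocks_mul_fromRows, fromCols_mul_fromRows]
  simp [sub_eq_neg_add]

theorem map_similitude {M : Matrix (n ⊕ n) (n ⊕ n) ℝ} {c : ℝ}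
    (hM : Mᵀ * J n ℝ * M = c • J n ℝ) :
    (M.map Complex.ofReal)ᵀ * J n ℂ * M.map Complex.ofReal = (c : ℂ) • J n ℂ := by
  have h := congrArg (fun A => A.map Complex.ofRealHom) hM
  simp only [Matrix.map_mul, map_J, transpose_map] at h
  rw [← transpose_map] at h
  refine Eq.trans h ?_
  ext i j
  have hJ : ((J n ℝ i j : ℝ) : ℂ) = J n ℂ i j :=
    congrFun (congrFun (map_J n (S := ℂ) Complex.ofRealHom) i) j
  simp [hJ]

theorem moeb_symm {M : Matrix (n ⊕ n) (n ⊕ n) ℝ} {c : ℝ} (hM : Mᵀ * J n ℝ * M = c • J n ℝ)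
    {Z : Matrix n n ℂ} (hZ : Z.IsSymm) :
    (moebDenom M Z)ᵀ * moebNum M Z - (moebNum M Z)ᵀ * moebDenom M Z = 0 := by
  rw [← fromRows_J, ← transpose_fromRows, ← moeb_fromRows, transpose_mul, transpose_fromRows,
    Matrix.mul_assoc]
  calc (fromCols Zᵀ 1ᵀ : Matrix n (n ⊕ n) ℂ) * ((M.map Complex.ofReal)ᵀ *
        (J n ℂ * (M.map Complex.ofReal * (fromRows Z 1 : Matrix (n ⊕ n) n ℂ))))
      = (fromCols Zᵀ 1ᵀ : Matrix n (n ⊕ n) ℂ) * (((M.map Complex.ofReal)ᵀ * J n ℂ * M.map Complex.ofReal) *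
        (fromRows Z 1 : Matrix (n ⊕ n) n ℂ)) := by simp only [Matrix.mul_assoc]
    _ = 0 := by
      rw [map_similitude hM, Matrix.smul_mul, Matrix.mul_smul, fromRows_J]
      simp [hZ.eq]

theorem moeb_im {M : Matrix (n ⊕ n) (n ⊕ n) ℝ} {c : ℝ} (hM : Mᵀ * J n ℝ * M = c • J n ℝ)
    (Z : Matrix n n ℂ) :
    (moebDenom M Z)ᴴ * moebNum M Z - (moebNum M Z)ᴴ * moebDenom M Z = (c : ℂ) • (Z - Zᴴ) := by
  have hr : (M.map Complex.ofReal)ᴴ = (M.map Complex.ofReal)ᵀ := by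
    ext i j
    simp
  rw [← fromRows_J, ← conjTranspose_fromRows_eq_fromCols_conjTranspose, ← moeb_fromRows,
    conjTranspose_mul, conjTranspose_fromRows_eq_fromCols_conjTranspose, Matrix.mul_assoc, hr]
  calc (fromCols Zᴴ 1ᴴ : Matrix n (n ⊕ n) ℂ) * ((M.map Complex.ofReal)ᵀ *
        (J n ℂ * (M.map Complex.ofReal * (fromRows Z 1 : Matrix (n ⊕ n) n ℂ))))
      = (fromCols Zᴴ 1ᴴ : Matrix n (n ⊕ n) ℂ) * (((M.map Complex.ofReal)ᵀ * J n ℂ * M.map Complex.ofReal) *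
        (fromRows Z 1 : Matrix (n ⊕ n) n ℂ)) := by simp only [Matrix.mul_assoc]
    _ = (c : ℂ) • (Z - Zᴴ) := by
      rw [map_similitude hM, Matrix.smul_mul, Matrix.mul_smul, fromRows_J]
      simp

theorem moebDenom_isUnit {M : Matrix (n ⊕ n) (n ⊕ n) ℝ} {c : ℝ} (hc : 0 < c)
    (hM : Mᵀ * J n ℝ * M = c • J n ℝ) (Z : SiegelSpace n) :
    IsUnit (moebDenom M Z.1).det := by
  rw [isUnit_iff_ne_zero]
  intro hdet
  obtain ⟨v, hv, hv0⟩ := Matrix.exists_mulVec_eq_zero_iff.2 hdet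
  have hpos := (posDef_ofReal_iff.2 Z.2.2).dotProduct_mulVec_pos hv
  have h := moeb_im hM Z.1
  rw [sub_conjTranspose_of_isSymm Z.2.1] at h
  have h1 := congrArg (fun A => star v ⬝ᵥ (A *ᵥ v)) h
  have h2 : star v ⬝ᵥ (((moebDenom M Z.1)ᴴ * moebNum M Z.1) *ᵥ v) = 0 := by
    rw [← mulVec_mulVec, dotProduct_mulVec, ← star_mulVec, hv0, star_zero, zero_dotProduct]
  have h3 : star v ⬝ᵥ (((moebNum M Z.1)ᴴ * moebDenom M Z.1) *ᵥ v) = 0 := by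
    rw [← mulVec_mulVec, hv0, mulVec_zero, dotProduct_zero]
  simp only [sub_mulVec, dotProduct_sub, h2, h3, sub_zero, smul_mulVec, dotProduct_smul,
    smul_eq_mul] at h1
  have hc' : (c : ℂ) ≠ 0 := by exact_mod_cast hc.ne'
  exact mul_ne_zero hc' (mul_ne_zero (by simp) hpos.ne') h1.symm

theorem moeb_mem {M : Matrix (n ⊕ n) (n ⊕ n) ℝ} {c : ℝ} (hc : 0 < c)
    (hM : Mᵀ * J n ℝ * M = c • J n ℝ) (Z : SiegelSpace n) :
    (moebNum M Z.1 * (moebDenom M Z.1)⁻¹).IsSymm ∧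
      ((moebNum M Z.1 * (moebDenom M Z.1)⁻¹).map Complex.im).PosDef := by
  have hu := moebDenom_isUnit hc hM Z
  set P := moebNum M Z.1 with hP
  set Q := moebDenom M Z.1 with hQ
  have hs : (P * Q⁻¹).IsSymm := by
    have h := sub_eq_zero.1 (moeb_symm hM Z.2.1)
    rw [← hP, ← hQ] at h
    have hut : IsUnit (Qᵀ).det := by rwa [det_transpose]
    rw [IsSymm, transpose_mul, transpose_nonsing_inv]
    calc (Qᵀ)⁻¹ * Pᵀ = (Qᵀ)⁻¹ * (Pᵀ * Q) * Q⁻¹ := by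
          rw [Matrix.mul_assoc, Matrix.mul_nonsing_inv_cancel_right _ _ hu]
      _ = P * Q⁻¹ := by rw [← h, Matrix.nonsing_inv_mul_cancel_left _ _ hut]
  refine ⟨hs, posDef_ofReal_iff.1 ?_⟩
  have h := moeb_im hM Z.1
  rw [← hP, ← hQ, sub_conjTranspose_of_isSymm Z.2.1] at h
  have hQu : IsUnit Q := (Matrix.isUnit_iff_isUnit_det _).2 hu
  refine (Matrix.IsUnit.posDef_star_left_conjugate_iff hQu).1 ?_
  have e : Qᴴ * (P * Q⁻¹ - (P * Q⁻¹)ᴴ) * Q = Qᴴ * P - Pᴴ * Q := by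
    have huh : IsUnit (Qᴴ).det := by rw [det_conjTranspose]; exact hu.star
    rw [Matrix.mul_sub, Matrix.sub_mul, conjTranspose_mul, conjTranspose_nonsing_inv,
      Matrix.mul_nonsing_inv_cancel_left _ _ huh, ← Matrix.mul_assoc,
      Matrix.nonsing_inv_mul_cancel_right _ _ hu]
  rw [h, sub_conjTranspose_of_isSymm hs, Matrix.mul_smul, Matrix.smul_mul, smul_comm] at e
  have h2I : (2 * Complex.I) ≠ 0 := by simp
  have e' := smul_right_injective _ h2I e
  rw [star_eq_conjTranspose]
  change Qᴴ * _ * Q = _ at e'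
  rw [e']
  exact (posDef_ofReal_iff.2 Z.2.2).smul (by exact_mod_cast hc)

theorem GSpPos_similitude (M : GSpPos n) :
    ∃ c : ℝ, 0 < c ∧ M.1.valᵀ * J n ℝ * M.1.val = c • J n ℝ := by
  obtain ⟨c, hc, h⟩ := M.2
  exact ⟨c, hc, symp_transpose hc.ne' h⟩

/-- The action `M • Z = (A Z + B) (C Z + D)⁻¹` of `GSp⁺` on the Siegel upper half space. -/
noncomputable instance : MulAction (GSpPos n) (SiegelSpace n) where
  smul M Z := ⟨moebNum M.1.val Z.1 * (moebDenom M.1.val Z.1)⁻¹, by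
    obtain ⟨c, hc, h⟩ := GSpPos_similitude M
    exact moeb_mem hc h Z⟩
  one_smul Z := Subtype.ext <| by
    change moebNum ((1 : Matrix (n ⊕ n) (n ⊕ n) ℝ)) Z.1 * (moebDenom 1 Z.1)⁻¹ = Z.1
    simp [moebNum, moebDenom, ← fromBlocks_one]
  mul_smul M M' Z := Subtype.ext <| by
    obtain ⟨c, hc, h⟩ := GSpPos_similitude M
    obtain ⟨c', hc', h'⟩ := GSpPos_similitude M'
    have hu' := moebDenom_isUnit hc' h' Z
    have hu := moebDenom_isUnit hc h ⟨_, moeb_mem hc' h' Z⟩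
    change moebNum (M.1.val * M'.1.val) Z.1 * (moebDenom (M.1.val * M'.1.val) Z.1)⁻¹ =
      moebNum M.1.val (moebNum M'.1.val Z.1 * (moebDenom M'.1.val Z.1)⁻¹) *
      (moebDenom M.1.val (moebNum M'.1.val Z.1 * (moebDenom M'.1.val Z.1)⁻¹))⁻¹
    rw [(moeb_mul _ _ _ hu').1, (moeb_mul _ _ _ hu').2, Matrix.mul_inv_rev,
      ← Matrix.mul_assoc, Matrix.mul_nonsing_inv_cancel_right _ _ hu']

end Action

/-! ### The Siegel variety of level `N` and the Hecke correspondence `T_p` -/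

/-- `Γ₀(N)`: integral symplectic matrices `(A B; C D)` with `C ≡ 0 mod N`, as a group of real
matrices. -/
def Gamma0 (n : Type) [Fintype n] [DecidableEq n] (N : ℕ) : Subgroup (GSpPos n) where
  carrier := {M | ∃ S : Matrix (n ⊕ n) (n ⊕ n) ℤ, S ∈ symplecticGroup n ℤ ∧
    (∀ i j, (N : ℤ) ∣ S.toBlocks₂₁ i j) ∧ M.1.val = S.map (Int.cast : ℤ → ℝ)}
  one_mem' := ⟨1, one_mem _, by simp [← fromBlocks_one], by simp⟩
  mul_mem' := by
    rintro a b ⟨S, hS, hd, h⟩ ⟨S', hS', hd', h'⟩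
    refine ⟨S * S', mul_mem hS hS', fun i j => ?_, ?_⟩
    · have e : (S * S').toBlocks₂₁ =
          S.toBlocks₂₁ * S'.toBlocks₁₁ + S.toBlocks₂₂ * S'.toBlocks₂₁ := by
        conv_lhs => rw [← fromBlocks_toBlocks S, ← fromBlocks_toBlocks S', fromBlocks_multiply,
          toBlocks_fromBlocks₂₁]
      rw [e, Matrix.add_apply, Matrix.mul_apply, Matrix.mul_apply]
      exact dvd_add (Finset.dvd_sum fun k _ => (hd i k).mul_right _)
        (Finset.dvd_sum fun k _ => (hd' k j).mul_left _)
    · have hm : (S * S').map (Int.cast : ℤ → ℝ) = S.map Int.cast * S'.map Int.cast :=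
        Matrix.map_mul (f := Int.castRingHom ℝ)
      rw [hm, ← h, ← h']
      rfl
  inv_mem' := by
    rintro a ⟨S, hS, hd, h⟩
    let T : symplecticGroup n ℤ := ⟨S, hS⟩
    have hT : (T⁻¹).1 * S = 1 := congrArg Subtype.val (inv_mul_cancel T)
    refine ⟨(T⁻¹).1, (T⁻¹).2, fun i j => ?_, ?_⟩
    · have e : ((T⁻¹).1).toBlocks₂₁ = -(S.toBlocks₂₁)ᵀ := by
        rw [SymplecticGroup.coe_inv]
        change (-J n ℤ * Sᵀ * J n ℤ).toBlocks₂₁ = _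
        conv_lhs => rw [← fromBlocks_toBlocks S, J, fromBlocks_transpose, fromBlocks_neg,
          fromBlocks_multiply, fromBlocks_multiply, toBlocks_fromBlocks₂₁]
        simp
      rw [e]
      simpa using hd j i
    · have hm : ((T⁻¹).1 * S).map (Int.cast : ℤ → ℝ) =
          (T⁻¹).1.map Int.cast * S.map Int.cast := Matrix.map_mul (f := Int.castRingHom ℝ)
      have h1 : (T⁻¹).1.map (Int.cast : ℤ → ℝ) * a.1.val = 1 := by
        rw [h, ← hm, hT]
        exact Matrix.map_one _ Int.cast_zero Int.cast_one
      exact Units.inv_eq_of_mul_eq_one_left h1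

/-- The Siegel variety of level `N` (its complex points, with the quotient topology). -/
abbrev SiegelVariety (n : Type) [Fintype n] [DecidableEq n] (N : ℕ) : Type :=
  MulAction.orbitRel.Quotient (Gamma0 n N) (SiegelSpace n)

/-- The point of the Siegel variety defined by a point of the Siegel upper half space. -/
noncomputable def toVariety {n : Type} [Fintype n] [DecidableEq n] (N : ℕ) (Z : SiegelSpace n) :
    SiegelVariety n N :=
  Quotient.mk'' Z

/-- The element `diag (1, …, 1, p, …, p)` of `GSp⁺`. -/
noncomputable def tauP (n : Type) [Fintype n] [DecidableEq n] (p : ℕ) [hp : Fact p.Prime] : GSpPos n :=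
  ⟨⟨fromBlocks 1 0 0 ((p : ℝ) • 1), fromBlocks 1 0 0 ((p : ℝ)⁻¹ • 1), by
      have : (p : ℝ) ≠ 0 := by exact_mod_cast hp.out.ne_zero
      simp [fromBlocks_multiply, this], by
      have : (p : ℝ) ≠ 0 := by exact_mod_cast hp.out.ne_zero
      simp [fromBlocks_multiply, this]⟩, (p : ℝ), by exact_mod_cast hp.out.pos, by
      simp [fromBlocks_multiply, fromBlocks_transpose, J, fromBlocks_smul]⟩

/-- The double coset `Γ₀(N) diag (1, …, 1, p, …, p) Γ₀(N)` of the correspondence `T_p`. The points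
of `T_p(x)`, for `x` the class of `Z`, are the classes of `σ • Z`, `σ ∈ heckeTp`. -/
def heckeTp (n : Type) [Fintype n] [DecidableEq n] (p : ℕ) [Fact p.Prime] (N : ℕ) :
    Set (GSpPos n) :=
  DoubleCoset.doubleCoset (tauP n p) (Gamma0 n N) (Gamma0 n N)

/-! ### The unitary group `GU(r, s)` and the subvariety `V` -/

section Unitary

variable (r s : ℕ)

/-- `E_{rs} = diag (1, …, 1, -1, …, -1)`. -/
def Ers (R : Type) [CommRing R] : Matrix (Fin r ⊕ Fin s) (Fin r ⊕ Fin s) R :=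
  fromBlocks 1 0 0 (-1)

/-- `h + k √-Δ` lies in `GU(r, s)(R)` with multiplier `c`, i.e. `g E ḡᵗ = c E` for
`g = h + k √-Δ`. -/
def IsUnitarySimilitude {R : Type} [CommRing R] (Δ : R)
    (h k : Matrix (Fin r ⊕ Fin s) (Fin r ⊕ Fin s) R) (c : Rˣ) : Prop :=
  h * Ers r s R * hᵀ + Δ • (k * Ers r s R * kᵀ) = c.val • Ers r s R ∧
    k * Ers r s R * hᵀ = h * Ers r s R * kᵀ

/-- The embedding `α : GU(r, s) → GSp_{2g}`, `g = r + s`, on `h + k √-Δ`. -/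
def alpha {R : Type} [CommRing R] (Δ : R) (h k : Matrix (Fin r ⊕ Fin s) (Fin r ⊕ Fin s) R) :
    Matrix ((Fin r ⊕ Fin s) ⊕ (Fin r ⊕ Fin s)) ((Fin r ⊕ Fin s) ⊕ (Fin r ⊕ Fin s)) R :=
  fromBlocks h (k * Ers r s R) (-(Δ • (Ers r s R * k))) (Ers r s R * h * Ers r s R)

/-- The Hermitian symmetric domain `D_V` inside the Siegel upper half space: the orbit under
`α(GU(r, s)(ℝ))` of the point `(i / √Δ) · 1`, which is the fixed point of
`α(h_V(z))`, `z ∈ ℂˣ`, for the standard `h_V(z) = diag (z, …, z, z̄, …, z̄)`. The subvariety `V` of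
the Siegel variety is the image of `D_V`. -/
def domainV (Δ : ℕ) : Set (SiegelSpace (Fin r ⊕ Fin s)) :=
  {Z | ∃ Z₀ : SiegelSpace (Fin r ⊕ Fin s),
    Z₀.1 = (Complex.I / (Real.sqrt Δ : ℂ)) • (1 : Matrix (Fin r ⊕ Fin s) (Fin r ⊕ Fin s) ℂ) ∧
    ∃ (M : GSpPos (Fin r ⊕ Fin s)) (h k : Matrix (Fin r ⊕ Fin s) (Fin r ⊕ Fin s) ℝ) (c : ℝˣ),
      IsUnitarySimilitude r s (Δ : ℝ) h k c ∧ M.1.val = alpha r s (Δ : ℝ) h k ∧ Z = M • Z₀}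

/-! ### Types of elements of `T_p`, and the bad ones -/

/-- The isotropic subspace `W_σ` of `A_t[p] = 𝔽_p^{2g}` (row vectors): the span of the rows of
`σ mod p`. -/
def isoSubspace (p : ℕ) {m : Type} (S : Matrix m m ℤ) : Submodule (ZMod p) (m → ZMod p) :=
  Submodule.span (ZMod p) (Set.range fun i j => (S i j : ZMod p))

/-- The number `dim_{𝔽_p} (𝔽_{p²} W_σ)`. The field `𝔽_{p²} = O_K / p` acts on `𝔽_p^{2g}` with
`√-Δ` acting as right multiplication by `α(√-Δ)`, so `𝔽_{p²} W = W + √-Δ W`. -/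
noncomputable def dimOKSpan (p Δ : ℕ)
    (S : Matrix ((Fin r ⊕ Fin s) ⊕ (Fin r ⊕ Fin s)) ((Fin r ⊕ Fin s) ⊕ (Fin r ⊕ Fin s)) ℤ) : ℕ :=
  Module.finrank (ZMod p)
    ↥(isoSubspace p S ⊔ (isoSubspace p S).map (alpha r s (Δ : ZMod p) 0 1).vecMulLinear)

/-- `σ` is bad: the integer `j = dim_{𝔽_p} (𝔽_{p²} W_σ)` differs from `g` and `2g`. -/
def IsBad (p Δ : ℕ) (σ : GSpPos (Fin r ⊕ Fin s)) : Prop :=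
  ∃ S, σ.1.val = S.map (Int.cast : ℤ → ℝ) ∧
    dimOKSpan r s p Δ S ≠ r + s ∧ dimOKSpan r s p Δ S ≠ 2 * (r + s)

/-- D-equivalence of integral `σ₁`, `σ₂`: there is `g ∈ GU(r, s)(ℤ_p)` with
`σ₁ α(g) σ₂⁻¹ ∈ GSp_{2g}(ℤ_p)`. (An element `u` as below is a symplectic similitude if `σ₁`, `σ₂`
have the same multiplier.) -/
def DEquiv (p : ℕ) [Fact p.Prime] (Δ : ℕ) (σ₁ σ₂ : GSpPos (Fin r ⊕ Fin s)) : Prop :=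
  ∃ S₁ S₂ : Matrix ((Fin r ⊕ Fin s) ⊕ (Fin r ⊕ Fin s)) ((Fin r ⊕ Fin s) ⊕ (Fin r ⊕ Fin s)) ℤ,
    σ₁.1.val = S₁.map (Int.cast : ℤ → ℝ) ∧ σ₂.1.val = S₂.map (Int.cast : ℤ → ℝ) ∧
    ∃ (h k : Matrix (Fin r ⊕ Fin s) (Fin r ⊕ Fin s) ℤ_[p]) (c : ℤ_[p]ˣ),
      IsUnitarySimilitude r s (Δ : ℤ_[p]) h k c ∧
      ∃ u : GL ((Fin r ⊕ Fin s) ⊕ (Fin r ⊕ Fin s)) ℤ_[p],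
        S₁.map (Int.cast : ℤ → ℤ_[p]) * alpha r s (Δ : ℤ_[p]) h k =
          u.val * S₂.map (Int.cast : ℤ → ℤ_[p])

/-! ### Components of `T_p(V)`, and the degree of the second projection -/

/-- The graph, in `V × X`, of the part of `T_p` restricted to `V` that is given by a set `Sg` of
elements `σ`: the pairs of classes of `t` and `σ • t`, with `t ∈ D_V` and `σ ∈ Sg`.

For `Sg = {σ}` this is the image of the connected `D_V` under `t ↦ ([t], [σ • t])`, i.e. the graph
of the irreducible part of the correspondence that contains `σ` (it does not change if `σ` varies
in `Γ₀(N) σ (Γ₀(N) ∩ α(GU(r, s)(ℚ)))`). For `Sg` a D-equivalence class it is the graph of the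
component that corresponds to this class. -/
def heckeGraph (Δ N : ℕ) (Sg : Set (GSpPos (Fin r ⊕ Fin s))) :
    Set (SiegelVariety (Fin r ⊕ Fin s) N × SiegelVariety (Fin r ⊕ Fin s) N) :=
  {q | ∃ t ∈ domainV r s Δ, ∃ σ ∈ Sg, q = (toVariety N t, toVariety N (σ • t))}

/-- The corresponding part `V_i ⊆ X` of `T_p(V)`: the points `[σ • t]`, `t ∈ D_V`, `σ ∈ Sg`
(with the topology induced from the Siegel variety). -/
def heckeImage (Δ N : ℕ) (Sg : Set (GSpPos (Fin r ⊕ Fin s))) :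
    Set (SiegelVariety (Fin r ⊕ Fin s) N) :=
  {x | ∃ t ∈ domainV r s Δ, ∃ σ ∈ Sg, x = toVariety N (σ • t)}

/-- The second projection `π₂` from the graph to the corresponding part of `T_p(V)`. -/
def piTwo (Δ N : ℕ) (Sg : Set (GSpPos (Fin r ⊕ Fin s))) (q : heckeGraph r s Δ N Sg) :
    heckeImage r s Δ N Sg :=
  ⟨q.1.2, by
    obtain ⟨t, ht, σ, hσ, h⟩ := q.2
    exact ⟨t, ht, σ, hσ, by rw [h]⟩⟩

end Unitary

/-- `π` has (generic) degree `d`: over a dense open set its fibres have exactly `d` points. -/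
def HasDegree {G Y : Type} [TopologicalSpace Y] (π : G → Y) (d : ℕ) : Prop :=
  ∃ U : Set Y, IsOpen U ∧ Dense U ∧ ∀ y ∈ U, (π ⁻¹' {y}).encard = d

/-!
Write `ω = √-Δ` for the matrix `α(√-Δ)`. The centralizer of `ω` in `GSp⁺` is the real unitary
similitude group, and `D_V` is the orbit of the base point under it (`mem_domainV_iff`); in
particular `ω` fixes `D_V` pointwise.

*Generic points.* Call a point of the Siegel space generic if the elements with denominator dividing
`p` and multiplier at most `Δ` that fix it generate at most a plane `ℝ + ℝ a`. Such elements are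
bounded near a given point, by compactness of the unit sphere for the norm that the point defines on
`ℝ⁶`; hence only finitely many of them fix it, and the set of those which fix a point can only
shrink at neighbouring points. So the generic points form an open set (`isOpen_generic`). They are
dense in `σ D_V` (`exists_generic`), because a similitude that fixes `D_V` pointwise near a point
lies in `ℝ + ℝ ω`, as one sees by moving the point by Lorentz boosts (`eq_of_fixes_near`).

*The fibre in terms of lattices.* Let `σ t` be generic and let `t'` be a point of `D_V` with
`σ' t' = γ σ t`, for `γ` in `Γ₀(N)` and `σ'` in the same double coset. Then `ρ = σ'⁻¹ γ σ` takes `t`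
to `t'`, and `ρ⁻¹ ω ρ` fixes `t`, so that it lies in `ℝ + ℝ ω` and equals `±ω`. The sign is `+`,
since an element that anticommutes with `ω` would exchange `q` and `-q` up to a positive factor for
a quadratic form `q` of signature `(4, 2)` (`ne_neg_of_signature`). So `ρ` is unitary. On row
vectors, with `Λ = ℤ⁶ = ℤ[√-Δ]³`, the lattice `Λρ` is unimodular, stable under `ℤ[√-Δ]`, and lies
between `Λσ` and `p⁻¹ Λσ`.

*Counting the lattices.* If `σ` is bad, then the orthogonal complement of `𝔽_{p²} W_σ` is an isotropic
`𝔽_{p²}`-line contained in `W_σ` (`exists_line`, `exists_flag`). The unimodular lattices in question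
correspond to the isotropic lines of a hyperbolic plane over `𝔽_{p²}`, and there are `p + 1` of
these. Concretely, for an isotropic lift `e` of a generator of the line and an isotropic `f` that
pairs with `e` to a unit modulo `p`, the lattices are the images of `Λ` under the elements `rep`:
the identity and `p` products of a transvection along `e` with a transvection along `f`
(`le_or_exists_transv`). With the factor `N` in their parameters, these transvections are conjugated
into `Γ₀(N)` by `σ` (`conj_rep_mem`), so that each `rep i • t` does lie in the fibre; no strong
approximation is needed.

*Distinctness.* If `rep i • t` and `rep k • t` have the same class, then some
`κ = (rep k)⁻¹ δ (rep i)` with `δ` in `Γ₀(N)` fixes `t`, hence is an element of norm one of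
`ℝ + ℝ ω`, with denominator a power of `p`. As `p` is inert, `κ` is integral
(`intMat_of_norm_eq_one`), and then the two lattices agree (`rep_injective`).

The argument only needs that all elements of `Σ` are bad, which for a D-equivalence class follows
from `isBad_of_dEquiv`. A bad element is written down in `exists_bad`.
-/

namespace PicardHecke

open scoped Topology ComplexConjugate

/-! ### The matrix of multiplication by `√-Δ` -/

section UnitaryGroup

variable (r s : ℕ)

theorem Ers_mul_self (R : Type) [CommRing R] : Ers r s R * Ers r s R = 1 := by
  simp [Ers, fromBlocks_multiply]

theorem Ers_transpose (R : Type) [CommRing R] : (Ers r s R)ᵀ = Ers r s R := by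
  simp [Ers, fromBlocks_transpose]

/-- The matrix `α(√-Δ)` of multiplication by `√-Δ`. -/
def rootMat {R : Type} [CommRing R] (Δ : R) :
    Matrix ((Fin r ⊕ Fin s) ⊕ (Fin r ⊕ Fin s)) ((Fin r ⊕ Fin s) ⊕ (Fin r ⊕ Fin s)) R :=
  alpha r s Δ 0 1

variable {r s} {R : Type} [CommRing R] {Δ : R}

theorem rootMat_eq : rootMat r s Δ = fromBlocks 0 (Ers r s R) (-(Δ • Ers r s R)) 0 := by
  simp [rootMat, alpha]

theorem rootMat_mul_self : rootMat r s Δ * rootMat r s Δ = -(Δ • 1) := by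
  simp [rootMat_eq, fromBlocks_multiply, Ers_mul_self, ← fromBlocks_one, fromBlocks_smul,
    fromBlocks_neg]

theorem rootMat_similitude :
    rootMat r s Δ * J _ R * (rootMat r s Δ)ᵀ = Δ • J _ R := by
  simp [rootMat_eq, fromBlocks_multiply, J, fromBlocks_transpose, Ers_transpose, Ers_mul_self,
    fromBlocks_smul]

theorem rootMat_mul_J :
    rootMat r s Δ * J _ R = fromBlocks (Ers r s R) 0 0 (Δ • Ers r s R) := by
  simp [rootMat_eq, fromBlocks_multiply, J]

theorem alpha_mul_rootMat (h k : Matrix (Fin r ⊕ Fin s) (Fin r ⊕ Fin s) R) :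
    alpha r s Δ h k * rootMat r s Δ = rootMat r s Δ * alpha r s Δ h k := by
  have e := Ers_mul_self r s R
  have e1 : ∀ X : Matrix (Fin r ⊕ Fin s) (Fin r ⊕ Fin s) R, X * Ers r s R * Ers r s R = X :=
    fun X => by rw [Matrix.mul_assoc, e, Matrix.mul_one]
  have e2 : ∀ X : Matrix (Fin r ⊕ Fin s) (Fin r ⊕ Fin s) R, Ers r s R * (Ers r s R * X) = X :=
    fun X => by rw [← Matrix.mul_assoc, e, Matrix.one_mul]
  simp only [rootMat_eq, alpha, fromBlocks_multiply]
  simp [Matrix.mul_assoc, e1, e2]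

/-- `α` takes a unitary similitude to a symplectic similitude with the same multiplier. -/
theorem alpha_similitude {h k : Matrix (Fin r ⊕ Fin s) (Fin r ⊕ Fin s) R} {c : Rˣ}
    (H : IsUnitarySimilitude r s Δ h k c) :
    alpha r s Δ h k * J _ R * (alpha r s Δ h k)ᵀ = c.val • J _ R := by
  have e := Ers_mul_self r s R
  have e1 : ∀ X : Matrix (Fin r ⊕ Fin s) (Fin r ⊕ Fin s) R, Ers r s R * (Ers r s R * X) = X :=
    fun X => by rw [← Matrix.mul_assoc, e, Matrix.one_mul]
  obtain ⟨H1, H2⟩ := H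
  rw [Matrix.mul_assoc, Matrix.mul_assoc] at H2
  have H3 := congrArg (fun X => X * Ers r s R) H1
  have H4 := congrArg (fun X => Ers r s R * X) H1
  have H5 := congrArg (fun X => Ers r s R * X * Ers r s R) H2
  simp only [Matrix.add_mul, Matrix.mul_add, Matrix.smul_mul, Matrix.mul_smul, Matrix.mul_assoc,
    e] at H3 H4 H5
  simp only [alpha, fromBlocks_multiply, J, fromBlocks_transpose, fromBlocks_smul,
    transpose_mul, transpose_neg, transpose_smul, Ers_transpose, Matrix.mul_assoc]
  congr 1
  · simp [H2, Matrix.mul_assoc]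
  · simp only [Matrix.mul_zero, Matrix.mul_one, Matrix.mul_neg, zero_add, add_zero,
      Matrix.mul_smul, Matrix.neg_mul, Matrix.mul_assoc, smul_neg] at H3 ⊢
    rw [← H3]; abel
  · simp only [Matrix.mul_zero, Matrix.mul_one, Matrix.mul_neg, zero_add, add_zero,
      Matrix.mul_assoc, Matrix.smul_mul, neg_neg] at H4 ⊢
    rw [← H4]
  · simp only [Matrix.mul_zero, Matrix.mul_one, Matrix.mul_neg, zero_add, add_zero,
      Matrix.mul_smul, Matrix.mul_assoc, Matrix.smul_mul, neg_neg, smul_zero]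
    rw [H5]; abel

/-- A symplectic similitude that commutes with `α(√-Δ)` comes from the unitary group. -/
theorem exists_alpha_of_commute
    {M : Matrix ((Fin r ⊕ Fin s) ⊕ (Fin r ⊕ Fin s)) ((Fin r ⊕ Fin s) ⊕ (Fin r ⊕ Fin s)) R} {c : Rˣ}
    (hM : M * J _ R * Mᵀ = c.val • J _ R) (hc : M * rootMat r s Δ = rootMat r s Δ * M) :
    ∃ h k, IsUnitarySimilitude r s Δ h k c ∧ M = alpha r s Δ h k := by
  have e := Ers_mul_self r s R
  have e1 : ∀ X : Matrix (Fin r ⊕ Fin s) (Fin r ⊕ Fin s) R, Ers r s R * (Ers r s R * X) = X :=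
    fun X => by rw [← Matrix.mul_assoc, e, Matrix.one_mul]
  obtain ⟨A, B, C, D, rfl⟩ : ∃ A B C D, M = fromBlocks A B C D :=
    ⟨_, _, _, _, (fromBlocks_toBlocks M).symm⟩
  simp only [rootMat_eq, fromBlocks_multiply, Matrix.mul_zero, zero_add, add_zero,
    Matrix.zero_mul, fromBlocks_inj, Matrix.mul_neg, Matrix.neg_mul, Matrix.mul_smul,
    Matrix.smul_mul] at hc
  obtain ⟨h1, h2, -, -⟩ := hc
  have hC : C = -(Δ • (Ers r s R * (B * Ers r s R))) := by
    rw [← e1 C, ← h1]; simp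
  have hD : D = Ers r s R * (A * Ers r s R) := by rw [h2, e1]
  have hal : fromBlocks A B C D = alpha r s Δ A (B * Ers r s R) := by
    simp [alpha, hC, hD, Matrix.mul_assoc, e]
  refine ⟨A, B * Ers r s R, ?_, hal⟩
  subst hC hD
  simp only [fromBlocks_multiply, J, fromBlocks_transpose, fromBlocks_smul, Matrix.mul_zero,
    Matrix.mul_one, Matrix.mul_neg, zero_add, add_zero, transpose_neg, transpose_smul,
    transpose_mul, Ers_transpose, fromBlocks_inj, Matrix.mul_smul, Matrix.neg_mul,
    smul_zero, smul_neg] at hM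
  obtain ⟨m1, m2, -, -⟩ := hM
  have m3 := congrArg (fun X => -X * Ers r s R) m2
  simp only [neg_add, neg_neg, Matrix.add_mul, Matrix.smul_mul, Matrix.mul_assoc, e,
    Matrix.mul_one, Matrix.one_mul] at m3
  refine ⟨?_, ?_⟩
  · simp only [transpose_mul, Ers_transpose, Matrix.mul_assoc, e1]
    rw [← m3]; abel
  · simp only [transpose_mul, Ers_transpose, Matrix.mul_assoc, e1]
    exact sub_eq_zero.1 (by rw [sub_eq_add_neg]; exact m1)

end UnitaryGroup

/-! ### Elements of `GSp⁺` and their action -/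

section Points

variable {n : Type} [Fintype n] [DecidableEq n]

theorem smul_val (M : GSpPos n) (Z : SiegelSpace n) :
    (M • Z).1 = moebNum M.1.val Z.1 * (moebDenom M.1.val Z.1)⁻¹ := rfl

theorem isUnit_moebDenom (M : GSpPos n) (Z : SiegelSpace n) :
    IsUnit (moebDenom M.1.val Z.1).det := by
  obtain ⟨c, hc, h⟩ := GSpPos_similitude M
  exact moebDenom_isUnit hc h Z

theorem smul_eq_iff (M : GSpPos n) (Z W : SiegelSpace n) :
    M • Z = W ↔ moebNum M.1.val Z.1 = W.1 * moebDenom M.1.val Z.1 := by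
  have hu := isUnit_moebDenom M Z
  rw [Subtype.ext_iff, smul_val]
  constructor
  · intro h
    rw [← h, Matrix.nonsing_inv_mul_cancel_right _ _ hu]
  · intro h
    rw [h, Matrix.mul_nonsing_inv_cancel_right _ _ hu]

theorem ext_val {M M' : GSpPos n} (h : M.1.val = M'.1.val) : M = M' :=
  Subtype.ext (Units.ext h)

theorem val_mul (M M' : GSpPos n) : (M * M').1.val = M.1.val * M'.1.val := rfl

theorem val_mul_val_inv (M : GSpPos n) : M.1.val * (M⁻¹).1.val = 1 := by
  rw [← val_mul, mul_inv_cancel]; rfl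

theorem val_inv_mul_val (M : GSpPos n) : (M⁻¹).1.val * M.1.val = 1 := by
  rw [← val_mul, inv_mul_cancel]; rfl

/-- A real matrix `M` with `M J Mᵗ = c J`, `c > 0`, as an element of `GSp⁺`. -/
noncomputable def ofSimilitude (M : Matrix (n ⊕ n) (n ⊕ n) ℝ) (c : ℝ) (hc : 0 < c)
    (h : M * J n ℝ * Mᵀ = c • J n ℝ) : GSpPos n :=
  have h1 : M * (c⁻¹ • (J n ℝ * Mᵀ * (-J n ℝ))) = 1 := by
    rw [Matrix.mul_smul, ← Matrix.mul_assoc, ← Matrix.mul_assoc, h, Matrix.smul_mul, smul_smul,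
      inv_mul_cancel₀ hc.ne', one_smul, Matrix.mul_neg, J_squared, neg_neg]
  ⟨⟨M, _, h1, mul_eq_one_comm.1 h1⟩, c, hc, h⟩

theorem ofSimilitude_val (M : Matrix (n ⊕ n) (n ⊕ n) ℝ) (c : ℝ) (hc : 0 < c)
    (h : M * J n ℝ * Mᵀ = c • J n ℝ) : (ofSimilitude M c hc h).1.val = M := rfl

end Points

/-! ### The domain `D_V` and the centralizer of `√-Δ` -/

section Domain

variable (r s : ℕ) {Δ : ℕ} (hΔ : 0 < Δ)

/-- `α(√-Δ)` as an element of `GSp⁺`. -/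
noncomputable def rootG : GSpPos (Fin r ⊕ Fin s) :=
  ofSimilitude (rootMat r s (Δ : ℝ)) Δ (by exact_mod_cast hΔ) rootMat_similitude

theorem rootG_val : (rootG r s hΔ).1.val = rootMat r s (Δ : ℝ) := rfl

theorem smul_one_mem {n : Type} [Fintype n] [DecidableEq n] {P : Matrix n n ℝ} (hP : P.PosDef)
    (hΔ : 0 < Δ) :
    ((Complex.I / (Real.sqrt Δ : ℂ)) • P.map Complex.ofReal).IsSymm ∧
      (((Complex.I / (Real.sqrt Δ : ℂ)) • P.map Complex.ofReal).map Complex.im).PosDef := by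
  have hs : Pᵀ = P := by
    have := hP.1
    rwa [IsHermitian, conjTranspose_eq_transpose_of_trivial] at this
  constructor
  · rw [IsSymm, transpose_smul, ← transpose_map, hs]
  · have hq : 0 < (Real.sqrt Δ)⁻¹ := inv_pos.2 (Real.sqrt_pos.2 (by exact_mod_cast hΔ))
    have e : ((Complex.I / (Real.sqrt Δ : ℂ)) • P.map Complex.ofReal).map Complex.im
        = (Real.sqrt Δ)⁻¹ • P := by
      ext i j
      have : Complex.I / (Real.sqrt Δ : ℂ) * (P i j : ℂ)
          = (((Real.sqrt Δ)⁻¹ * P i j : ℝ) : ℂ) * Complex.I := by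
        push_cast; ring
      simp [this, Real.sqrt_div_self]
    rw [e]
    exact hP.smul hq

/-- The point `(i/√Δ) P` of the Siegel upper half space, for a positive definite real `P`. -/
noncomputable def imPoint {n : Type} [Fintype n] [DecidableEq n] (hΔ : 0 < Δ) (P : Matrix n n ℝ)
    (hP : P.PosDef) : SiegelSpace n :=
  ⟨(Complex.I / (Real.sqrt Δ : ℂ)) • P.map Complex.ofReal, smul_one_mem hP hΔ⟩

/-- The base point `(i/√Δ) 1` of the domain `D_V`. -/
noncomputable def basePoint {n : Type} [Fintype n] [DecidableEq n] (hΔ : 0 < Δ) : SiegelSpace n :=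
  imPoint hΔ 1 PosDef.one

theorem basePoint_val {n : Type} [Fintype n] [DecidableEq n] (hΔ : 0 < Δ) :
    (basePoint hΔ : SiegelSpace n).1 = (Complex.I / (Real.sqrt Δ : ℂ)) • 1 := by
  simp [basePoint, imPoint]

variable {r s}

theorem sqrt_sq_ofReal : ((Real.sqrt Δ : ℂ)) * (Real.sqrt Δ : ℂ) = (Δ : ℂ) := by
  rw [← Complex.ofReal_mul, Real.mul_self_sqrt (Nat.cast_nonneg _)]; simp

theorem sqrt_ne_zero_ofReal (hΔ : 0 < Δ) : (Real.sqrt Δ : ℂ) ≠ 0 := by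
  have : 0 < Real.sqrt Δ := Real.sqrt_pos.2 (by exact_mod_cast hΔ)
  exact_mod_cast this.ne'

/-- A similitude with blocks `A, B, C, D` fixes the point `(i/√Δ) P`, `P` real, if and only if
`A P = P D` and `Δ B = - P C P`: these are the imaginary and the real part of
`A Z + B = Z (C Z + D)`. -/
theorem smul_imPoint_eq_iff {n : Type} [Fintype n] [DecidableEq n] (M : GSpPos n) {P : Matrix n n ℝ}
    (hP : P.PosDef) :
    M • imPoint hΔ P hP = imPoint hΔ P hP ↔
      M.1.val.toBlocks₁₁ * P = P * M.1.val.toBlocks₂₂ ∧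
        (Δ : ℝ) • M.1.val.toBlocks₁₂ = -(P * M.1.val.toBlocks₂₁ * P) := by
  rw [smul_eq_iff]
  simp only [moebNum, moebDenom, imPoint]
  generalize M.1.val.toBlocks₁₁ = A
  generalize M.1.val.toBlocks₁₂ = B
  generalize M.1.val.toBlocks₂₁ = C
  generalize M.1.val.toBlocks₂₂ = D
  have hm : ∀ X Y : Matrix n n ℝ,
      (X * Y).map Complex.ofReal = X.map Complex.ofReal * Y.map Complex.ofReal :=
    fun X Y => Matrix.map_mul (f := Complex.ofRealHom)
  have hs := sqrt_sq_ofReal (Δ := Δ)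
  have hs0 := sqrt_ne_zero_ofReal hΔ
  have hΔ' : (Δ : ℂ) ≠ 0 := by exact_mod_cast hΔ.ne'
  have hq : (Real.sqrt Δ)⁻¹ ≠ 0 := inv_ne_zero (by exact_mod_cast hs0)
  have hI : Complex.I / (Real.sqrt Δ : ℂ) * (Complex.I / (Real.sqrt Δ : ℂ)) = -(Δ : ℂ)⁻¹ := by
    rw [div_mul_div_comm, hs, Complex.I_mul_I]; ring
  simp only [Matrix.mul_add, Matrix.mul_smul, Matrix.smul_mul, smul_smul, ← Matrix.mul_assoc, hI,
    ← hm]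
  rw [← Matrix.ext_iff, ← Matrix.ext_iff, ← Matrix.ext_iff, ← forall_and]
  refine forall_congr' fun i => ?_
  rw [← forall_and]
  refine forall_congr' fun j => ?_
  simp only [Matrix.add_apply, Matrix.smul_apply, map_apply, smul_eq_mul, Matrix.neg_apply]
  generalize (A * P) i j = a
  generalize (P * D) i j = d
  generalize (P * C * P) i j = c
  generalize B i j = b
  have e1 : Complex.I / (Real.sqrt Δ : ℂ) * (a : ℂ) + b
      = ⟨b, (Real.sqrt Δ)⁻¹ * a⟩ := by
    have : Complex.I / (Real.sqrt Δ : ℂ) * (a : ℂ)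
          = (((Real.sqrt Δ)⁻¹ * a : ℝ) : ℂ) * Complex.I := by push_cast; ring
    rw [this]; apply Complex.ext <;> simp [Real.sqrt_div_self]
  have e2 : -(Δ : ℂ)⁻¹ * (c : ℂ) + Complex.I / (Real.sqrt Δ : ℂ) * d
      = ⟨-(Δ : ℝ)⁻¹ * c, (Real.sqrt Δ)⁻¹ * d⟩ := by
    have : Complex.I / (Real.sqrt Δ : ℂ) * (d : ℂ)
          = (((Real.sqrt Δ)⁻¹ * d : ℝ) : ℂ) * Complex.I := by push_cast; ring
    have h' : -(Δ : ℂ)⁻¹ * (c : ℂ) = ((-(Δ : ℝ)⁻¹ * c : ℝ) : ℂ) := by push_cast; ring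
    rw [this, h']; apply Complex.ext <;> simp [Real.sqrt_div_self]
  rw [e1, e2, Complex.mk.injEq, and_comm]
  have hΔr : (Δ : ℝ) ≠ 0 := by exact_mod_cast hΔ.ne'
  refine and_congr (mul_right_inj' hq) ?_
  constructor
  · rintro rfl; field_simp
  · intro h
    apply mul_left_cancel₀ hΔr
    rw [h]; field_simp

theorem rootG_smul_basePoint :
    rootG r s hΔ • (basePoint hΔ : SiegelSpace (Fin r ⊕ Fin s)) = basePoint hΔ := by
  rw [basePoint, smul_imPoint_eq_iff]
  simp [rootG_val, rootMat_eq]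

theorem commute_rootG_iff {M : GSpPos (Fin r ⊕ Fin s)} :
    Commute M (rootG r s hΔ) ↔
      M.1.val * rootMat r s (Δ : ℝ) = rootMat r s (Δ : ℝ) * M.1.val :=
  ⟨fun h => congrArg (fun X : GSpPos _ => X.1.val) h, fun h => ext_val h⟩

/-- `D_V` is the orbit of the base point under the centralizer of `α(√-Δ)` in `GSp⁺`. -/
theorem mem_domainV_iff {Z : SiegelSpace (Fin r ⊕ Fin s)} :
    Z ∈ domainV r s Δ ↔
      ∃ M : GSpPos (Fin r ⊕ Fin s), Commute M (rootG r s hΔ) ∧ Z = M • basePoint hΔ := by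
  constructor
  · rintro ⟨Z₀, h0, M, h, k, c, -, h2, rfl⟩
    refine ⟨M, ?_, ?_⟩
    · rw [commute_rootG_iff, h2, alpha_mul_rootMat]
    · congr 1
      exact Subtype.ext (h0.trans (basePoint_val hΔ).symm)
  · rintro ⟨M, hM, rfl⟩
    obtain ⟨c, hc, hMJ⟩ := M.2
    obtain ⟨h, k, h1, h2⟩ := exists_alpha_of_commute (c := Units.mk0 c hc.ne') hMJ
      ((commute_rootG_iff hΔ).1 hM)
    exact ⟨basePoint hΔ, basePoint_val hΔ, M, h, k, _, h1, h2, rfl⟩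

theorem smul_mem_domainV {M : GSpPos (Fin r ⊕ Fin s)} (hM : Commute M (rootG r s hΔ))
    {Z : SiegelSpace (Fin r ⊕ Fin s)} (hZ : Z ∈ domainV r s Δ) : M • Z ∈ domainV r s Δ := by
  rw [mem_domainV_iff hΔ] at hZ ⊢
  obtain ⟨M', hM', rfl⟩ := hZ
  exact ⟨M * M', hM.mul_left hM', (mul_smul _ _ _).symm⟩

theorem rootG_smul_of_mem {Z : SiegelSpace (Fin r ⊕ Fin s)} (hZ : Z ∈ domainV r s Δ) :
    rootG r s hΔ • Z = Z := by
  rw [mem_domainV_iff hΔ] at hZ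
  obtain ⟨M, hM, rfl⟩ := hZ
  rw [← mul_smul, ← hM.eq, mul_smul, rootG_smul_basePoint]

/-- No element of `GSp⁺` anticommutes with `α(√-Δ)` in signature `(2, 1)`: it would
multiply the quadratic form with matrix `α(√-Δ) J`, which has signature `(4, 2)`, by a negative
number. -/
theorem ne_neg_of_signature (hΔ : 0 < Δ) (M : GSpPos (Fin 2 ⊕ Fin 1))
    (hM : M.1.val * rootMat 2 1 (Δ : ℝ) = -(rootMat 2 1 (Δ : ℝ) * M.1.val)) : False := by
  obtain ⟨c, hc, h⟩ := M.2
  set A := M.1.val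
  set S := rootMat 2 1 (Δ : ℝ) * J _ ℝ with hS
  have h1 : A * S * Aᵀ = -(c • S) := by
    rw [hS, ← Matrix.mul_assoc A, hM, Matrix.neg_mul, Matrix.neg_mul,
      Matrix.mul_assoc (rootMat 2 1 (Δ : ℝ)),
      Matrix.mul_assoc (rootMat 2 1 (Δ : ℝ)), h, Matrix.mul_smul]
  have hQ : ∀ x, (x ᵥ* A) ⬝ᵥ (S *ᵥ (x ᵥ* A)) = -(c * (x ⬝ᵥ (S *ᵥ x))) := by
    intro x
    have e : S *ᵥ (x ᵥ* A) = (S * Aᵀ) *ᵥ x := by rw [← mulVec_transpose, mulVec_mulVec]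
    rw [e, ← dotProduct_mulVec, mulVec_mulVec, ← Matrix.mul_assoc, h1]
    simp [neg_mulVec, smul_mulVec]
  -- `S` is positive definite on the four-dimensional space of the vectors `x` with `x₃ = x₆ = 0`.
  have hS' : ∀ x : (Fin 2 ⊕ Fin 1) ⊕ (Fin 2 ⊕ Fin 1) → ℝ, x (.inl (.inr 0)) = 0 →
      x (.inr (.inr 0)) = 0 → x ⬝ᵥ (S *ᵥ x) =
        (x (.inl (.inl 0))) ^ 2 + (x (.inl (.inl 1))) ^ 2 +
          Δ * ((x (.inr (.inl 0))) ^ 2 + (x (.inr (.inl 1))) ^ 2) := by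
    intro x h3 h6
    rw [hS, rootMat_mul_J]
    simp [dotProduct, mulVec, Ers, Matrix.one_apply, h3, h6, fromBlocks]
    ring
  let L : ((Fin 2 ⊕ Fin 1) ⊕ (Fin 2 ⊕ Fin 1) → ℝ) →ₗ[ℝ] (Fin 4 → ℝ) :=
    LinearMap.pi ![LinearMap.proj (.inl (.inr 0)), LinearMap.proj (.inr (.inr 0)),
      LinearMap.proj (.inl (.inr 0)) ∘ₗ A.vecMulLinear,
      LinearMap.proj (.inr (.inr 0)) ∘ₗ A.vecMulLinear]
  have hker := LinearMap.ker_ne_bot_of_finrank_lt (f := L) (by simp)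
  obtain ⟨x, hx, hx0⟩ := (Submodule.ne_bot_iff _).1 hker
  rw [LinearMap.mem_ker] at hx
  have x0 : x (.inl (.inr 0)) = 0 := congrFun hx 0
  have x1 : x (.inr (.inr 0)) = 0 := congrFun hx 1
  have x2 : (x ᵥ* A) (.inl (.inr 0)) = 0 := congrFun hx 2
  have x3 : (x ᵥ* A) (.inr (.inr 0)) = 0 := congrFun hx 3
  have key := hQ x
  rw [hS' _ x0 x1, hS' _ x2 x3] at key
  have hΔ' : (0 : ℝ) < Δ := by exact_mod_cast hΔ
  have hnn : 0 ≤ c * ((x (.inl (.inl 0))) ^ 2 + (x (.inl (.inl 1))) ^ 2 +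
          Δ * ((x (.inr (.inl 0))) ^ 2 + (x (.inr (.inl 1))) ^ 2)) := by positivity
  have hnn' : 0 ≤ ((x ᵥ* A) (.inl (.inl 0))) ^ 2 + ((x ᵥ* A) (.inl (.inl 1))) ^ 2 +
          Δ * (((x ᵥ* A) (.inr (.inl 0))) ^ 2 + ((x ᵥ* A) (.inr (.inl 1))) ^ 2) := by positivity
  have hz : c * ((x (.inl (.inl 0))) ^ 2 + (x (.inl (.inl 1))) ^ 2 +
          Δ * ((x (.inr (.inl 0))) ^ 2 + (x (.inr (.inl 1))) ^ 2)) = 0 := by linarith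
  rw [mul_eq_zero, or_iff_right hc.ne'] at hz
  have p1 := sq_nonneg (x (.inl (.inl 0)))
  have p2 := sq_nonneg (x (.inl (.inl 1)))
  have p3 : 0 ≤ Δ * (x (.inr (.inl 0))) ^ 2 := by positivity
  have p4 : 0 ≤ Δ * (x (.inr (.inl 1))) ^ 2 := by positivity
  rw [mul_add] at hz
  have q1 : x (.inl (.inl 0)) = 0 := pow_eq_zero_iff two_ne_zero |>.1 (by linarith)
  have q2 : x (.inl (.inl 1)) = 0 := pow_eq_zero_iff two_ne_zero |>.1 (by linarith)
  have q3 : x (.inr (.inl 0)) = 0 := by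
    have : (Δ : ℝ) * (x (.inr (.inl 0))) ^ 2 = 0 := by linarith
    simpa [hΔ'.ne'] using this
  have q4 : x (.inr (.inl 1)) = 0 := by
    have : (Δ : ℝ) * (x (.inr (.inl 1))) ^ 2 = 0 := by linarith
    simpa [hΔ'.ne'] using this
  apply hx0
  funext i
  rcases i with (i | i) | (i | i) <;> fin_cases i <;> assumption

end Domain

/-! ### The norm of the periods -/

section Continuity

open scoped ComplexOrder

variable {n : Type} [Fintype n] [DecidableEq n]

theorem continuous_matrix_inv {X 𝕜 : Type*} [TopologicalSpace X] [NormedField 𝕜]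
    {f : X → Matrix n n 𝕜} (hf : Continuous f) (h : ∀ x, (f x).det ≠ 0) :
    Continuous fun x => (f x)⁻¹ := by
  simp only [Matrix.inv_def, Ring.inverse_eq_inv']
  exact (hf.matrix_det.inv₀ h).smul hf.matrix_adjugate

instance : ContinuousConstSMul (GSpPos n) (SiegelSpace n) where
  continuous_const_smul M := by
    refine Continuous.subtype_mk ?_ _
    have h1 : Continuous fun Z : SiegelSpace n => moebNum M.1.val Z.1 :=
      (continuous_const.matrix_mul continuous_subtype_val).add continuous_const
    have h2 : Continuous fun Z : SiegelSpace n => moebDenom M.1.val Z.1 :=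
      (continuous_const.matrix_mul continuous_subtype_val).add continuous_const
    exact h1.matrix_mul (continuous_matrix_inv h2 fun Z => (isUnit_moebDenom M Z).ne_zero)

/-- The real row vector `x` of length `2n` as an element of `ℂⁿ`, for the complex structure given
by the point `Z`: `x ↦ x (Z; 1)`. -/
def periodVec (x : n ⊕ n → ℝ) (Z : SiegelSpace n) : n → ℂ :=
  (fun i => (x i : ℂ)) ᵥ* (fromRows Z.1 1 : Matrix (n ⊕ n) n ℂ)

/-- The norm of `x ∈ ℝ²ⁿ` for the Hermitian metric of the principally polarized abelian variety
with period matrix `Z`. -/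
noncomputable def periodNorm (x : n ⊕ n → ℝ) (Z : SiegelSpace n) : ℝ :=
  (periodVec x Z ⬝ᵥ (((Z.1.map Complex.im).map Complex.ofReal)⁻¹ *ᵥ star (periodVec x Z))).re

theorem posDef_imC (Z : SiegelSpace n) : ((Z.1.map Complex.im).map Complex.ofReal).PosDef :=
  posDef_ofReal_iff.2 Z.2.2

theorem continuous_periodNorm :
    Continuous fun q : (n ⊕ n → ℝ) × SiegelSpace n => periodNorm q.1 q.2 := by
  have hv : Continuous fun q : (n ⊕ n → ℝ) × SiegelSpace n => periodVec q.1 q.2 := by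
    refine Continuous.matrix_vecMul ?_ ?_
    · exact continuous_pi fun i => Complex.continuous_ofReal.comp
        ((continuous_apply i).comp continuous_fst)
    · refine continuous_matrix fun i j => ?_
      rcases i with i | i
      · exact (continuous_subtype_val.comp continuous_snd).matrix_elem i j
      · exact continuous_const
  have hY : Continuous fun q : (n ⊕ n → ℝ) × SiegelSpace n =>
      ((q.2.1.map Complex.im).map Complex.ofReal)⁻¹ := by
    refine continuous_matrix_inv ?_ fun q => (posDef_imC q.2).det_pos.ne'
    exact ((continuous_subtype_val.comp continuous_snd).matrix_map Complex.continuous_im).matrix_map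
      Complex.continuous_ofReal
  exact Complex.continuous_re.comp (hv.dotProduct (hY.matrix_mulVec hv.star))

theorem periodNorm_pos {x : n ⊕ n → ℝ} (hx : x ≠ 0) (Z : SiegelSpace n) :
    0 < periodNorm x Z := by
  have hv : star (periodVec x Z) ≠ 0 := by
    rw [Ne, star_eq_zero]
    intro h
    apply hx
    have h1 : ∀ j, (∑ i, (x (.inl i) : ℂ) * Z.1 i j) + x (.inr j) = 0 := fun j => by
      have := congrFun h j
      simpa [periodVec, vecMul, dotProduct, Matrix.one_apply] using this
    have h2 : (fun i => x (.inl i)) ᵥ* (Z.1.map Complex.im) = 0 := by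
      funext j
      have := congrArg Complex.im (h1 j)
      simpa [vecMul, dotProduct] using this
    have hdet : (Z.1.map Complex.im).det ≠ 0 := Z.2.2.det_pos.ne'
    have h3 := Matrix.eq_zero_of_vecMul_eq_zero hdet h2
    funext i
    rcases i with i | i
    · exact congrFun h3 i
    · have := congrArg Complex.re (h1 i)
      have h4 : ∀ i, x (.inl i) = 0 := congrFun h3
      simpa [h4] using this
  have h := (posDef_imC Z).inv.dotProduct_mulVec_pos hv
  rw [star_star] at h
  exact (Complex.pos_iff.1 h).1

theorem periodNorm_smul (a : ℝ) (x : n ⊕ n → ℝ) (Z : SiegelSpace n) :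
    periodNorm (a • x) Z = a ^ 2 * periodNorm x Z := by
  have : periodVec (a • x) Z = (a : ℂ) • periodVec x Z := by
    rw [periodVec, periodVec, ← smul_vecMul]
    congr 1
    funext i
    simp
  rw [periodNorm, periodNorm, this, star_smul, smul_dotProduct, mulVec_smul, dotProduct_smul]
  simp [pow_two, mul_assoc]

/-- A similitude with multiplier `c` that fixes `Z` multiplies the norm defined by `Z` by `c`. -/
theorem periodNorm_vecMul {M : GSpPos n} {Z : SiegelSpace n} {c : ℝ} (hc : 0 < c)
    (hM : M.1.val * J n ℝ * M.1.valᵀ = c • J n ℝ) (hZ : M • Z = Z) (x : n ⊕ n → ℝ) :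
    periodNorm (x ᵥ* M.1.val) Z = c * periodNorm x Z := by
  set Q := moebDenom M.1.val Z.1 with hQ
  set Y := (Z.1.map Complex.im).map Complex.ofReal with hY
  have hnum := (smul_eq_iff _ _ _).1 hZ
  rw [← hQ] at hnum
  have hvec : periodVec (x ᵥ* M.1.val) Z = periodVec x Z ᵥ* Q := by
    have e : (fun i => ((x ᵥ* M.1.val) i : ℂ)) =
        (fun i => (x i : ℂ)) ᵥ* M.1.val.map Complex.ofReal := by
      funext i
      simp [vecMul, dotProduct]
    rw [periodVec, e, vecMul_vecMul, moeb_fromRows, hnum, ← hQ, periodVec, vecMul_vecMul,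
      fromRows_mul, Matrix.one_mul]
  have him := moeb_im (symp_transpose hc.ne' hM) Z.1
  rw [← hQ, hnum, conjTranspose_mul, ← Matrix.mul_assoc, ← Matrix.sub_mul, ← Matrix.mul_sub,
    sub_conjTranspose_of_isSymm Z.2.1, ← hY, Matrix.mul_smul, Matrix.smul_mul, smul_comm] at him
  have h2I : (2 * Complex.I) ≠ 0 := by simp
  have him' : Qᴴ * Y * Q = (c : ℂ) • Y := smul_right_injective _ h2I him
  have hYu : IsUnit Y.det := isUnit_iff_ne_zero.2 (posDef_imC Z).det_pos.ne'
  have hQu : IsUnit Q.det := isUnit_moebDenom M Z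
  have hcC : (c : ℂ) ≠ 0 := by exact_mod_cast hc.ne'
  have key : Q * Y⁻¹ * Qᴴ = (c : ℂ) • Y⁻¹ := by
    have h1 : (Q * Y⁻¹ * Qᴴ) * Y * Q = ((c : ℂ) • Y⁻¹) * Y * Q := by
      rw [Matrix.mul_assoc, Matrix.mul_assoc, ← Matrix.mul_assoc Qᴴ, him', Matrix.mul_smul,
        Matrix.mul_assoc, Matrix.nonsing_inv_mul _ hYu, Matrix.smul_mul, Matrix.smul_mul,
        Matrix.nonsing_inv_mul _ hYu, Matrix.mul_one, Matrix.one_mul]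
    have h2 := congrArg (fun X => X * Q⁻¹ * Y⁻¹) h1
    simpa only [Matrix.mul_nonsing_inv_cancel_right _ _ hQu,
      Matrix.mul_nonsing_inv_cancel_right _ _ hYu] using h2
  rw [periodNorm, periodNorm, hvec, star_vecMul, ← dotProduct_mulVec, mulVec_mulVec,
    mulVec_mulVec, ← hY, key, smul_mulVec, dotProduct_smul]
  simp

end Continuity

/-! ### Local finiteness of fixers, generic points -/

section LocalFiniteness

variable {n : Type} [Fintype n] [DecidableEq n]

/-- The similitudes with denominator dividing `p` and with multiplier at most `Δ`. -/
def heckeSet (n : Type) [Fintype n] [DecidableEq n] (p Δ : ℕ) : Set (GSpPos n) :=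
  {m | (∃ c : ℝ, 0 < c ∧ c ≤ Δ ∧ m.1.val * J n ℝ * m.1.valᵀ = c • J n ℝ) ∧
    ∃ S : Matrix (n ⊕ n) (n ⊕ n) ℤ, (p : ℝ) • m.1.val = S.map (Int.cast : ℤ → ℝ)}

/-- Matrices with bounded entries and bounded denominator are finite in number. -/
theorem finite_heckeSet_bounded {p Δ : ℕ} (hp : p ≠ 0) (R : ℝ) :
    {m ∈ heckeSet n p Δ | ∀ i j, |m.1.val i j| ≤ R}.Finite := by
  have hp' : (0 : ℝ) < p := by exact_mod_cast Nat.pos_of_ne_zero hp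
  obtain ⟨K, hK⟩ := exists_nat_ge (p * R)
  have hfin := Set.finite_Icc (fun _ _ => -(K : ℤ) : n ⊕ n → n ⊕ n → ℤ) (fun _ _ => (K : ℤ))
  refine Set.Finite.subset (Set.Finite.preimage (f := fun m : GSpPos n => m.1.val)
    (fun a _ b _ h => ext_val h)
    (hfin.image fun S : n ⊕ n → n ⊕ n → ℤ =>
      (p : ℝ)⁻¹ • (Matrix.of S).map (Int.cast : ℤ → ℝ))) ?_
  rintro m ⟨⟨-, S, hS⟩, hb⟩
  have hent : ∀ i j, (S i j : ℝ) = p * m.1.val i j := fun i j => by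
    have := congrFun (congrFun hS i) j
    simpa using this.symm
  have habs : ∀ i j, |S i j| ≤ (K : ℤ) := fun i j => by
    have : |(S i j : ℝ)| ≤ K := by
      rw [hent, abs_mul, abs_of_pos hp']
      exact (mul_le_mul_of_nonneg_left (hb i j) hp'.le).trans hK
    exact_mod_cast this
  refine ⟨S, ⟨fun i j => (abs_le.1 (habs i j)).1, fun i j => (abs_le.1 (habs i j)).2⟩, ?_⟩
  ext i j
  change (p : ℝ)⁻¹ * (S i j : ℝ) = _
  rw [hent, inv_mul_cancel_left₀ hp'.ne']

/-- The similitudes of bounded multiplier that fix a point near `Z₀` are bounded: the unit ball of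
the norm defined by `Z` is bounded, uniformly near `Z₀`. -/
theorem eventually_bounded_of_smul_eq (Z₀ : SiegelSpace n) (C : ℝ) :
    ∃ R : ℝ, ∀ᶠ Z in 𝓝 Z₀, ∀ (M : GSpPos n) (c : ℝ), 0 < c → c ≤ C →
      M.1.val * J n ℝ * M.1.valᵀ = c • J n ℝ → M • Z = Z → ∀ i j, |M.1.val i j| ≤ R := by
  have hcont := continuous_periodNorm (n := n)
  have hswap : Continuous fun q : SiegelSpace n × (n ⊕ n → ℝ) => (q.2, q.1) := by fun_prop
  have hcomp := hcont.comp hswap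
  have hsw : Continuous fun q : SiegelSpace n × (n ⊕ n → ℝ) => periodNorm q.2 q.1 := hcomp
  have hS : IsCompact (Metric.sphere (0 : n ⊕ n → ℝ) 1) := isCompact_sphere _ _
  obtain ⟨b, hb, hbS⟩ := hS.exists_forall_le' (f := fun x => periodNorm x Z₀) (a := 0)
    (hcont.comp (by fun_prop : Continuous fun x : n ⊕ n → ℝ => (x, Z₀))).continuousOn
    (fun x hx => periodNorm_pos (by
      rintro rfl
      simp at hx) Z₀)
  have h1 : ∀ᶠ Z in 𝓝 Z₀, ∀ x ∈ Metric.sphere (0 : n ⊕ n → ℝ) 1, b / 2 < periodNorm x Z := by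
    refine hS.eventually_forall_of_forall_eventually fun x hx => ?_
    have ho : IsOpen {q : SiegelSpace n × (n ⊕ n → ℝ) | b / 2 < periodNorm q.2 q.1} :=
      isOpen_lt continuous_const hsw
    have hmem : (Z₀, x) ∈ {q : SiegelSpace n × (n ⊕ n → ℝ) | b / 2 < periodNorm q.2 q.1} := by
      have hx1 : b ≤ periodNorm x Z₀ := hbS x hx
      exact lt_of_lt_of_le (half_lt_self hb) hx1
    exact (ho.eventually_mem hmem).mono fun _ h => h
  have h2 : ∀ i : n ⊕ n, ∀ᶠ Z in 𝓝 Z₀,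
      periodNorm (Pi.single i 1) Z < periodNorm (Pi.single i 1) Z₀ + 1 := fun i => by
    have hpair : Continuous fun Z : SiegelSpace n => ((Pi.single i 1 : n ⊕ n → ℝ), Z) := by
      fun_prop
    have hc := hcont.comp hpair
    have hc : Continuous fun Z : SiegelSpace n => periodNorm (Pi.single i 1) Z := hc
    exact (isOpen_lt hc continuous_const).mem_nhds (by simp)
  set B : n ⊕ n → ℝ := fun i => periodNorm (Pi.single i 1) Z₀ + 1 with hB
  have hB0 : ∀ i, 0 ≤ B i := fun i =>
    add_nonneg (periodNorm_pos (by simp) Z₀).le zero_le_one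
  refine ⟨∑ i, (C * B i / (b / 2) + 1), ?_⟩
  filter_upwards [h1, Filter.eventually_all.2 h2] with Z hZ1 hZ2 M c hc hcC hM hfix i j
  have hC : 0 ≤ C := hc.le.trans hcC
  have hhom : ∀ x : n ⊕ n → ℝ, b / 2 * ‖x‖ ^ 2 ≤ periodNorm x Z := by
    intro x
    by_cases hx : x = 0
    · subst hx
      simp [periodNorm, periodVec, show (fun _ : n ⊕ n => (0 : ℂ)) = 0 from rfl]
    · have hx' : ‖x‖ ≠ 0 := norm_ne_zero_iff.2 hx
      have := hZ1 (‖x‖⁻¹ • x) (by simp [norm_smul, hx'])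
      rw [periodNorm_smul] at this
      have h3 : ‖x‖ ^ 2 * (b / 2) ≤ ‖x‖ ^ 2 * ((‖x‖⁻¹) ^ 2 * periodNorm x Z) :=
        mul_le_mul_of_nonneg_left this.le (sq_nonneg _)
      rw [← mul_assoc, ← mul_pow, mul_inv_cancel₀ hx', one_pow, one_mul] at h3
      linarith
  have hrow : Pi.single i (1 : ℝ) ᵥ* M.1.val = M.1.val i := by
    rw [single_one_vecMul]; rfl
  have h4 := hhom (M.1.val i)
  rw [← hrow, periodNorm_vecMul hc hM hfix, hrow] at h4
  have h5 : c * periodNorm (Pi.single i 1) Z ≤ C * B i :=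
    mul_le_mul hcC (hZ2 i).le (periodNorm_pos (by simp) Z).le hC
  have h6 : ‖M.1.val i‖ ^ 2 ≤ C * B i / (b / 2) := by
    rw [le_div_iff₀ (by linarith)]
    linarith
  have h7 : ‖M.1.val i‖ ≤ C * B i / (b / 2) + 1 := by
    nlinarith [sq_nonneg (‖M.1.val i‖ - 1), norm_nonneg (M.1.val i)]
  refine (norm_le_pi_norm (M.1.val i) j).trans (h7.trans ?_)
  exact Finset.single_le_sum (f := fun i => C * B i / (b / 2) + 1) (fun k _ => by
    have := hB0 k
    positivity) (Finset.mem_univ i)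

theorem finite_fixers {p Δ : ℕ} (hp : p ≠ 0) (Z : SiegelSpace n) :
    {m ∈ heckeSet n p Δ | m • Z = Z}.Finite := by
  obtain ⟨R, hR⟩ := eventually_bounded_of_smul_eq Z (Δ : ℝ)
  refine (finite_heckeSet_bounded (Δ := Δ) hp R).subset ?_
  rintro m ⟨hm, hZ⟩
  obtain ⟨c, hc, hcΔ, h⟩ := hm.1
  exact ⟨hm, hR.self_of_nhds m c hc hcΔ h hZ⟩

/-- The fixers of a point contain those of the neighbouring points. -/
theorem eventually_fixers_subset {p Δ : ℕ} (hp : p ≠ 0) (Z₀ : SiegelSpace n) :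
    ∀ᶠ Z in 𝓝 Z₀, ∀ m ∈ heckeSet n p Δ, m • Z = Z → m • Z₀ = Z₀ := by
  obtain ⟨R, hR⟩ := eventually_bounded_of_smul_eq Z₀ (Δ : ℝ)
  have hfin := finite_heckeSet_bounded (n := n) (Δ := Δ) hp R
  have h : ∀ᶠ Z in 𝓝 Z₀, ∀ m ∈ {m ∈ heckeSet n p Δ | ∀ i j, |m.1.val i j| ≤ R},
      m • Z = Z → m • Z₀ = Z₀ := by
    rw [Filter.eventually_all_finite hfin]
    intro m _
    by_cases h0 : m • Z₀ = Z₀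
    · exact Filter.Eventually.of_forall fun _ _ => h0
    · have ho : IsOpen {Z : SiegelSpace n | m • Z ≠ Z} :=
        isOpen_ne_fun (continuous_const_smul m) continuous_id
      filter_upwards [ho.mem_nhds h0] with Z hZ hZ' using absurd hZ' hZ
  filter_upwards [h, hR] with Z hZ hRZ m hm hfix
  obtain ⟨c, hc, hcΔ, h'⟩ := hm.1
  exact hZ m ⟨hm, hRZ m c hc hcΔ h' hfix⟩ hfix

/-- A point `Z` is generic if the similitudes in `heckeSet` that fix it all lie in `ℝ + ℝ a`, for
each non-scalar one `a` among them. -/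
def Generic (p Δ : ℕ) (Z : SiegelSpace n) : Prop :=
  ∀ a ∈ heckeSet n p Δ, a • Z = Z → ∀ b ∈ heckeSet n p Δ, b • Z = Z →
    (∃ x : ℝ, a.1.val = x • 1) ∨ ∃ x y : ℝ, b.1.val = x • 1 + y • a.1.val

theorem isOpen_generic {p Δ : ℕ} (hp : p ≠ 0) : IsOpen {Z : SiegelSpace n | Generic p Δ Z} := by
  rw [isOpen_iff_mem_nhds]
  intro Z₀ h0
  filter_upwards [eventually_fixers_subset (Δ := Δ) hp Z₀] with Z hZ a ha haZ b hb hbZ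
  exact h0 a ha (hZ a ha haZ) b hb (hZ b hb hbZ)

theorem intCast_map_mul {m : Type} [Fintype m] (A B : Matrix m m ℤ) :
    (A * B).map (Int.cast : ℤ → ℝ) = A.map Int.cast * B.map Int.cast :=
  Matrix.map_mul (f := Int.castRingHom ℝ)

/-- `heckeSet` is stable under conjugation by `Γ₀(N)`, so that being generic only depends on the
class of a point in the Siegel variety. -/
theorem conj_mem_heckeSet {p Δ N : ℕ} {g m : GSpPos n} (hg : g ∈ Gamma0 n N)
    (hm : m ∈ heckeSet n p Δ) : g⁻¹ * m * g ∈ heckeSet n p Δ := by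
  obtain ⟨S, hS, -, hgS⟩ := id hg
  obtain ⟨S', hS', -, hgS'⟩ := inv_mem hg
  obtain ⟨⟨c, hc, hcΔ, h⟩, T, hT⟩ := hm
  have sympl : ∀ {S : Matrix (n ⊕ n) (n ⊕ n) ℤ}, S ∈ symplecticGroup n ℤ →
      S.map (Int.cast : ℤ → ℝ) * J n ℝ * (S.map (Int.cast : ℤ → ℝ))ᵀ = J n ℝ := by
    intro S hS
    have h := congrArg (fun X => X.map (Int.castRingHom ℝ)) (SymplecticGroup.mem_iff.1 hS)
    simp only [Matrix.map_mul, map_J] at h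
    exact h
  refine ⟨⟨c, hc, hcΔ, ?_⟩, S' * T * S, ?_⟩
  · rw [val_mul, val_mul, hgS, hgS', transpose_mul, transpose_mul]
    calc _ = S'.map (Int.cast : ℤ → ℝ) * (m.1.val * (S.map (Int.cast : ℤ → ℝ) * J n ℝ *
          (S.map (Int.cast : ℤ → ℝ))ᵀ) * m.1.valᵀ) * (S'.map (Int.cast : ℤ → ℝ))ᵀ := by
            simp only [Matrix.mul_assoc]
      _ = c • J n ℝ := by
        rw [sympl hS, h, Matrix.mul_smul, Matrix.smul_mul, sympl hS']
  · rw [val_mul, val_mul, intCast_map_mul, intCast_map_mul, ← hT, hgS, hgS']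
    simp

theorem Generic.smul {p Δ N : ℕ} {g : GSpPos n} (hg : g ∈ Gamma0 n N) {Z : SiegelSpace n}
    (h : Generic p Δ Z) : Generic p Δ (g • Z) := by
  have hfix : ∀ a : GSpPos n, a • g • Z = g • Z → (g⁻¹ * a * g) • Z = Z := fun a ha => by
    rw [mul_smul, mul_smul, ha, inv_smul_smul]
  have hback : ∀ a : GSpPos n, a.1.val = g.1.val * (g⁻¹ * a * g).1.val * (g⁻¹).1.val := by
    intro a
    rw [← val_mul, ← val_mul]
    congr 2
    group
  intro a ha haZ b hb hbZ
  rcases h _ (conj_mem_heckeSet hg ha) (hfix a haZ) _ (conj_mem_heckeSet hg hb) (hfix b hbZ) with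
    ⟨x, hx⟩ | ⟨x, y, hxy⟩
  · left
    refine ⟨x, ?_⟩
    rw [hback a, hx, Matrix.mul_smul, Matrix.smul_mul, Matrix.mul_one, val_mul_val_inv]
  · right
    refine ⟨x, y, ?_⟩
    rw [hback b, hxy, Matrix.mul_add, Matrix.add_mul, Matrix.mul_smul, Matrix.smul_mul,
      Matrix.mul_one, val_mul_val_inv, Matrix.mul_smul, Matrix.smul_mul, ← hback a]

end LocalFiniteness

/-! ### Density of the generic points -/

section Rigidity

variable {Δ : ℕ}

/-- The Lorentz boost with `sinh = u` in the plane of the coordinate `l ∈ {0, 1}` and of the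
negative coordinate. -/
noncomputable def boost (l : Fin 2) (u : ℝ) : Matrix (Fin 2 ⊕ Fin 1) (Fin 2 ⊕ Fin 1) ℝ :=
  fromBlocks (diagonal (Function.update 1 l (Real.sqrt (1 + u ^ 2))))
    (Matrix.of fun i _ => if i = l then u else 0) (Matrix.of fun _ i => if i = l then u else 0)
    (diagonal fun _ => Real.sqrt (1 + u ^ 2))

theorem boost_zero (l : Fin 2) : boost l 0 = 1 := by
  ext i j
  rcases i with i | i <;> rcases j with j | j <;>
    simp [boost, Matrix.one_apply]

theorem boost_transpose (l : Fin 2) (u : ℝ) : (boost l u)ᵀ = boost l u := by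
  rw [boost, fromBlocks_transpose, diagonal_transpose, diagonal_transpose]
  rfl

theorem boost_isometry (l : Fin 2) (u : ℝ) : boost l u * Ers 2 1 ℝ * boost l u = Ers 2 1 ℝ := by
  have hs : Real.sqrt (1 + u ^ 2) * Real.sqrt (1 + u ^ 2) = 1 + u ^ 2 :=
    Real.mul_self_sqrt (by positivity)
  ext i j
  fin_cases l <;> rcases i with i | i <;> rcases j with j | j <;> fin_cases i <;> fin_cases j <;>
    simp [boost, Ers, fromBlocks, Matrix.mul_apply, Matrix.diagonal_apply, hs, Matrix.one_apply,
      Function.update] <;> ring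

theorem continuous_boost (l : Fin 2) : Continuous (boost l) := by
  refine continuous_matrix fun i j => ?_
  fin_cases l <;> rcases i with i | i <;> rcases j with j | j <;> fin_cases i <;> fin_cases j <;>
    simp [boost, Function.update] <;> fun_prop

/-- A matrix that commutes with the squares of two nontrivial boosts, one in each of the two
planes, is scalar. -/
theorem eq_smul_one_of_commute_boost {A : Matrix (Fin 2 ⊕ Fin 1) (Fin 2 ⊕ Fin 1) ℝ} {u v : ℝ}
    (hu : u ≠ 0) (hv : v ≠ 0)
    (h0 : A * (boost 0 u * boost 0 u) = boost 0 u * boost 0 u * A)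
    (h1 : A * (boost 1 v * boost 1 v) = boost 1 v * boost 1 v * A) : ∃ a : ℝ, A = a • 1 := by
  have hsu : Real.sqrt (1 + u ^ 2) * Real.sqrt (1 + u ^ 2) = 1 + u ^ 2 :=
    Real.mul_self_sqrt (by positivity)
  have hsv : Real.sqrt (1 + v ^ 2) * Real.sqrt (1 + v ^ 2) = 1 + v ^ 2 :=
    Real.mul_self_sqrt (by positivity)
  have hcu : Real.sqrt (1 + u ^ 2) ≠ 0 := (Real.sqrt_pos.2 (by positivity)).ne'
  have hcv : Real.sqrt (1 + v ^ 2) ≠ 0 := (Real.sqrt_pos.2 (by positivity)).ne'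
  rw [← Matrix.ext_iff] at h0 h1
  have e01 := h0 (.inl 0) (.inl 1)
  have e21 := h0 (.inr 0) (.inl 1)
  have e10 := h0 (.inl 1) (.inl 0)
  have e12 := h0 (.inl 1) (.inr 0)
  have e02 := h0 (.inl 0) (.inr 0)
  have f10 := h1 (.inl 1) (.inl 0)
  have f20 := h1 (.inr 0) (.inl 0)
  have f01 := h1 (.inl 0) (.inl 1)
  have f02 := h1 (.inl 0) (.inr 0)
  have f12 := h1 (.inl 1) (.inr 0)
  simp [boost, fromBlocks, Matrix.mul_apply, Matrix.diagonal_apply,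
    Function.update] at e01 e21 e10 e12 e02 f10 f20 f01 f02 f12
  have aux : ∀ {c u : ℝ} (x y : ℝ), u ≠ 0 → c * c = 1 + u ^ 2 → x = (c * c + u * u) * x + 2 * c * u * y →
      y = 2 * c * u * x + (u * u + c * c) * y → x = 0 ∧ y = 0 := by
    intro c u x y hu hc h1 h2
    have h3 : u * x + c * y = 0 := by
      apply mul_left_cancel₀ (mul_ne_zero two_ne_zero hu)
      linear_combination -h1 - x * hc
    have h4 : c * x + u * y = 0 := by
      apply mul_left_cancel₀ (mul_ne_zero two_ne_zero hu)
      linear_combination -h2 - y * hc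
    constructor
    · linear_combination c * h4 - u * h3 - x * hc
    · linear_combination c * h3 - u * h4 - y * hc
  obtain ⟨a01, a21⟩ := aux (A (.inl 0) (.inl 1)) (A (.inr 0) (.inl 1)) hu hsu
    (by linear_combination e01) (by linear_combination e21)
  obtain ⟨a10, a12⟩ := aux (A (.inl 1) (.inl 0)) (A (.inl 1) (.inr 0)) hu hsu
    (by linear_combination -e10) (by linear_combination -e12)
  obtain ⟨-, a20⟩ := aux (A (.inl 1) (.inl 0)) (A (.inr 0) (.inl 0)) hv hsv
    (by linear_combination f10) (by linear_combination f20)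
  obtain ⟨-, a02⟩ := aux (A (.inl 0) (.inl 1)) (A (.inl 0) (.inr 0)) hv hsv
    (by linear_combination -f01) (by linear_combination -f02)
  have a00 : A (.inl 0) (.inl 0) = A (.inr 0) (.inr 0) := by
    apply mul_left_cancel₀ (mul_ne_zero (mul_ne_zero two_ne_zero hcu) hu)
    rw [a02] at e02
    linear_combination e02
  have a11 : A (.inl 1) (.inl 1) = A (.inr 0) (.inr 0) := by
    apply mul_left_cancel₀ (mul_ne_zero (mul_ne_zero two_ne_zero hcv) hv)
    rw [a12] at f12
    linear_combination f12
  refine ⟨A (.inr 0) (.inr 0), ?_⟩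
  ext i j
  rcases i with i | i <;> rcases j with j | j <;> fin_cases i <;> fin_cases j <;>
    simp [a01, a21, a10, a12, a20, a02, a00, a11]

/-- The element `α(h)` of `GSp⁺`, for a real isometry `h`. -/
noncomputable def boostG (l : Fin 2) (u : ℝ) : GSpPos (Fin 2 ⊕ Fin 1) :=
  ofSimilitude (alpha 2 1 (Δ : ℝ) (boost l u) 0) 1 one_pos <| by
    refine alpha_similitude (c := 1) ⟨?_, by simp⟩
    rw [boost_transpose, boost_isometry]
    simp

theorem commute_boostG (hΔ : 0 < Δ) (l : Fin 2) (u : ℝ) :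
    Commute (boostG (Δ := Δ) l u) (rootG 2 1 hΔ) :=
  (commute_rootG_iff hΔ).2 (alpha_mul_rootMat _ _)

theorem isUnit_boost (l : Fin 2) (u : ℝ) : IsUnit (boost l u) := by
  refine (Matrix.isUnit_iff_isUnit_det _).2 (isUnit_iff_ne_zero.2 fun h => ?_)
  have h1 := congrArg det (boost_isometry l u)
  have h2 := congrArg det (Ers_mul_self 2 1 ℝ)
  rw [det_mul, det_mul, h] at h1
  rw [det_mul, ← h1] at h2
  simp at h2

theorem posDef_boost_mul_boost (l : Fin 2) (u : ℝ) : (boost l u * boost l u).PosDef := by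
  have h := (IsUnit.posDef_star_left_conjugate_iff (isUnit_boost l u)).2
    (PosDef.one (n := Fin 2 ⊕ Fin 1) (R := ℝ))
  rwa [star_eq_conjTranspose, conjTranspose_eq_transpose_of_trivial, boost_transpose,
    Matrix.mul_one] at h

theorem boostG_smul_basePoint (hΔ : 0 < Δ) (l : Fin 2) (u : ℝ) :
    boostG (Δ := Δ) l u • basePoint hΔ = imPoint hΔ _ (posDef_boost_mul_boost l u) := by
  rw [smul_eq_iff, basePoint_val, boostG, ofSimilitude_val]
  have h1 : boost l u * (Ers 2 1 ℝ * boost l u * Ers 2 1 ℝ) = 1 := by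
    rw [← Matrix.mul_assoc, ← Matrix.mul_assoc, boost_isometry, Ers_mul_self]
  have h2 : boost l u * boost l u * (Ers 2 1 ℝ * boost l u * Ers 2 1 ℝ) = boost l u := by
    rw [Matrix.mul_assoc, h1, Matrix.mul_one]
  simp only [moebNum, moebDenom, alpha, toBlocks_fromBlocks₁₁, toBlocks_fromBlocks₁₂,
    toBlocks_fromBlocks₂₁, toBlocks_fromBlocks₂₂, imPoint, Matrix.zero_mul, Matrix.mul_zero,
    smul_zero, neg_zero, Matrix.map_zero _ Complex.ofReal_zero, add_zero, zero_add,
    Matrix.smul_mul]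
  have hm : ∀ X Y : Matrix (Fin 2 ⊕ Fin 1) (Fin 2 ⊕ Fin 1) ℝ,
      (X * Y).map Complex.ofReal = X.map Complex.ofReal * Y.map Complex.ofReal :=
    fun X Y => Matrix.map_mul (f := Complex.ofRealHom)
  rw [← hm, h2]
  simp

theorem continuous_imPoint_boost (hΔ : 0 < Δ) (l : Fin 2) :
    Continuous fun u : ℝ => imPoint hΔ _ (posDef_boost_mul_boost l u) := by
  refine Continuous.subtype_mk ?_ _
  exact (((continuous_boost l).matrix_mul (continuous_boost l)).matrix_map
    Complex.continuous_ofReal).const_smul (Complex.I / (Real.sqrt Δ : ℂ))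

/-- A similitude that fixes `D_V` pointwise near one of its points is an element of
`ℝ + ℝ √-Δ`. -/
theorem eq_of_fixes_near (hΔ : 0 < Δ) {t : SiegelSpace (Fin 2 ⊕ Fin 1)} (ht : t ∈ domainV 2 1 Δ)
    {O : Set (SiegelSpace (Fin 2 ⊕ Fin 1))} (hO : IsOpen O) (htO : t ∈ O)
    (m : GSpPos (Fin 2 ⊕ Fin 1)) (hm : ∀ z ∈ domainV 2 1 Δ, z ∈ O → m • z = z) :
    ∃ x y : ℝ, m.1.val = x • 1 + y • rootMat 2 1 (Δ : ℝ) := by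
  obtain ⟨M, hM, rfl⟩ := (mem_domainV_iff hΔ).1 ht
  set g := M⁻¹ * m * M with hg
  have hgfix : ∀ B : GSpPos (Fin 2 ⊕ Fin 1), Commute B (rootG 2 1 hΔ) →
      M • B • (basePoint hΔ : SiegelSpace (Fin 2 ⊕ Fin 1)) ∈ O →
        g • B • (basePoint hΔ : SiegelSpace (Fin 2 ⊕ Fin 1)) = B • basePoint hΔ := by
    intro B hB hBO
    have h1 := hm _ (smul_mem_domainV hΔ hM (smul_mem_domainV hΔ hB
      ((mem_domainV_iff hΔ).2 ⟨1, Commute.one_left _, (one_smul _ _).symm⟩))) hBO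
    rw [hg, mul_smul, mul_smul, h1, inv_smul_smul]
  have hbase := hgfix 1 (Commute.one_left _) (by rwa [one_smul])
  rw [one_smul, basePoint, smul_imPoint_eq_iff] at hbase
  have hex : ∀ l, ∃ u : ℝ, u ≠ 0 ∧
      M • imPoint hΔ _ (posDef_boost_mul_boost l u) ∈ O := by
    intro l
    have hc : Continuous fun u : ℝ => M • imPoint hΔ _ (posDef_boost_mul_boost l u) :=
      (continuous_imPoint_boost hΔ l).const_smul M
    have h0 : M • imPoint hΔ _ (posDef_boost_mul_boost l 0) ∈ O := by
      convert htO using 2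
      apply Subtype.ext
      simp [imPoint, basePoint, boost_zero]
    have h1 : ∀ᶠ u in 𝓝[≠] (0 : ℝ), M • imPoint hΔ _ (posDef_boost_mul_boost l u) ∈ O :=
      nhdsWithin_le_nhds ((hO.preimage hc).mem_nhds h0)
    obtain ⟨u, hu, hu'⟩ := (h1.and self_mem_nhdsWithin).exists
    exact ⟨u, hu', hu⟩
  have hcomm : ∀ l, ∃ u : ℝ, u ≠ 0 ∧
      g.1.val.toBlocks₁₁ * (boost l u * boost l u) = boost l u * boost l u * g.1.val.toBlocks₁₁ ∧
      g.1.val.toBlocks₂₁ * Ers 2 1 ℝ * (boost l u * boost l u) =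
        boost l u * boost l u * (g.1.val.toBlocks₂₁ * Ers 2 1 ℝ) := by
    intro l
    obtain ⟨u, hu, huO⟩ := hex l
    refine ⟨u, hu, ?_⟩
    have h1 := hgfix (boostG l u) (commute_boostG hΔ l u) (by rwa [boostG_smul_basePoint])
    rw [boostG_smul_basePoint, smul_imPoint_eq_iff] at h1
    obtain ⟨hA, hC⟩ := h1
    have hAD : g.1.val.toBlocks₁₁ = g.1.val.toBlocks₂₂ := by simpa using hbase.1
    rw [← hAD] at hA
    refine ⟨hA, ?_⟩
    have hB : (Δ : ℝ) • g.1.val.toBlocks₁₂ = -g.1.val.toBlocks₂₁ := by simpa using hbase.2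
    rw [hB, neg_inj] at hC
    have hPE : (boost l u * boost l u) * Ers 2 1 ℝ * (boost l u * boost l u) = Ers 2 1 ℝ := by
      calc _ = boost l u * (boost l u * Ers 2 1 ℝ * boost l u) * boost l u := by
            simp only [Matrix.mul_assoc]
        _ = _ := by rw [boost_isometry, boost_isometry]
    conv_lhs => rw [hC]
    rw [Matrix.mul_assoc, Matrix.mul_assoc, ← Matrix.mul_assoc _ (Ers 2 1 ℝ), hPE,
      Matrix.mul_assoc]
  obtain ⟨u, hu, hu1, hu2⟩ := hcomm 0
  obtain ⟨v, hv, hv1, hv2⟩ := hcomm 1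
  obtain ⟨a, ha⟩ := eq_smul_one_of_commute_boost hu hv hu1 hv1
  obtain ⟨c, hc⟩ := eq_smul_one_of_commute_boost hu hv hu2 hv2
  have hΔr : (Δ : ℝ) ≠ 0 := by exact_mod_cast hΔ.ne'
  have hC : g.1.val.toBlocks₂₁ = c • Ers 2 1 ℝ := by
    have := congrArg (fun X => X * Ers 2 1 ℝ) hc
    simpa [Matrix.mul_assoc, Ers_mul_self] using this
  have hD : g.1.val.toBlocks₂₂ = a • 1 := by rw [← ha]; simpa using hbase.1.symm
  have hB : g.1.val.toBlocks₁₂ = (-(c / Δ)) • Ers 2 1 ℝ := by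
    have h := hbase.2
    simp only [Matrix.one_mul, Matrix.mul_one, hC] at h
    apply smul_right_injective _ hΔr
    change (Δ : ℝ) • _ = (Δ : ℝ) • _
    rw [h, smul_smul, ← neg_smul]
    congr 1
    field_simp
  have hgval : g.1.val = a • 1 + (-(c / Δ)) • rootMat 2 1 (Δ : ℝ) := by
    have h1 : fromBlocks (1 : Matrix (Fin 2 ⊕ Fin 1) (Fin 2 ⊕ Fin 1) ℝ) 0 0
        (1 : Matrix (Fin 2 ⊕ Fin 1) (Fin 2 ⊕ Fin 1) ℝ) = 1 := fromBlocks_one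
    rw [← fromBlocks_toBlocks g.1.val, ha, hB, hC, hD, rootMat_eq, ← h1, fromBlocks_smul,
      fromBlocks_smul, fromBlocks_add]
    congr 1
    · simp
    · simp
    · rw [smul_zero, zero_add, smul_neg, neg_smul, neg_neg, smul_smul]
      congr 1
      field_simp
    · simp
  refine ⟨a, -(c / Δ), ?_⟩
  have hmg : m = M * g * M⁻¹ := by rw [hg]; group
  rw [hmg, val_mul, val_mul, hgval, Matrix.mul_add, Matrix.add_mul, Matrix.mul_smul,
    Matrix.smul_mul, Matrix.mul_one, val_mul_val_inv, Matrix.mul_smul, Matrix.smul_mul,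
    (commute_rootG_iff hΔ).1 hM, Matrix.mul_assoc, val_mul_val_inv, Matrix.mul_one]

/-- Near each point of `D_V` there are points of `D_V` that are not fixed by any of finitely many
given similitudes outside of `ℝ + ℝ √-Δ`. -/
theorem exists_not_fixed (hΔ : 0 < Δ) {F : Set (GSpPos (Fin 2 ⊕ Fin 1))} (hF : F.Finite)
    (hnot : ∀ m ∈ F, ¬ ∃ x y : ℝ, m.1.val = x • 1 + y • rootMat 2 1 (Δ : ℝ)) :
    ∀ {t : SiegelSpace (Fin 2 ⊕ Fin 1)}, t ∈ domainV 2 1 Δ →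
    ∀ {O : Set (SiegelSpace (Fin 2 ⊕ Fin 1))}, IsOpen O → t ∈ O →
      ∃ z ∈ domainV 2 1 Δ, z ∈ O ∧ ∀ m ∈ F, m • z ≠ z := by
  induction F, hF using Set.Finite.induction_on with
  | empty => exact fun ht O _ htO => ⟨_, ht, htO, by simp⟩
  | @insert a F _ _ ih =>
    intro t ht O hO htO
    obtain ⟨z, hz, hzO, hzF⟩ := ih (fun m hm => hnot m (Set.mem_insert_of_mem _ hm)) ht hO htO
    have hF' : IsOpen {w : SiegelSpace (Fin 2 ⊕ Fin 1) | ∀ m ∈ F, m • w ≠ w} := by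
      have e : {w : SiegelSpace (Fin 2 ⊕ Fin 1) | ∀ m ∈ F, m • w ≠ w} =
          ⋂ m ∈ F, {w | m • w ≠ w} := by ext; simp
      rw [e]
      exact Set.Finite.isOpen_biInter ‹F.Finite› fun m _ =>
        isOpen_ne_fun (continuous_const_smul m) continuous_id
    by_contra hcon
    push Not at hcon
    refine hnot a (Set.mem_insert _ _) (eq_of_fixes_near hΔ hz (hO.inter hF') ⟨hzO, hzF⟩ a ?_)
    intro w hw hwO
    obtain ⟨m, hm, hmw⟩ := hcon w hw hwO.1
    rcases hm with rfl | hm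
    · exact hmw
    · exact absurd hmw (hwO.2 m hm)

/-- For each similitude `σ`, the points `z` of `D_V` such that `σ z` is generic are dense in
`D_V`. -/
theorem exists_generic (hΔ : 0 < Δ) {p : ℕ} (hp : p ≠ 0) (σ : GSpPos (Fin 2 ⊕ Fin 1))
    {t : SiegelSpace (Fin 2 ⊕ Fin 1)} (ht : t ∈ domainV 2 1 Δ)
    {O : Set (SiegelSpace (Fin 2 ⊕ Fin 1))} (hO : IsOpen O) (htO : t ∈ O) :
    ∃ z ∈ domainV 2 1 Δ, z ∈ O ∧ Generic p Δ (σ • z) := by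
  have hev := eventually_fixers_subset (Δ := Δ) hp (σ • t)
  obtain ⟨O', hO'sub, hO', htO'⟩ := eventually_nhds_iff.1 hev
  have hopen : IsOpen ((fun z : SiegelSpace (Fin 2 ⊕ Fin 1) => σ • z) ⁻¹' O') :=
    hO'.preimage (continuous_const_smul σ)
  set F : Set (GSpPos (Fin 2 ⊕ Fin 1)) := {m | (∃ x y : ℝ, (σ⁻¹ * m * σ).1.val =
    x • 1 + y • rootMat 2 1 (Δ : ℝ))} with hFdef
  set G := (fun m => σ⁻¹ * m * σ) ''
    {m | m ∈ {m ∈ heckeSet (Fin 2 ⊕ Fin 1) p Δ | m • (σ • t) = σ • t} ∧ m ∉ F} with hG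
  have hGfin : G.Finite := ((finite_fixers hp (σ • t)).subset fun m hm => hm.1).image _
  obtain ⟨z, hz, hzO, hzG⟩ := exists_not_fixed hΔ hGfin (by
    rintro _ ⟨m, hm, rfl⟩ h
    exact hm.2 h) ht (hO.inter hopen) ⟨htO, htO'⟩
  have key : ∀ m ∈ heckeSet (Fin 2 ⊕ Fin 1) p Δ, m • σ • z = σ • z →
      ∃ x y : ℝ, (σ⁻¹ * m * σ).1.val = x • 1 + y • rootMat 2 1 (Δ : ℝ) := by
    intro m hm hmz
    by_contra hcon
    refine hzG _ ⟨m, ⟨⟨hm, hO'sub _ hzO.2 m hm hmz⟩, hcon⟩, rfl⟩ ?_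
    rw [mul_smul, mul_smul, hmz, inv_smul_smul]
  refine ⟨z, hz, hzO.1, ?_⟩
  have hconj : ∀ (m : GSpPos (Fin 2 ⊕ Fin 1)) (x y : ℝ) (X : Matrix _ _ ℝ),
      (σ⁻¹ * m * σ).1.val = x • 1 + y • X →
      m.1.val = x • 1 + y • (σ.1.val * X * (σ⁻¹).1.val) := by
    intro m x y X h
    have hm : m = σ * (σ⁻¹ * m * σ) * σ⁻¹ := by group
    rw [hm, val_mul, val_mul, h, Matrix.mul_add, Matrix.add_mul, Matrix.mul_smul, Matrix.smul_mul,
      Matrix.mul_one, val_mul_val_inv, Matrix.mul_smul, Matrix.smul_mul]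
  intro a ha haz b hb hbz
  obtain ⟨x, y, h⟩ := key a ha haz
  obtain ⟨x', y', h'⟩ := key b hb hbz
  have e := hconj a x y _ h
  have e' := hconj b x' y' _ h'
  by_cases hy : y = 0
  · left
    exact ⟨x, by rw [e, hy, zero_smul, add_zero]⟩
  · right
    refine ⟨x' - y' / y * x, y' / y, ?_⟩
    rw [e, e', smul_add, smul_smul, smul_smul, div_mul_cancel₀ _ hy, sub_smul]
    abel

end Rigidity

/-! ### The order `ℤ[√-Δ]` and its reduction modulo an inert prime -/

section Order

/-- The complex number `√-Δ`. -/
noncomputable def rootC (Δ : ℕ) : ℂ := (Real.sqrt Δ : ℂ) * Complex.I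

theorem rootC_mul_self (Δ : ℕ) : rootC Δ * rootC Δ = -(Δ : ℂ) := by
  rw [rootC, mul_mul_mul_comm, sqrt_sq_ofReal, Complex.I_mul_I]; ring

theorem conj_rootC (Δ : ℕ) : conj (rootC Δ) = -rootC Δ := by
  simp [rootC]

/-- The order `ℤ[√-Δ]`, as a subring of `ℂ`. -/
def order (Δ : ℕ) : Subring ℂ where
  carrier := {z | ∃ a b : ℤ, z = a + b * rootC Δ}
  mul_mem' := by
    rintro _ _ ⟨a, b, rfl⟩ ⟨c, d, rfl⟩
    refine ⟨a * c - Δ * b * d, a * d + b * c, ?_⟩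
    push_cast
    linear_combination (b * d : ℂ) * rootC_mul_self Δ
  one_mem' := ⟨1, 0, by simp⟩
  add_mem' := by
    rintro _ _ ⟨a, b, rfl⟩ ⟨c, d, rfl⟩
    exact ⟨a + c, b + d, by push_cast; ring⟩
  zero_mem' := ⟨0, 0, by simp⟩
  neg_mem' := by
    rintro _ ⟨a, b, rfl⟩
    exact ⟨-a, -b, by push_cast; ring⟩

theorem rootC_mem (Δ : ℕ) : rootC Δ ∈ order Δ := ⟨0, 1, by simp⟩

theorem conj_mem_order {Δ : ℕ} {z : ℂ} (hz : z ∈ order Δ) : conj z ∈ order Δ := by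
  obtain ⟨a, b, rfl⟩ := hz
  exact ⟨a, -b, by simp [conj_rootC]⟩

theorem order_ext {Δ : ℕ} (hΔ : 0 < Δ) {a b c d : ℤ}
    (h : (a : ℂ) + b * rootC Δ = c + d * rootC Δ) : a = c ∧ b = d := by
  have hs : Real.sqrt Δ ≠ 0 := (Real.sqrt_pos.2 (by exact_mod_cast hΔ)).ne'
  have hre := congrArg Complex.re h
  have him := congrArg Complex.im h
  simp [rootC, hs] at hre him
  exact ⟨hre, him⟩

/-- The norm form `a² + Δ b²` represents multiples of `p` only trivially, `p` being inert. -/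
theorem dvd_of_dvd_norm {p : ℕ} [Fact p.Prime] {Δ : ℕ} (hinert : legendreSym p (-(Δ : ℤ)) = -1)
    {a b : ℤ} (h : (p : ℤ) ∣ a ^ 2 + Δ * b ^ 2) : (p : ℤ) ∣ a ∧ (p : ℤ) ∣ b := by
  have h1 : (p : ℤ) ∣ a ^ 2 - (-(Δ : ℤ)) * b ^ 2 := by rwa [neg_mul, sub_neg_eq_add]
  exact legendreSym.prime_dvd_of_eq_neg_one hinert h1

/-- Every element of `ZMod 2` is a square, so that `legendreSym 2` does not take the value `-1`. -/
theorem zmod_two_eq_mul_self : ∀ x : ZMod 2, x = x * x := by decide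

theorem ne_two_of_inert {p : ℕ} [Fact p.Prime] {Δ : ℕ} (hinert : legendreSym p (-(Δ : ℤ)) = -1) :
    p ≠ 2 := by
  rintro rfl
  refine (legendreSym.eq_neg_one_iff (p := 2)).1 hinert ⟨((-(Δ : ℤ) : ℤ) : ZMod 2), ?_⟩
  exact zmod_two_eq_mul_self _

theorem not_dvd_of_inert {p : ℕ} [Fact p.Prime] {Δ : ℕ} (hinert : legendreSym p (-(Δ : ℤ)) = -1) :
    ¬ (p : ℤ) ∣ Δ := by
  intro h
  have : legendreSym p (-(Δ : ℤ)) = 0 := by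
    rw [legendreSym.eq_zero_iff]
    have := (ZMod.intCast_zmod_eq_zero_iff_dvd _ _).2 h
    simpa using this
  rw [this] at hinert
  norm_num at hinert

end Order


section Multiples

/-- The ideal `p ℤ[√-Δ]`. -/
def orderMul (Δ p : ℕ) : AddSubgroup ℂ where
  carrier := {z | ∃ w ∈ order Δ, z = p * w}
  zero_mem' := ⟨0, zero_mem _, by simp⟩
  add_mem' := by
    rintro _ _ ⟨w, hw, rfl⟩ ⟨w', hw', rfl⟩
    exact ⟨w + w', add_mem hw hw', by ring⟩
  neg_mem' := by
    rintro _ ⟨w, hw, rfl⟩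
    exact ⟨-w, neg_mem hw, by ring⟩

variable {Δ p : ℕ}

theorem p_mul_mem {w : ℂ} (hw : w ∈ order Δ) : (p : ℂ) * w ∈ orderMul Δ p := ⟨w, hw, rfl⟩

theorem mul_mem_orderMul {w z : ℂ} (hw : w ∈ order Δ) (hz : z ∈ orderMul Δ p) :
    w * z ∈ orderMul Δ p := by
  obtain ⟨z, hz, rfl⟩ := hz
  exact ⟨w * z, mul_mem hw hz, by ring⟩

theorem add_mul_rootC_mem_orderMul_iff (hΔ : 0 < Δ) {a b : ℤ} :
    (a : ℂ) + b * rootC Δ ∈ orderMul Δ p ↔ (p : ℤ) ∣ a ∧ (p : ℤ) ∣ b := by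
  constructor
  · rintro ⟨_, ⟨c, d, rfl⟩, h⟩
    have h' : (a : ℂ) + b * rootC Δ = ((p * c : ℤ) : ℂ) + ((p * d : ℤ) : ℂ) * rootC Δ := by
      rw [h]; push_cast; ring
    obtain ⟨h1, h2⟩ := order_ext hΔ h'
    exact ⟨⟨c, h1⟩, ⟨d, h2⟩⟩
  · rintro ⟨⟨c, rfl⟩, ⟨d, rfl⟩⟩
    exact ⟨_, ⟨c, d, rfl⟩, by push_cast; ring⟩

theorem intCast_mem_orderMul_iff (hΔ : 0 < Δ) {a : ℤ} :
    (a : ℂ) ∈ orderMul Δ p ↔ (p : ℤ) ∣ a := by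
  have := add_mul_rootC_mem_orderMul_iff (p := p) hΔ (a := a) (b := 0)
  simpa using this

/-- The norm of an element of `ℤ[√-Δ]` that is not divisible by `p` is prime to `p`. -/
theorem exists_norm (hΔ : 0 < Δ) [Fact p.Prime] (hinert : legendreSym p (-(Δ : ℤ)) = -1) {z : ℂ}
    (hz : z ∈ order Δ) (hzp : z ∉ orderMul Δ p) :
    ∃ n : ℤ, ¬ (p : ℤ) ∣ n ∧ z * conj z = n := by
  obtain ⟨a, b, rfl⟩ := hz
  refine ⟨a ^ 2 + Δ * b ^ 2, fun h => hzp ?_, ?_⟩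
  · exact (add_mul_rootC_mem_orderMul_iff hΔ).2 (dvd_of_dvd_norm hinert h)
  · simp only [map_add, map_mul, map_intCast, conj_rootC]
    push_cast
    linear_combination (-b ^ 2 : ℂ) * rootC_mul_self Δ

theorem exists_int_inv [hp : Fact p.Prime] {n : ℤ} (hn : ¬ (p : ℤ) ∣ n) :
    ∃ m k : ℤ, m * n = 1 + p * k := by
  have h1 : IsCoprime (p : ℤ) n := (Nat.prime_iff_prime_int.1 hp.out).coprime_iff_not_dvd.2 hn
  obtain ⟨u, v, h⟩ := h1
  exact ⟨v, -u, by linarith⟩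

/-- Since `p` is inert, `ℤ[√-Δ] / p` is a field. -/
theorem exists_inv_mod (hΔ : 0 < Δ) [Fact p.Prime] (hinert : legendreSym p (-(Δ : ℤ)) = -1) {z : ℂ}
    (hz : z ∈ order Δ) (hzp : z ∉ orderMul Δ p) :
    ∃ w ∈ order Δ, ∃ k ∈ order Δ, w * z = 1 + p * k := by
  obtain ⟨n, hn, h⟩ := exists_norm hΔ hinert hz hzp
  obtain ⟨m, k, hmk⟩ := exists_int_inv hn
  refine ⟨m * conj z, mul_mem (intCast_mem _ m) (conj_mem_order hz), k, intCast_mem _ k, ?_⟩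
  have : (m : ℂ) * n = 1 + p * k := by exact_mod_cast hmk
  rw [mul_assoc, mul_comm (conj z), h, this]

theorem mem_orderMul_of_mul_mem (hΔ : 0 < Δ) [Fact p.Prime]
    (hinert : legendreSym p (-(Δ : ℤ)) = -1) {z w : ℂ} (hz : z ∈ order Δ) (hw : w ∈ order Δ)
    (h : w * z ∈ orderMul Δ p) (hwp : w ∉ orderMul Δ p) : z ∈ orderMul Δ p := by
  obtain ⟨v, hv, k, hk, hvk⟩ := exists_inv_mod hΔ hinert hw hwp
  have h1 : z = v * (w * z) - p * (k * z) := by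
    rw [← mul_assoc, hvk]; ring
  rw [h1]
  exact sub_mem (mul_mem_orderMul hv h) (p_mul_mem (mul_mem hk hz))

end Multiples

/-! ### Neighbours of a lattice -/

section Lattice

variable {V : Type} [AddCommGroup V] [Module ℂ V] (H : V →ₗ[ℂ] V →ₗ⋆[ℂ] ℂ)

/-- The unitary transvection `x ↦ x + s √-Δ ⟨x, v⟩ v`; it is an isometry for `v` isotropic and
`s` real. -/
noncomputable def transv (Δ : ℕ) (v : V) (s : ℝ) (x : V) : V := x + (s * rootC Δ * H x v) • v

/-- A subgroup `M` between `pΛ` and `Λ`, for a lattice `Λ` over `ℤ[√-Δ]`, such that the span of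
`M / p` over the field `ℤ[√-Δ] / p` is the orthogonal complement of the line spanned by `e`, and
such that this line is contained in `M / p`. -/
structure IsFlag (Δ p : ℕ) (Λ M : AddSubgroup V) (e : V) : Prop where
  mem : e ∈ Λ
  orth : ∀ x ∈ M, H x e ∈ orderMul Δ p
  smul_mem : ∀ z ∈ order Δ, z • e ∈ M
  span : ∀ x ∈ Λ, H x e ∈ orderMul Δ p → ∃ y ∈ M, ∃ y' ∈ M, x = y + rootC Δ • y'
  perp : ∀ z ∈ Λ, (∀ y ∈ M, H z y ∈ orderMul Δ p) →
    ∃ c ∈ order Δ, ∃ l ∈ Λ, z = c • e + (p : ℂ) • l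

variable {H} {Δ p N : ℕ} {Λ M L : AddSubgroup V} {e f : V}

theorem transv_neg_transv (hv : H e e = 0) (s : ℝ) (x : V) :
    transv H Δ e (-s) (transv H Δ e s x) = x := by
  simp only [transv, map_add, map_smul, LinearMap.add_apply, LinearMap.smul_apply, hv, smul_zero,
    add_zero]
  rw [add_assoc, ← add_smul]
  have : (s : ℂ) * rootC Δ * H x e + ((-s : ℝ) : ℂ) * rootC Δ * H x e = 0 := by push_cast; ring
  rw [this, zero_smul, add_zero]

theorem transv_add (hv : H e e = 0) (s s' : ℝ) (x : V) :
    transv H Δ e s (transv H Δ e s' x) = transv H Δ e (s' + s) x := by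
  simp only [transv, map_add, map_smul, LinearMap.add_apply, LinearMap.smul_apply, hv, smul_zero,
    add_zero]
  rw [add_assoc, ← add_smul]
  congr 2
  push_cast
  ring

theorem transv_transv {h : ℂ} (hef : H e f = h) (y : V) (s : ℝ) (t : ℝ) :
    transv H Δ f s (transv H Δ e t y) =
      y + (t * rootC Δ * H y e) • e + (s * rootC Δ * H y f) • f
        - (s * t * Δ * H y e * h) • f := by
  simp only [transv, map_add, map_smul, LinearMap.add_apply, LinearMap.smul_apply, hef,
    smul_eq_mul]
  rw [mul_add, add_smul, ← add_assoc, sub_eq_add_neg, ← neg_smul]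
  congr 2
  linear_combination (s * t * H y e * h) * rootC_mul_self Δ

/-- A unimodular lattice `L` with `pL ⊆ M ⊆ L`, stable under `ℤ[√-Δ]`, is either `Λ` or one of the
`p` lattices obtained from `Λ` by a fixed transvection along `e` followed by one
of `p` transvections along `f`. These are the `p + 1` isotropic lines of a hyperbolic plane
over the field with `p²` elements. -/
theorem le_or_exists_transv (hΔ : 0 < Δ) [hp : Fact p.Prime]
    (hinert : legendreSym p (-(Δ : ℤ)) = -1) (hN : ¬ p ∣ N) (hherm : ∀ x y, H y x = conj (H x y))
    (hΛO : ∀ z ∈ order Δ, ∀ x ∈ Λ, z • x ∈ Λ) (hΛH : ∀ x ∈ Λ, ∀ y ∈ Λ, H x y ∈ order Δ)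
    (hpM : ∀ x ∈ Λ, (p : ℂ) • x ∈ M) (hMΛ : M ≤ Λ) (hflag : IsFlag H Δ p Λ M e)
    (he : H e e = 0) (hfΛ : f ∈ Λ) (hef : H e f ∉ orderMul Δ p)
    (hLO : ∀ z ∈ order Δ, ∀ x ∈ L, z • x ∈ L) (hLH : ∀ x ∈ L, ∀ y ∈ L, H x y ∈ order Δ)
    (hML : M ≤ L) (hpL : ∀ x ∈ L, (p : ℂ) • x ∈ M) :
    L ≤ Λ ∨ ∃ s : ℕ, s < p ∧ ∀ y ∈ Λ,
      transv H Δ f (-(p * N * s)) (transv H Δ e (N / p) y) ∈ L := by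
  have hp0 : (p : ℂ) ≠ 0 := by exact_mod_cast hp.out.ne_zero
  by_cases hLΛ : L ≤ Λ
  · exact Or.inl hLΛ
  right
  obtain ⟨x, hxL, hxΛ⟩ := SetLike.not_le_iff_exists.1 hLΛ
  obtain ⟨c, hc, l, hl, hx⟩ := hflag.perp _ (hMΛ (hpL x hxL)) fun y hy => by
    rw [map_smul, LinearMap.smul_apply, smul_eq_mul]
    exact p_mul_mem (hLH _ hxL _ (hML hy))
  have hcp : c ∉ orderMul Δ p := by
    rintro ⟨c', hc', rfl⟩
    apply hxΛ
    rw [mul_smul, ← smul_add] at hx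
    rw [smul_right_injective V hp0 hx]
    exact add_mem (hΛO _ hc' _ hflag.mem) hl
  -- A vector of `L` of the form `p⁻¹ e + l'` with `l'` in `Λ`.
  obtain ⟨w, hw, k, hk, hwc⟩ := exists_inv_mod hΔ hinert hc hcp
  set l' := w • l with hl'
  have hl'Λ : l' ∈ Λ := hΛO _ hw _ hl
  have hx' : (p : ℂ)⁻¹ • e + l' ∈ L := by
    have h1 : (p : ℂ)⁻¹ • e + l' = w • x - k • e := by
      apply smul_right_injective V hp0
      change (p : ℂ) • _ = (p : ℂ) • _
      have h2 : (p : ℂ) • w • x = (1 + p * k) • e + (p : ℂ) • w • l := by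
        rw [smul_comm, hx, smul_add, smul_smul, hwc, smul_comm w]
      rw [smul_add, smul_smul, mul_inv_cancel₀ hp0, one_smul, smul_sub, h2, add_smul, one_smul,
        smul_smul (p : ℂ) k, hl']
      abel
    rw [h1]
    exact sub_mem (hLO _ hw _ hxL) (hML (hflag.smul_mem _ hk))
  -- Its integrality gives that `⟨l', e⟩ ≡ √-Δ v` modulo `p`, with `v` an integer.
  obtain ⟨u, v, huv⟩ := hΛH _ hl'Λ _ hflag.mem
  have hu : (p : ℤ) ∣ u := by
    have h1 := hLH _ hx' _ hx'
    have h2 := hΛH _ hl'Λ _ hl'Λ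
    have h3 : H ((p : ℂ)⁻¹ • e + l') ((p : ℂ)⁻¹ • e + l') =
        (p : ℂ)⁻¹ * (2 * u) + H l' l' := by
      simp only [map_add, map_smul, LinearMap.add_apply, LinearMap.smul_apply, LinearMap.map_smulₛₗ,
        he, smul_eq_mul, hherm l' e, huv, map_inv₀, map_natCast, map_mul, map_intCast,
        conj_rootC]
      ring
    have h4 : ((2 * u : ℤ) : ℂ) ∈ orderMul Δ p := by
      refine ⟨H ((p : ℂ)⁻¹ • e + l') ((p : ℂ)⁻¹ • e + l') - H l' l', sub_mem h1 h2, ?_⟩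
      rw [h3]
      push_cast
      field_simp
      ring
    have h5 := (intCast_mem_orderMul_iff hΔ).1 h4
    have hpp := Nat.prime_iff_prime_int.1 hp.out
    refine (hpp.dvd_or_dvd h5).resolve_left fun h => ne_two_of_inert hinert ?_
    have : p ∣ 2 := by exact_mod_cast h
    exact (Nat.prime_dvd_prime_iff_eq hp.out Nat.prime_two).1 this
  obtain ⟨u', rfl⟩ := hu
  have hh := hΛH _ hflag.mem _ hfΛ
  obtain ⟨n, hn, hnn⟩ := exists_norm hΔ hinert hh hef
  set h := H e f with hhdef
  have hcop : ¬ (p : ℤ) ∣ (N : ℤ) ^ 2 * Δ * n := by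
    have hpp := Nat.prime_iff_prime_int.1 hp.out
    intro hdvd
    rcases hpp.dvd_or_dvd hdvd with h1 | h1
    · rcases hpp.dvd_or_dvd h1 with h2 | h2
      · exact hN (by exact_mod_cast hpp.dvd_of_dvd_pow h2)
      · exact not_dvd_of_inert hinert h2
    · exact hn h1
  -- With this parameter `s`, the transform of `y` is, up to elements of `M`, a multiple of
  -- `p⁻¹ e + l'` plus a vector of `Λ` that is orthogonal to `e` modulo `p`.
  obtain ⟨s, hs, q, hq⟩ : ∃ s : ℕ, s < p ∧ ∃ q : ℤ,
      1 + (N : ℤ) ^ 2 * Δ * n * s + N * Δ * v = p * q := by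
    obtain ⟨m, k', hmk⟩ := exists_int_inv hcop
    have hp' : (0 : ℤ) < p := by exact_mod_cast hp.out.pos
    refine ⟨((-(m * (1 + N * Δ * v))) % p).toNat, ?_, ?_⟩
    · have h1 := Int.emod_lt_of_pos (-(m * (1 + N * Δ * v))) hp'
      have h2 := Int.emod_nonneg (-(m * (1 + N * Δ * v))) hp'.ne'
      omega
    · rw [Int.toNat_of_nonneg (Int.emod_nonneg _ hp'.ne'), Int.emod_def]
      generalize (-(m * (1 + N * Δ * v))) / (p : ℤ) = d
      refine ⟨-((1 + N * Δ * v) * k') - (N : ℤ) ^ 2 * Δ * n * d, ?_⟩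
      linear_combination (-(1 + N * Δ * v)) * hmk
  refine ⟨s, hs, fun y hy => ?_⟩
  have hye := hΛH _ hy _ hflag.mem
  have hyf := hΛH _ hy _ hfΛ
  set b := H y e with hb
  have hω := rootC_mem Δ
  have hNat : ∀ k : ℕ, (k : ℂ) ∈ order Δ := natCast_mem _
  have hint : ∀ k : ℤ, (k : ℂ) ∈ order Δ := intCast_mem _
  have key : transv H Δ f (-(p * N * s)) (transv H Δ e (N / p) y) =
      ((N : ℂ) * rootC Δ * b) • ((p : ℂ)⁻¹ • e + l') +
        ((y + ((N : ℂ) ^ 2 * s * Δ * b * h) • f - (N * rootC Δ * b) • l') -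
        (p : ℂ) • (N * s * rootC Δ * H y f) • f) := by
    rw [transv_transv hhdef.symm]
    simp only [smul_add, smul_smul]
    push_cast
    have e1 : (N : ℂ) / p * rootC Δ * b = N * rootC Δ * b * (p : ℂ)⁻¹ := by ring
    have e2 : (-(p * N * s : ℂ)) * (N / p) * Δ * b * h = -((N : ℂ) ^ 2 * s * Δ * b * h) := by
      field_simp
    have e3 : -(p * N * s : ℂ) * rootC Δ * H y f = -(p * (N * s * rootC Δ * H y f)) := by ring
    rw [e1, e2, e3, neg_smul, neg_smul]
    abel
  rw [key]
  refine add_mem (hLO _ (mul_mem (mul_mem (hNat _) hω) hye) _ hx') (sub_mem ?_ ?_)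
  · have hBΛ : y + ((N : ℂ) ^ 2 * s * Δ * b * h) • f - (N * rootC Δ * b) • l' ∈ Λ := by
      refine sub_mem (add_mem hy (hΛO _ ?_ _ hfΛ)) (hΛO _ ?_ _ hl'Λ)
      · exact mul_mem (mul_mem (mul_mem (mul_mem (pow_mem (hNat _) _) (hNat _)) (hNat _)) hye) hh
      · exact mul_mem (mul_mem (hNat _) hω) hye
    obtain ⟨y1, hy1, y2, hy2, hyy⟩ := hflag.span _ hBΛ (by
      have hfe : H f e = conj h := hherm _ _
      refine ⟨b * (q - N * rootC Δ * u'), mul_mem hye (sub_mem (hint _)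
        (mul_mem (mul_mem (hNat _) hω) (hint _))), ?_⟩
      have hqC : (1 : ℂ) + (N : ℂ) ^ 2 * Δ * n * s + N * Δ * v = p * q := by exact_mod_cast hq
      simp only [map_add, map_sub, map_smul, LinearMap.add_apply, LinearMap.sub_apply,
        LinearMap.smul_apply, smul_eq_mul, hfe, huv, ← hb]
      push_cast
      linear_combination b * hqC + ((N : ℂ) ^ 2 * s * Δ * b) * hnn
        - (N * b * v : ℂ) * rootC_mul_self Δ)
    rw [hyy]
    exact add_mem (hML hy1) (hLO _ hω _ (hML hy2))
  · refine hML (hpM _ (hΛO _ ?_ _ hfΛ))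
    exact mul_mem (mul_mem (mul_mem (hNat _) (hNat _)) hω) hyf

theorem not_mem_order_of_not_dvd (hΔ : 0 < Δ) [hp : Fact p.Prime] {m : ℤ} (hm : ¬ (p : ℤ) ∣ m) :
    (m : ℂ) / p * rootC Δ ∉ order Δ := by
  rintro ⟨a, b, h⟩
  have hp0 : (p : ℂ) ≠ 0 := by exact_mod_cast hp.out.ne_zero
  have h1 : ((0 : ℤ) : ℂ) + m * rootC Δ = ((p * a : ℤ) : ℂ) + ((p * b : ℤ) : ℂ) * rootC Δ := by
    push_cast
    rw [mul_assoc, ← mul_add, ← h]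
    field_simp
    ring
  exact hm ⟨b, (order_ext hΔ h1).2⟩

/-- The transvection along `e` with parameter `N / p` does not preserve `Λ`. -/
theorem transv_not_mem (hΔ : 0 < Δ) [hp : Fact p.Prime]
    (hinert : legendreSym p (-(Δ : ℤ)) = -1) (hN : ¬ p ∣ N) (hherm : ∀ x y, H y x = conj (H x y))
    (hΛH : ∀ x ∈ Λ, ∀ y ∈ Λ, H x y ∈ order Δ) (heΛ : e ∈ Λ)
    (hfΛ : f ∈ Λ) (hf : H f f = 0) (hef : H e f ∉ orderMul Δ p) :
    transv H Δ e (N / p) f ∉ Λ := by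
  intro hmem
  obtain ⟨n, hn, hnn⟩ := exists_norm hΔ hinert (hΛH _ heΛ _ hfΛ) hef
  have h1 := hΛH _ hmem _ hfΛ
  have hpp := Nat.prime_iff_prime_int.1 hp.out
  have hm : ¬ (p : ℤ) ∣ N * n := fun hdvd => (hpp.dvd_or_dvd hdvd).elim
    (fun h => hN (by exact_mod_cast h)) hn
  refine not_mem_order_of_not_dvd hΔ hm ?_
  convert h1 using 1
  simp only [transv, map_add, map_smul, LinearMap.add_apply, LinearMap.smul_apply, smul_eq_mul, hf,
    hherm e f]
  push_cast
  linear_combination (-(N / p * rootC Δ) : ℂ) * hnn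

/-- The `p` lattices of `le_or_exists_transv` that differ from `Λ` are pairwise different. -/
theorem transv_conj_not_mem (hΔ : 0 < Δ) [hp : Fact p.Prime]
    (hinert : legendreSym p (-(Δ : ℤ)) = -1) (hN : ¬ p ∣ N) (hherm : ∀ x y, H y x = conj (H x y))
    (hΛH : ∀ x ∈ Λ, ∀ y ∈ Λ, H x y ∈ order Δ) (heΛ : e ∈ Λ) (he : H e e = 0)
    (hfΛ : f ∈ Λ) (hf : H f f = 0) (hef : H e f ∉ orderMul Δ p) {d : ℤ} (hd : ¬ (p : ℤ) ∣ d) :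
    transv H Δ e (-(N / p)) (transv H Δ f (p * N * d) (transv H Δ e (N / p) f)) ∉ Λ := by
  intro hmem
  obtain ⟨n, hn, hnn⟩ := exists_norm hΔ hinert (hΛH _ heΛ _ hfΛ) hef
  have hp0 : (p : ℂ) ≠ 0 := by exact_mod_cast hp.out.ne_zero
  have h1 := hΛH _ hmem _ hfΛ
  have hpp := Nat.prime_iff_prime_int.1 hp.out
  have hm : ¬ (p : ℤ) ∣ N ^ 3 * d * Δ * n ^ 2 := by
    intro hdvd
    rcases hpp.dvd_or_dvd hdvd with h | h
    · rcases hpp.dvd_or_dvd h with h | h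
      · rcases hpp.dvd_or_dvd h with h | h
        · exact hN (by exact_mod_cast hpp.dvd_of_dvd_pow h)
        · exact hd h
      · exact not_dvd_of_inert hinert h
    · exact hn (hpp.dvd_of_dvd_pow h)
  refine not_mem_order_of_not_dvd hΔ hm ?_
  convert h1 using 1
  have hfe : H f e = conj (H e f) := hherm _ _
  rw [transv_transv rfl]
  simp only [transv, map_add, map_sub, map_smul, LinearMap.add_apply, LinearMap.sub_apply,
    LinearMap.smul_apply, smul_eq_mul, hf, he, hfe]
  push_cast
  rw [← hnn]
  field_simp
  ring

/-- A generator of the line of a flag can be replaced by an isotropic one. -/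
theorem exists_isotropic (hΔ : 0 < Δ) [hp : Fact p.Prime]
    (hinert : legendreSym p (-(Δ : ℤ)) = -1) (hherm : ∀ x y, H y x = conj (H x y))
    (hΛO : ∀ z ∈ order Δ, ∀ x ∈ Λ, z • x ∈ Λ) (hΛH : ∀ x ∈ Λ, ∀ y ∈ Λ, H x y ∈ order Δ)
    (hpM : ∀ x ∈ Λ, (p : ℂ) • x ∈ M) (hMΛ : M ≤ Λ) (hflag : IsFlag H Δ p Λ M e)
    (hfΛ : f ∈ Λ) (hf : H f f = 0) (hef : H e f ∉ orderMul Δ p) :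
    ∃ e', IsFlag H Δ p Λ M e' ∧ H e' e' = 0 ∧ H e' f ∉ orderMul Δ p := by
  obtain ⟨n, hn, hnn⟩ := exists_norm hΔ hinert (hΛH _ hflag.mem _ hfΛ) hef
  obtain ⟨w, hw, hee⟩ := hflag.orth e (by simpa using hflag.smul_mem 1 (one_mem _))
  have hpp := Nat.prime_iff_prime_int.1 hp.out
  have h2n : ¬ (p : ℤ) ∣ 2 * n := fun h => (hpp.dvd_or_dvd h).elim (fun h =>
    ne_two_of_inert hinert ((Nat.prime_dvd_prime_iff_eq hp.out Nat.prime_two).1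
      (by exact_mod_cast h))) hn
  have hp0 : (p : ℂ) ≠ 0 := by exact_mod_cast hp.out.ne_zero
  have hef' := hΛH _ hflag.mem _ hfΛ
  set t : V := -(w * H e f) • f with ht
  have htΛ : t ∈ Λ := hΛO _ (neg_mem (mul_mem hw hef')) _ hfΛ
  have hint : ∀ k : ℤ, (k : ℂ) ∈ order Δ := intCast_mem _
  obtain ⟨m, k, hmk⟩ := exists_int_inv h2n
  have hmk' : (m : ℂ) * (2 * n) = 1 + p * k := by exact_mod_cast hmk
  have h2nC : ((2 * n : ℤ) : ℂ) ∉ orderMul Δ p := by rwa [intCast_mem_orderMul_iff hΔ]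
  refine ⟨((2 * n : ℤ) : ℂ) • e + (p : ℂ) • t, ⟨?_, ?_, ?_, ?_, ?_⟩, ?_, ?_⟩
  · exact add_mem (hΛO _ (hint _) _ hflag.mem) (hMΛ (hpM _ htΛ))
  · intro x hx
    rw [map_add, LinearMap.map_smulₛₗ, LinearMap.map_smulₛₗ, smul_eq_mul, smul_eq_mul,
      map_intCast, map_natCast]
    exact add_mem (mul_mem_orderMul (hint _) (hflag.orth x hx)) (p_mul_mem (hΛH _ (hMΛ hx) _ htΛ))
  · intro z hz
    rw [smul_add, smul_smul, smul_comm z]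
    exact add_mem (hflag.smul_mem _ (mul_mem hz (hint _))) (hpM _ (hΛO _ hz _ htΛ))
  · intro x hx hxe
    refine hflag.span x hx ?_
    rw [map_add, LinearMap.map_smulₛₗ, LinearMap.map_smulₛₗ, smul_eq_mul, smul_eq_mul,
      map_intCast, map_natCast] at hxe
    refine mem_orderMul_of_mul_mem hΔ hinert (hΛH _ hx _ hflag.mem) (hint (2 * n)) ?_ h2nC
    have := sub_mem hxe (p_mul_mem (p := p) (hΛH _ hx _ htΛ))
    rwa [add_sub_cancel_right] at this
  · intro z hz hzM
    obtain ⟨c, hc, l, hl, rfl⟩ := hflag.perp z hz hzM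
    refine ⟨c * m, mul_mem hc (hint _), l - (c * k) • e - (c * m) • t, ?_, ?_⟩
    · exact sub_mem (sub_mem hl (hΛO _ (mul_mem hc (hint _)) _ hflag.mem))
        (hΛO _ (mul_mem hc (hint _)) _ htΛ)
    · have h1 : (c * m) * ((2 * n : ℤ) : ℂ) = c + p * (c * k) := by
        push_cast
        linear_combination c * hmk'
      rw [smul_add, smul_smul, h1, add_smul, mul_smul (p : ℂ), smul_sub, smul_sub,
        smul_comm (c * m : ℂ) (p : ℂ)]
      abel
  · have hreal : conj (H e e) = H e e := (hherm e e).symm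
    have hw' : conj w = w := by
      rw [hee, map_mul, map_natCast] at hreal
      exact mul_left_cancel₀ hp0 hreal
    simp only [ht, map_add, map_smul, LinearMap.add_apply, LinearMap.smul_apply,
      LinearMap.map_smulₛₗ, smul_eq_mul, hf, hherm e f, hee, map_natCast, map_intCast,
      map_neg, map_mul, hw']
    push_cast
    linear_combination (-(4 * n * p * w) : ℂ) * hnn
  · intro h
    have h1 : H (((2 * n : ℤ) : ℂ) • e + (p : ℂ) • t) f = ((2 * n : ℤ) : ℂ) * H e f := by
      simp only [ht, map_add, map_smul, LinearMap.add_apply, LinearMap.smul_apply, smul_eq_mul, hf,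
        mul_zero, add_zero]
    rw [h1] at h
    exact hef (mem_orderMul_of_mul_mem hΔ hinert hef' (hint _) h h2nC)

end Lattice

/-! ### Row vectors as elements of a Hermitian space -/

section Coordinates

/-- The diagonal entries of `E = diag (1, 1, -1)`. -/
def sgn : Fin 2 ⊕ Fin 1 → ℝ := Sum.elim (fun _ => 1) (fun _ => -1)

theorem sgn_mul_self (i : Fin 2 ⊕ Fin 1) : sgn i * sgn i = 1 := by
  rcases i with i | i <;> simp [sgn]

theorem Ers_eq_diagonal : Ers 2 1 ℝ = diagonal sgn := by
  ext i j
  rcases i with i | i <;> rcases j with j | j <;>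
    simp [Ers, sgn, Matrix.one_apply, Matrix.diagonal_apply]
  split_ifs <;> simp

variable {Δ : ℕ}

/-- The identification `(x, y) ↦ x + √-Δ y E` of `ℝ⁶` with `ℂ³`, which turns `α(√-Δ)` into the
multiplication by `√-Δ`. -/
noncomputable def phi (hΔ : 0 < Δ) :
    ((Fin 2 ⊕ Fin 1) ⊕ (Fin 2 ⊕ Fin 1) → ℝ) ≃ₗ[ℝ] (Fin 2 ⊕ Fin 1 → ℂ) where
  toFun x := fun i => x (.inl i) + rootC Δ * (sgn i * x (.inr i) : ℝ)
  map_add' x y := by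
    funext i
    simp only [Pi.add_apply]
    push_cast
    ring
  map_smul' c x := by
    funext i
    simp only [Pi.smul_apply, smul_eq_mul, RingHom.id_apply, Complex.real_smul]
    push_cast
    ring
  invFun u := Sum.elim (fun i => (u i).re) (fun i => sgn i * ((u i).im / Real.sqrt Δ))
  left_inv x := by
    have hs : Real.sqrt Δ ≠ 0 := (Real.sqrt_pos.2 (by exact_mod_cast hΔ)).ne'
    funext i
    rcases i with i | i
    · simp [rootC]
    · simp [rootC, hs]
      rw [← mul_assoc, sgn_mul_self, one_mul]
  right_inv u := by
    have hs : Real.sqrt Δ ≠ 0 := (Real.sqrt_pos.2 (by exact_mod_cast hΔ)).ne'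
    funext i
    simp only [Sum.elim_inl, Sum.elim_inr]
    rw [← mul_assoc, sgn_mul_self, one_mul]
    apply Complex.ext
    · simp [rootC]
    · simp [rootC]
      field_simp

variable (hΔ : 0 < Δ)

theorem phi_apply (x : (Fin 2 ⊕ Fin 1) ⊕ (Fin 2 ⊕ Fin 1) → ℝ) (i : Fin 2 ⊕ Fin 1) :
    phi hΔ x i = x (.inl i) + rootC Δ * (sgn i * x (.inr i) : ℝ) := rfl

theorem vecMul_rootMat (x : (Fin 2 ⊕ Fin 1) ⊕ (Fin 2 ⊕ Fin 1) → ℝ) :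
    x ᵥ* rootMat 2 1 (Δ : ℝ) =
      Sum.elim (fun i => -(Δ * sgn i * x (.inr i))) (fun i => sgn i * x (.inl i)) := by
  funext i
  rw [rootMat_eq, Ers_eq_diagonal]
  rcases i with i | i <;>
    simp [vecMul, dotProduct, Matrix.diagonal_apply, Finset.sum_ite_eq'] <;> ring

theorem dotProduct_J (x y : (Fin 2 ⊕ Fin 1) ⊕ (Fin 2 ⊕ Fin 1) → ℝ) :
    x ⬝ᵥ (J (Fin 2 ⊕ Fin 1) ℝ *ᵥ y) =
      ∑ i, (x (.inr i) * y (.inl i) - x (.inl i) * y (.inr i)) := by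
  have h : J (Fin 2 ⊕ Fin 1) ℝ *ᵥ y = Sum.elim (fun i => -y (.inr i)) (fun i => y (.inl i)) := by
    funext i
    rcases i with i | i <;> simp [J, mulVec, dotProduct, Matrix.one_apply]
  rw [h]
  simp only [dotProduct, Fintype.sum_sum_type (α₁ := Fin 2 ⊕ Fin 1) (α₂ := Fin 2 ⊕ Fin 1),
    Sum.elim_inl, Sum.elim_inr, Finset.sum_sub_distrib]
  simp only [mul_neg, Finset.sum_neg_distrib]
  ring

theorem phi_vecMul_rootMat (x : (Fin 2 ⊕ Fin 1) ⊕ (Fin 2 ⊕ Fin 1) → ℝ) :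
    phi hΔ (x ᵥ* rootMat 2 1 (Δ : ℝ)) = rootC Δ • phi hΔ x := by
  funext i
  rw [vecMul_rootMat, phi_apply]
  simp only [Sum.elim_inl, Sum.elim_inr, Pi.smul_apply, smul_eq_mul, phi_apply]
  rw [← mul_assoc (sgn i), sgn_mul_self]
  push_cast
  linear_combination (-(sgn i * x (.inr i)) : ℂ) * rootC_mul_self Δ

/-- The Hermitian form with matrix `E` on `ℂ³`. -/
noncomputable def herm : (Fin 2 ⊕ Fin 1 → ℂ) →ₗ[ℂ] (Fin 2 ⊕ Fin 1 → ℂ) →ₗ⋆[ℂ] ℂ :=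
  LinearMap.mk₂'ₛₗ (RingHom.id ℂ) (starRingEnd ℂ) (fun u v => ∑ i, sgn i * (u i * conj (v i)))
    (fun u u' v => by simp only [Pi.add_apply, add_mul, mul_add, Finset.sum_add_distrib])
    (fun c u v => by
      simp only [Pi.smul_apply, smul_eq_mul, Finset.mul_sum, RingHom.id_apply]
      exact Finset.sum_congr rfl fun i _ => by ring)
    (fun u v v' => by simp only [Pi.add_apply, map_add, mul_add, Finset.sum_add_distrib])
    (fun c u v => by
      simp only [Pi.smul_apply, smul_eq_mul, Finset.mul_sum, map_mul]
      exact Finset.sum_congr rfl fun i _ => by ring)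

theorem herm_apply (u v : Fin 2 ⊕ Fin 1 → ℂ) : herm u v = ∑ i, sgn i * (u i * conj (v i)) := rfl

theorem herm_symm (u v : Fin 2 ⊕ Fin 1 → ℂ) : herm v u = conj (herm u v) := by
  simp only [herm_apply, map_sum, map_mul, Complex.conj_ofReal, Complex.conj_conj]
  exact Finset.sum_congr rfl fun i _ => by ring

/-- The symplectic form is the coefficient of `√-Δ` in the Hermitian form. -/
theorem herm_phi (x y : (Fin 2 ⊕ Fin 1) ⊕ (Fin 2 ⊕ Fin 1) → ℝ) :
    herm (phi hΔ x) (phi hΔ y) =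
      ((x ᵥ* rootMat 2 1 (Δ : ℝ)) ⬝ᵥ (J (Fin 2 ⊕ Fin 1) ℝ *ᵥ y) : ℝ) +
        (x ⬝ᵥ (J (Fin 2 ⊕ Fin 1) ℝ *ᵥ y) : ℝ) * rootC Δ := by
  rw [herm_apply, dotProduct_J, dotProduct_J, vecMul_rootMat]
  push_cast
  rw [Finset.sum_mul, ← Finset.sum_add_distrib]
  refine Finset.sum_congr rfl fun i _ => ?_
  simp only [phi_apply, map_add, map_mul, Complex.conj_ofReal, conj_rootC, Sum.elim_inl,
    Sum.elim_inr]
  have h : (sgn i : ℂ) * sgn i = 1 := by exact_mod_cast sgn_mul_self i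
  push_cast
  generalize (sgn i : ℂ) = s at *
  linear_combination (-(s ^ 3 * x (.inr i) * y (.inr i)) : ℂ) * rootC_mul_self Δ +
    ((x (.inr i) * y (.inl i) - x (.inl i) * y (.inr i)) * rootC Δ
      + s * Δ * x (.inr i) * y (.inr i)) * h

theorem real_add_mul_rootC_inj (hΔ : 0 < Δ) {a b c d : ℝ}
    (h : (a : ℂ) + b * rootC Δ = c + d * rootC Δ) : a = c ∧ b = d := by
  have hs : Real.sqrt Δ ≠ 0 := (Real.sqrt_pos.2 (by exact_mod_cast hΔ)).ne'
  have hre := congrArg Complex.re h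
  have him := congrArg Complex.im h
  simp [rootC, hs] at hre him
  exact ⟨hre, him⟩

/-- The lattice `ℤ[√-Δ]³`. -/
def stdLattice (Δ : ℕ) : AddSubgroup (Fin 2 ⊕ Fin 1 → ℂ) where
  carrier := {u | ∀ i, u i ∈ order Δ}
  zero_mem' := fun _ => zero_mem _
  add_mem' := fun hu hv i => add_mem (hu i) (hv i)
  neg_mem' := fun hu i => neg_mem (hu i)

theorem smul_mem_stdLattice : ∀ z ∈ order Δ, ∀ u ∈ stdLattice Δ, z • u ∈ stdLattice Δ :=
  fun _ hz _ hu i => mul_mem hz (hu i)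

theorem sgn_mem_order (i : Fin 2 ⊕ Fin 1) : (sgn i : ℂ) ∈ order Δ := by
  rcases i with i | i
  · simp [sgn, one_mem]
  · simp [sgn, one_mem]

theorem herm_mem_order : ∀ u ∈ stdLattice Δ, ∀ v ∈ stdLattice Δ, herm u v ∈ order Δ :=
  fun u hu v hv => by
    rw [herm_apply]
    exact sum_mem fun i _ => mul_mem (sgn_mem_order i) (mul_mem (hu i) (conj_mem_order (hv i)))

/-- The lattice `ℤ⁶` corresponds to `ℤ[√-Δ]³`. -/
theorem phi_mem_stdLattice_iff (x : (Fin 2 ⊕ Fin 1) ⊕ (Fin 2 ⊕ Fin 1) → ℝ) :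
    phi hΔ x ∈ stdLattice Δ ↔ ∃ z : (Fin 2 ⊕ Fin 1) ⊕ (Fin 2 ⊕ Fin 1) → ℤ, x = fun i => (z i : ℝ) := by
  constructor
  · intro h
    have h1 : ∀ i, ∃ a b : ℤ, x (.inl i) = a ∧ x (.inr i) = b := by
      intro i
      obtain ⟨a, b, hab⟩ := h i
      rw [phi_apply, mul_comm] at hab
      have h2 := real_add_mul_rootC_inj hΔ (c := a) (d := b) (by rw [hab]; push_cast; rfl)
      rcases i with i | i
      · exact ⟨a, b, h2.1, by simpa [sgn] using h2.2⟩
      · exact ⟨a, -b, h2.1, by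
          have := h2.2
          simp [sgn] at this
          push_cast
          linarith⟩
    choose a b hab using h1
    refine ⟨Sum.elim a b, ?_⟩
    funext i
    rcases i with i | i
    · exact (hab i).1
    · exact (hab i).2
  · rintro ⟨z, rfl⟩ i
    rw [phi_apply]
    refine add_mem ?_ (mul_mem (rootC_mem _) ?_)
    · simp [intCast_mem]
    · push_cast
      exact mul_mem (sgn_mem_order i) (intCast_mem (order Δ) (z (.inr i)))

/-- The right action of a real matrix on row vectors, transported to `ℂ³`. -/
noncomputable def rowAct
    (A : Matrix ((Fin 2 ⊕ Fin 1) ⊕ (Fin 2 ⊕ Fin 1)) ((Fin 2 ⊕ Fin 1) ⊕ (Fin 2 ⊕ Fin 1)) ℝ) :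
    (Fin 2 ⊕ Fin 1 → ℂ) →ₗ[ℝ] (Fin 2 ⊕ Fin 1 → ℂ) :=
  (phi hΔ).toLinearMap ∘ₗ A.vecMulLinear ∘ₗ (phi hΔ).symm.toLinearMap

variable {A B : Matrix ((Fin 2 ⊕ Fin 1) ⊕ (Fin 2 ⊕ Fin 1)) ((Fin 2 ⊕ Fin 1) ⊕ (Fin 2 ⊕ Fin 1)) ℝ}

theorem rowAct_phi (x : (Fin 2 ⊕ Fin 1) ⊕ (Fin 2 ⊕ Fin 1) → ℝ) :
    rowAct hΔ A (phi hΔ x) = phi hΔ (x ᵥ* A) := by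
  simp [rowAct]

theorem rowAct_mul (u : Fin 2 ⊕ Fin 1 → ℂ) :
    rowAct hΔ (A * B) u = rowAct hΔ B (rowAct hΔ A u) := by
  obtain ⟨x, rfl⟩ := (phi hΔ).surjective u
  rw [rowAct_phi, rowAct_phi, rowAct_phi, vecMul_vecMul]

theorem rowAct_one (u : Fin 2 ⊕ Fin 1 → ℂ) : rowAct hΔ 1 u = u := by
  obtain ⟨x, rfl⟩ := (phi hΔ).surjective u
  rw [rowAct_phi, vecMul_one]

theorem rowAct_smul_mat (c : ℝ) (u : Fin 2 ⊕ Fin 1 → ℂ) :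
    rowAct hΔ (c • A) u = c • rowAct hΔ A u := by
  obtain ⟨x, rfl⟩ := (phi hΔ).surjective u
  rw [rowAct_phi, rowAct_phi, vecMul_smul, map_smul]

theorem ext_rowAct (h : ∀ u, rowAct hΔ A u = rowAct hΔ B u) : A = B := by
  ext i j
  have h1 := h (phi hΔ (Pi.single i 1))
  rw [rowAct_phi, rowAct_phi] at h1
  have h2 := congrFun ((phi hΔ).injective h1) j
  simpa using h2

theorem exists_mat (f : (Fin 2 ⊕ Fin 1 → ℂ) →ₗ[ℝ] (Fin 2 ⊕ Fin 1 → ℂ)) :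
    ∃ A, ∀ u, rowAct hΔ A u = f u := by
  refine ⟨(LinearMap.toMatrix' ((phi hΔ).symm.toLinearMap ∘ₗ f ∘ₗ (phi hΔ).toLinearMap))ᵀ, ?_⟩
  intro u
  obtain ⟨x, rfl⟩ := (phi hΔ).surjective u
  rw [rowAct_phi, vecMul_transpose, LinearMap.toMatrix'_mulVec]
  simp

theorem rowAct_complex_smul (hA : A * rootMat 2 1 (Δ : ℝ) = rootMat 2 1 (Δ : ℝ) * A) (z : ℂ)
    (u : Fin 2 ⊕ Fin 1 → ℂ) : rowAct hΔ A (z • u) = z • rowAct hΔ A u := by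
  have hs : Real.sqrt Δ ≠ 0 := (Real.sqrt_pos.2 (by exact_mod_cast hΔ)).ne'
  have hroot : rowAct hΔ A (rootC Δ • u) = rootC Δ • rowAct hΔ A u := by
    obtain ⟨x, rfl⟩ := (phi hΔ).surjective u
    rw [← phi_vecMul_rootMat, rowAct_phi, rowAct_phi, ← phi_vecMul_rootMat, vecMul_vecMul,
      vecMul_vecMul, hA]
  have hz : z = z.re + (z.im / Real.sqrt Δ : ℝ) * rootC Δ := by
    have hsC : (Real.sqrt Δ : ℂ) ≠ 0 := by exact_mod_cast hs
    conv_lhs => rw [← Complex.re_add_im z]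
    rw [rootC]
    push_cast
    field_simp
  have hre : ∀ (c : ℝ) (v : Fin 2 ⊕ Fin 1 → ℂ), (c : ℂ) • v = c • v := fun c v => by
    funext i
    simp
  rw [hz, add_smul, add_smul, map_add, mul_smul, mul_smul, hre, hre, hre, hre, map_smul, map_smul,
    hroot]

/-- A symplectic similitude that commutes with `α(√-Δ)` is a unitary similitude of `ℂ³`. -/
theorem herm_rowAct {c : ℝ} (hA : A * rootMat 2 1 (Δ : ℝ) = rootMat 2 1 (Δ : ℝ) * A)
    (hc : A * J _ ℝ * Aᵀ = c • J _ ℝ) (u v : Fin 2 ⊕ Fin 1 → ℂ) :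
    herm (rowAct hΔ A u) (rowAct hΔ A v) = c * herm u v := by
  obtain ⟨x, rfl⟩ := (phi hΔ).surjective u
  obtain ⟨y, rfl⟩ := (phi hΔ).surjective v
  have key : ∀ x y : (Fin 2 ⊕ Fin 1) ⊕ (Fin 2 ⊕ Fin 1) → ℝ,
      (x ᵥ* A) ⬝ᵥ (J _ ℝ *ᵥ (y ᵥ* A)) = c * (x ⬝ᵥ (J _ ℝ *ᵥ y)) := fun x y => by
    have e : J _ ℝ *ᵥ (y ᵥ* A) = (J _ ℝ * Aᵀ) *ᵥ y := by rw [← mulVec_transpose, mulVec_mulVec]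
    rw [e, ← dotProduct_mulVec, mulVec_mulVec, ← Matrix.mul_assoc, hc, smul_mulVec,
      dotProduct_smul, smul_eq_mul]
  rw [rowAct_phi, rowAct_phi, herm_phi, herm_phi, key, vecMul_vecMul, hA, ← vecMul_vecMul, key]
  push_cast
  ring

/-- A unitary transformation of `ℂ³` is given by a symplectic matrix that commutes with
`α(√-Δ)`. -/
theorem mat_of_herm (hsm : ∀ u, rowAct hΔ A (rootC Δ • u) = rootC Δ • rowAct hΔ A u)
    (hH : ∀ u v, herm (rowAct hΔ A u) (rowAct hΔ A v) = herm u v) :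
    A * rootMat 2 1 (Δ : ℝ) = rootMat 2 1 (Δ : ℝ) * A ∧ A * J _ ℝ * Aᵀ = (1 : ℝ) • J _ ℝ := by
  constructor
  · refine ext_rowAct hΔ fun u => ?_
    obtain ⟨x, rfl⟩ := (phi hΔ).surjective u
    have h := hsm (phi hΔ x)
    rw [← phi_vecMul_rootMat, rowAct_phi, rowAct_phi, ← phi_vecMul_rootMat] at h
    rw [rowAct_phi, rowAct_phi, ← vecMul_vecMul, ← vecMul_vecMul, h]
  · ext i j
    have h := hH (phi hΔ (Pi.single i 1)) (phi hΔ (Pi.single j 1))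
    rw [rowAct_phi, rowAct_phi, herm_phi, herm_phi] at h
    have h1 := (real_add_mul_rootC_inj hΔ h).2
    have e : J _ ℝ *ᵥ ((Pi.single j (1 : ℝ)) ᵥ* A) = (J _ ℝ * Aᵀ) *ᵥ Pi.single j 1 := by
      rw [← mulVec_transpose, mulVec_mulVec]
    rw [e, ← dotProduct_mulVec, mulVec_mulVec, ← Matrix.mul_assoc] at h1
    simpa using h1

end Coordinates

/-! ### Integral matrices -/

section Integrality

set_option linter.unusedSectionVars false

/-- A real matrix with integer entries. -/
def IntMat {m : Type} (A : Matrix m m ℝ) : Prop := ∃ S : Matrix m m ℤ, A = S.map (Int.cast : ℤ → ℝ)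

/-- A real matrix with integer entries whose lower left block is divisible by `N`. -/
def BlockInt {n : Type} (N : ℕ) (A : Matrix (n ⊕ n) (n ⊕ n) ℝ) : Prop :=
  ∃ S : Matrix (n ⊕ n) (n ⊕ n) ℤ, A = S.map (Int.cast : ℤ → ℝ) ∧
    ∀ i j, (N : ℤ) ∣ S.toBlocks₂₁ i j

theorem map_intCast_injective {m : Type} {S T : Matrix m m ℤ}
    (h : S.map (Int.cast : ℤ → ℝ) = T.map Int.cast) : S = T := by
  ext i j
  have := congrFun (congrFun h i) j
  simpa using this

theorem IntMat.mul {m : Type} [Fintype m] {A B : Matrix m m ℝ} (hA : IntMat A) (hB : IntMat B) :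
    IntMat (A * B) := by
  obtain ⟨S, rfl⟩ := hA
  obtain ⟨T, rfl⟩ := hB
  exact ⟨S * T, (intCast_map_mul S T).symm⟩

variable {n : Type} [Fintype n] [DecidableEq n] {N : ℕ}
  {A B : Matrix (n ⊕ n) (n ⊕ n) ℝ}

theorem BlockInt.intMat (hA : BlockInt N A) : IntMat A := by
  obtain ⟨S, h, -⟩ := hA
  exact ⟨S, h⟩

theorem BlockInt.mul (hA : BlockInt N A) (hB : BlockInt N B) : BlockInt N (A * B) := by
  obtain ⟨S, rfl, hS⟩ := hA
  obtain ⟨T, rfl, hT⟩ := hB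
  refine ⟨S * T, (intCast_map_mul S T).symm, fun i j => ?_⟩
  have e : (S * T).toBlocks₂₁ = S.toBlocks₂₁ * T.toBlocks₁₁ + S.toBlocks₂₂ * T.toBlocks₂₁ := by
    conv_lhs => rw [← fromBlocks_toBlocks S, ← fromBlocks_toBlocks T, fromBlocks_multiply,
      toBlocks_fromBlocks₂₁]
  rw [e, Matrix.add_apply, Matrix.mul_apply, Matrix.mul_apply]
  exact dvd_add (Finset.dvd_sum fun k _ => (hS i k).mul_right _)
    (Finset.dvd_sum fun k _ => (hT k j).mul_left _)

theorem blockInt_of_mem {g : GSpPos n} (hg : g ∈ Gamma0 n N) : BlockInt N g.1.val := by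
  obtain ⟨S, -, hd, h⟩ := hg
  exact ⟨S, h, hd⟩

theorem similitude_of_mem {g : GSpPos n} (hg : g ∈ Gamma0 n N) :
    g.1.val * J n ℝ * g.1.valᵀ = (1 : ℝ) • J n ℝ := by
  obtain ⟨S, hS, -, h⟩ := hg
  have h2 := congrArg (fun X => X.map (Int.castRingHom ℝ)) (SymplecticGroup.mem_iff.1 hS)
  simp only [Matrix.map_mul, map_J] at h2
  rw [h, one_smul]
  exact h2

theorem mem_Gamma0_of_blockInt {g : GSpPos n} (h1 : g.1.val * J n ℝ * g.1.valᵀ = (1 : ℝ) • J n ℝ)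
    (hg : BlockInt N g.1.val) : g ∈ Gamma0 n N := by
  obtain ⟨S, hS, hd⟩ := hg
  refine ⟨S, ?_, hd, hS⟩
  rw [SymplecticGroup.mem_iff]
  apply map_intCast_injective
  rw [intCast_map_mul, intCast_map_mul, ← hS]
  have e : (J n ℤ).map (Int.cast : ℤ → ℝ) = J n ℝ := map_J n (Int.castRingHom ℝ)
  have e2 : (Sᵀ).map (Int.cast : ℤ → ℝ) = g.1.valᵀ := by rw [transpose_map, ← hS]
  rw [e, e2, h1, one_smul]

theorem blockInt_one_add (a : ℤ) (hA : IntMat A) :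
    BlockInt N ((a : ℝ) • (1 : Matrix (n ⊕ n) (n ⊕ n) ℝ) + (N : ℝ) • A) := by
  obtain ⟨S, rfl⟩ := hA
  refine ⟨Matrix.of fun i j => a * (if i = j then 1 else 0) + N * S i j, ?_, fun i j => ?_⟩
  · ext i j
    simp [Matrix.one_apply]
  · simp [toBlocks₂₁]

/-- The denominators `p` do not matter for the divisibility by `N`, which is prime to `p`. -/
theorem BlockInt.of_smul {p k : ℕ} [hp : Fact p.Prime] (hN : ¬ p ∣ N) (hA : IntMat A)
    (h : BlockInt N ((p : ℝ) ^ k • A)) : BlockInt N A := by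
  obtain ⟨S, rfl⟩ := hA
  obtain ⟨T, hT, hd⟩ := h
  refine ⟨S, rfl, fun i j => ?_⟩
  have e : T = Matrix.of fun i j => (p : ℤ) ^ k * S i j := by
    apply map_intCast_injective
    rw [← hT]
    ext i j
    simp
  have h1 := hd i j
  rw [e] at h1
  have hcop : IsCoprime (N : ℤ) ((p : ℤ) ^ k) :=
    (Nat.isCoprime_iff_coprime.2 ((Nat.Prime.coprime_iff_not_dvd hp.out).2 hN).symm).pow_right
  exact hcop.dvd_of_dvd_mul_left h1

/-- The inverse of an integral symplectic matrix is integral. -/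
theorem IntMat.inv {g : GSpPos n} (h1 : g.1.val * J n ℝ * g.1.valᵀ = (1 : ℝ) • J n ℝ)
    (hg : IntMat g.1.val) : IntMat (g⁻¹).1.val := by
  obtain ⟨S, hS⟩ := hg
  have hmem : g ∈ Gamma0 n 1 := mem_Gamma0_of_blockInt h1 ⟨S, hS, fun i j => by simp⟩
  exact (blockInt_of_mem (inv_mem hmem)).intMat

/-- A matrix is integral if and only if it maps `Λ = ℤ[√-Δ]³` to itself. -/
theorem intMat_iff_rowAct {Δ : ℕ} (hΔ : 0 < Δ)
    {A : Matrix ((Fin 2 ⊕ Fin 1) ⊕ (Fin 2 ⊕ Fin 1)) ((Fin 2 ⊕ Fin 1) ⊕ (Fin 2 ⊕ Fin 1)) ℝ} :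
    IntMat A ↔ ∀ u ∈ stdLattice Δ, rowAct hΔ A u ∈ stdLattice Δ := by
  constructor
  · rintro ⟨S, rfl⟩ u hu
    obtain ⟨x, rfl⟩ := (phi hΔ).surjective u
    obtain ⟨z, rfl⟩ := (phi_mem_stdLattice_iff hΔ x).1 hu
    rw [rowAct_phi, phi_mem_stdLattice_iff]
    refine ⟨z ᵥ* S, ?_⟩
    funext i
    simp [vecMul, dotProduct]
  · intro h
    have h1 : ∀ i, ∃ z : (Fin 2 ⊕ Fin 1) ⊕ (Fin 2 ⊕ Fin 1) → ℤ, A i = fun j => (z j : ℝ) := by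
      intro i
      have h2 := h (phi hΔ (Pi.single i 1)) ((phi_mem_stdLattice_iff hΔ _).2
        ⟨Pi.single i 1, by
          funext j
          by_cases hij : j = i
          · subst hij; simp
          · simp [hij]⟩)
      rw [rowAct_phi, phi_mem_stdLattice_iff, single_one_vecMul] at h2
      exact h2
    choose z hz using h1
    exact ⟨Matrix.of z, by
      ext i j
      exact congrFun (hz i) j⟩

end Integrality

/-! ### Maximal isotropic subspaces over `𝔽_p` -/

section ResidueField

variable {p Δ : ℕ} [hp : Fact p.Prime]

theorem toBilin'_J_apply {n R : Type} [Fintype n] [DecidableEq n] [CommRing R] (x y : n ⊕ n → R) :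
    Matrix.toBilin' (J n R) x y = x ⬝ᵥ (J n R *ᵥ y) := Matrix.toBilin'_apply' _ _ _

theorem dotProduct_J_swap {n R : Type} [Fintype n] [DecidableEq n] [CommRing R] (x y : n ⊕ n → R) :
    x ⬝ᵥ (J n R *ᵥ y) = -(y ⬝ᵥ (J n R *ᵥ x)) := by
  rw [dotProduct_mulVec, ← mulVec_transpose, J_transpose, neg_mulVec, neg_dotProduct,
    dotProduct_comm]

theorem isRefl_J {n R : Type} [Fintype n] [DecidableEq n] [CommRing R] :
    (Matrix.toBilin' (J n R)).IsRefl := fun x y h => by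
  rw [toBilin'_J_apply] at h ⊢
  rw [dotProduct_J_swap, h, neg_zero]

theorem nondegenerate_J {n R : Type} [Fintype n] [DecidableEq n] [Field R] :
    (Matrix.toBilin' (J n R)).Nondegenerate :=
  LinearMap.BilinForm.nondegenerate_toBilin'_iff_det_ne_zero.2 (isUnit_det_J n R).ne_zero

/-- `√-Δ` is skew for the symplectic form. -/
theorem rootMat_mul_J_eq {r s : ℕ} {R : Type} [CommRing R] {δ : R} :
    rootMat r s δ * J _ R = -(J _ R * (rootMat r s δ)ᵀ) := by
  rw [rootMat_mul_J]
  simp [rootMat_eq, fromBlocks_multiply, J, fromBlocks_transpose, Ers_transpose, fromBlocks_neg]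

theorem vecMul_rootMat_dotProduct_J {r s : ℕ} {R : Type} [CommRing R] {δ : R}
    (x y : (Fin r ⊕ Fin s) ⊕ (Fin r ⊕ Fin s) → R) :
    (x ᵥ* rootMat r s δ) ⬝ᵥ (J _ R *ᵥ y) = -(x ⬝ᵥ (J _ R *ᵥ (y ᵥ* rootMat r s δ))) := by
  rw [← mulVec_transpose _ y, mulVec_mulVec, ← dotProduct_mulVec, mulVec_mulVec, rootMat_mul_J_eq,
    neg_mulVec,
    dotProduct_neg]

theorem vecMul_rootMat_twice {r s : ℕ} {R : Type} [CommRing R] {δ : R}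
    (x : (Fin r ⊕ Fin s) ⊕ (Fin r ⊕ Fin s) → R) :
    x ᵥ* rootMat r s δ ᵥ* rootMat r s δ = -(δ • x) := by
  rw [vecMul_vecMul, rootMat_mul_self, vecMul_neg, vecMul_smul, vecMul_one]

/-- The norm form of `𝔽_{p²}` over `𝔽_p` is anisotropic. -/
theorem eq_zero_of_norm_eq_zero (hinert : legendreSym p (-(Δ : ℤ)) = -1) {a b : ZMod p}
    (h : a * a + Δ * (b * b) = 0) : a = 0 ∧ b = 0 := by
  have hb : b = 0 := by
    by_contra hb
    have hns := legendreSym.eq_neg_one_iff p |>.1 hinert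
    refine hns ⟨a / b, ?_⟩
    push_cast
    field_simp
    linear_combination -h
  subst hb
  simpa using h

/-- `𝔽_{p²} W` is stable under `√-Δ`. -/
theorem vecMul_mem_sup_map {r s : ℕ} {F : Type} [Field F] {δ : F}
    {W : Submodule F ((Fin r ⊕ Fin s) ⊕ (Fin r ⊕ Fin s) → F)}
    {x : (Fin r ⊕ Fin s) ⊕ (Fin r ⊕ Fin s) → F}
    (hx : x ∈ W ⊔ W.map (rootMat r s δ).vecMulLinear) :
    x ᵥ* rootMat r s δ ∈ W ⊔ W.map (rootMat r s δ).vecMulLinear := by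
  obtain ⟨y, hy, _, ⟨z, hz, rfl⟩, rfl⟩ := Submodule.mem_sup.1 hx
  rw [Matrix.vecMulLinear_apply, add_vecMul, vecMul_rootMat_twice]
  refine add_mem ?_ ?_
  · exact Submodule.mem_sup_right ⟨y, hy, rfl⟩
  · exact Submodule.mem_sup_left (neg_mem (W.smul_mem _ hz))

theorem finrank_eq_three
    {W : Submodule (ZMod p) ((Fin 2 ⊕ Fin 1) ⊕ (Fin 2 ⊕ Fin 1) → ZMod p)}
    (hW : (Matrix.toBilin' (J (Fin 2 ⊕ Fin 1) (ZMod p))).orthogonal W = W) :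
    Module.finrank (ZMod p) W = 3 := by
  have h1 := LinearMap.BilinForm.finrank_orthogonal
    (nondegenerate_J (n := Fin 2 ⊕ Fin 1) (R := ZMod p)) W
  have hle := Submodule.finrank_le W
  have hdim : Module.finrank (ZMod p) ((Fin 2 ⊕ Fin 1) ⊕ (Fin 2 ⊕ Fin 1) → ZMod p) = 6 := by
    simp
  rw [hW] at h1
  omega

/-- For a maximal isotropic `W` such that `𝔽_{p²} W` is neither `W` nor the whole space, the
orthogonal complement of `𝔽_{p²} W` is an `𝔽_{p²}`-line contained in `W`. -/
theorem exists_line (hinert : legendreSym p (-(Δ : ℤ)) = -1)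
    {W : Submodule (ZMod p) ((Fin 2 ⊕ Fin 1) ⊕ (Fin 2 ⊕ Fin 1) → ZMod p)}
    (hW : (Matrix.toBilin' (J (Fin 2 ⊕ Fin 1) (ZMod p))).orthogonal W = W)
    (h3 : Module.finrank (ZMod p)
      ↥(W ⊔ W.map (rootMat 2 1 (Δ : ZMod p)).vecMulLinear) ≠ 3)
    (h6 : Module.finrank (ZMod p)
      ↥(W ⊔ W.map (rootMat 2 1 (Δ : ZMod p)).vecMulLinear) ≠ 6) :
    ∃ e, e ≠ 0 ∧ e ∈ W ∧ e ᵥ* rootMat 2 1 (Δ : ZMod p) ∈ W ∧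
      (∀ x, x ∈ W ⊔ W.map (rootMat 2 1 (Δ : ZMod p)).vecMulLinear ↔
        (x ᵥ* rootMat 2 1 (Δ : ZMod p)) ⬝ᵥ (J _ (ZMod p) *ᵥ e) = 0 ∧
          x ⬝ᵥ (J _ (ZMod p) *ᵥ e) = 0) ∧
      ∀ z, (∀ y ∈ W, (z ᵥ* rootMat 2 1 (Δ : ZMod p)) ⬝ᵥ (J _ (ZMod p) *ᵥ y) = 0 ∧
          z ⬝ᵥ (J _ (ZMod p) *ᵥ y) = 0) →
        ∃ a b : ZMod p, z = a • e + b • (e ᵥ* rootMat 2 1 (Δ : ZMod p)) := by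
  set ω := rootMat 2 1 (Δ : ZMod p) with hω
  set B := Matrix.toBilin' (J (Fin 2 ⊕ Fin 1) (ZMod p)) with hB
  set S := W ⊔ W.map ω.vecMulLinear with hS
  have hnd : B.Nondegenerate := nondegenerate_J
  have hdim : Module.finrank (ZMod p) ((Fin 2 ⊕ Fin 1) ⊕ (Fin 2 ⊕ Fin 1) → ZMod p) = 6 := by
    simp
  have hortho : ∀ U : Submodule (ZMod p) ((Fin 2 ⊕ Fin 1) ⊕ (Fin 2 ⊕ Fin 1) → ZMod p),
      Module.finrank (ZMod p) (B.orthogonal U) = 6 - Module.finrank (ZMod p) U := fun U => by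
    rw [LinearMap.BilinForm.finrank_orthogonal hnd, hdim]
  have hle : ∀ U : Submodule (ZMod p) ((Fin 2 ⊕ Fin 1) ⊕ (Fin 2 ⊕ Fin 1) → ZMod p),
      Module.finrank (ZMod p) U ≤ 6 := fun U => hdim ▸ Submodule.finrank_le U
  have hmem : ∀ (U : Submodule (ZMod p) ((Fin 2 ⊕ Fin 1) ⊕ (Fin 2 ⊕ Fin 1) → ZMod p)) x,
      x ∈ B.orthogonal U ↔ ∀ y ∈ U, y ⬝ᵥ (J _ (ZMod p) *ᵥ x) = 0 := fun U x => by
    rw [LinearMap.BilinForm.mem_orthogonal_iff]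
    exact forall₂_congr fun y _ => by
      rw [← toBilin'_J_apply]
  have hW3 := finrank_eq_three hW
  have hS3 : 3 < Module.finrank (ZMod p) S :=
    lt_of_le_of_ne (hW3 ▸ Submodule.finrank_mono le_sup_left) (Ne.symm h3)
  have hSlt : Module.finrank (ZMod p) S < 6 := lt_of_le_of_ne (hle S) h6
  have hpos : 0 < Module.finrank (ZMod p) (B.orthogonal S) := by rw [hortho]; omega
  obtain ⟨e, heS, he0⟩ := (Submodule.ne_bot_iff _).1 (Submodule.one_le_finrank_iff.1 hpos)
  have heω : e ᵥ* ω ∈ B.orthogonal S := by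
    rw [hmem] at heS ⊢
    intro y hy
    have h1 := heS _ (vecMul_mem_sup_map hy)
    rwa [vecMul_rootMat_dotProduct_J, neg_eq_zero] at h1
  have hSW : B.orthogonal S ≤ W := by
    conv_rhs => rw [← hW]
    exact LinearMap.BilinForm.orthogonal_le le_sup_left
  set L := Submodule.span (ZMod p) (Set.range ![e, e ᵥ* ω]) with hL
  have hLS : L ≤ B.orthogonal S := Submodule.span_le.2 (by
    rintro _ ⟨i, rfl⟩
    fin_cases i
    · exact heS
    · exact heω)
  have hli : LinearIndependent (ZMod p) ![e, e ᵥ* ω] := by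
    rw [LinearIndependent.pair_iff]
    intro a b hab
    refine eq_zero_of_norm_eq_zero hinert ?_
    have h2 : a • (e ᵥ* ω) - (Δ * b) • e = 0 := by
      have h3 := congrArg (fun v => v ᵥ* ω) hab
      simp only [add_vecMul, smul_vecMul, zero_vecMul] at h3
      rw [vecMul_rootMat_twice] at h3
      rw [← h3, smul_neg, smul_smul, mul_comm b, sub_eq_add_neg]
    have h4 : (a * a + Δ * (b * b)) • e = 0 := by
      calc (a * a + Δ * (b * b)) • e
          = a • (a • e + b • (e ᵥ* ω)) - b • (a • (e ᵥ* ω) - (Δ * b) • e) := by module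
        _ = 0 := by rw [hab, h2]; simp
    exact (smul_eq_zero.1 h4).resolve_right he0
  have hL2 : Module.finrank (ZMod p) L = 2 := by
    rw [hL, finrank_span_eq_card hli]
    simp
  have hrefl : B.IsRefl := isRefl_J
  have hSL : S = B.orthogonal L := by
    refine Submodule.eq_of_le_of_finrank_le ?_ ?_
    · have h1 := LinearMap.BilinForm.orthogonal_le (B := B) hLS
      rwa [LinearMap.BilinForm.orthogonal_orthogonal hnd hrefl] at h1
    · rw [hortho, hL2]
      omega
  refine ⟨e, he0, hSW heS, hSW heω, fun x => ?_, fun z hz => ?_⟩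
  · rw [hSL, hmem]
    constructor
    · intro h
      have h1 := h e (Submodule.subset_span ⟨0, rfl⟩)
      have h2 := h (e ᵥ* ω) (Submodule.subset_span ⟨1, rfl⟩)
      rw [vecMul_rootMat_dotProduct_J, dotProduct_J_swap, h2]
      rw [dotProduct_J_swap, h1]
      simp
    · rintro ⟨h1, h2⟩ y hy
      obtain ⟨c, rfl⟩ := (Submodule.mem_span_range_iff_exists_fun _).1 hy
      rw [vecMul_rootMat_dotProduct_J, dotProduct_J_swap, neg_neg] at h1
      rw [dotProduct_J_swap] at h2
      rw [Fin.sum_univ_two]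
      simp only [Matrix.cons_val_zero, Matrix.cons_val_one, add_dotProduct, smul_dotProduct]
      rw [neg_eq_zero.1 h2, h1]
      simp
  · have hzS : z ∈ B.orthogonal S := by
      rw [hmem]
      intro y hy
      obtain ⟨w, hw, _, ⟨w', hw', rfl⟩, rfl⟩ := Submodule.mem_sup.1 hy
      have h1 := (hz w hw).2
      have h2 := (hz w' hw').1
      rw [dotProduct_J_swap, neg_eq_zero] at h1
      rw [dotProduct_J_swap, neg_eq_zero] at h2
      rw [add_dotProduct, h1, Matrix.vecMulLinear_apply, vecMul_rootMat_dotProduct_J, h2]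
      simp
    rw [hSL, LinearMap.BilinForm.orthogonal_orthogonal hnd hrefl] at hzS
    obtain ⟨c, hc⟩ := (Submodule.mem_span_range_iff_exists_fun _).1 hzS
    rw [Fin.sum_univ_two] at hc
    exact ⟨c 0, c 1, hc.symm⟩

end ResidueField

/-! ### Reduction modulo `p` -/

section Reduction

set_option linter.unusedSectionVars false

variable {n : Type} [Fintype n] [DecidableEq n] {p : ℕ} [hp : Fact p.Prime]

theorem mem_isoSubspace_iff {S : Matrix n n ℤ} {x : n → ZMod p} :
    x ∈ isoSubspace p S ↔ ∃ y : n → ℤ, x = fun i => ((y ᵥ* S) i : ZMod p) := by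
  rw [isoSubspace, Submodule.mem_span_range_iff_exists_fun]
  constructor
  · rintro ⟨c, rfl⟩
    refine ⟨fun i => (c i).cast, ?_⟩
    funext j
    simp [vecMul, dotProduct, Finset.sum_apply]
  · rintro ⟨y, rfl⟩
    refine ⟨fun i => y i, ?_⟩
    funext j
    simp [vecMul, dotProduct, Finset.sum_apply]

theorem exists_lift (x : n → ZMod p) : ∃ y : n → ℤ, x = fun i => (y i : ZMod p) :=
  ⟨fun i => (x i).cast, by simp⟩

/-- The symplectic form on integral vectors is compatible with base change. -/
theorem cast_dotProduct_J (R : Type) [CommRing R] (x y : n ⊕ n → ℤ) :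
    ((x ⬝ᵥ (J n ℤ *ᵥ y) : ℤ) : R) =
      (fun i => (x i : R)) ⬝ᵥ (J n R *ᵥ fun i => (y i : R)) := by
  rw [← map_J n (Int.castRingHom R)]
  simp [dotProduct, mulVec]

/-- The span of the rows of a matrix of multiplier `p` is maximal isotropic modulo `p`. -/
theorem orthogonal_isoSubspace {S : Matrix (n ⊕ n) (n ⊕ n) ℤ}
    (hS : S * J n ℤ * Sᵀ = (p : ℤ) • J n ℤ) (hS' : Sᵀ * J n ℤ * S = (p : ℤ) • J n ℤ) :
    (Matrix.toBilin' (J n (ZMod p))).orthogonal (isoSubspace p S) = isoSubspace p S := by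
  have hp0 : (p : ℤ) ≠ 0 := by exact_mod_cast hp.out.ne_zero
  ext z
  rw [LinearMap.BilinForm.mem_orthogonal_iff]
  constructor
  · intro h
    obtain ⟨z, rfl⟩ := exists_lift z
    have h1 : ∀ i, ∃ k : ℤ, (S *ᵥ (J n ℤ *ᵥ z)) i = p * k := by
      intro i
      have h2 := h (fun j => ((Pi.single i 1 ᵥ* S) j : ZMod p))
        (mem_isoSubspace_iff.2 ⟨Pi.single i 1, rfl⟩)
      rw [toBilin'_J_apply, ← cast_dotProduct_J,
        ZMod.intCast_zmod_eq_zero_iff_dvd, ← dotProduct_mulVec, single_one_dotProduct] at h2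
      exact h2
    choose k hk using h1
    have hk' : S *ᵥ (J n ℤ *ᵥ z) = (p : ℤ) • k := funext hk
    rw [mem_isoSubspace_iff]
    refine ⟨-(J n ℤ *ᵥ k), ?_⟩
    have h3 : (p : ℤ) • (-(J n ℤ *ᵥ k) ᵥ* S) = (p : ℤ) • z := by
      rw [neg_vecMul, smul_neg, ← smul_vecMul, ← mulVec_smul, ← hk', ← mulVec_transpose,
        mulVec_mulVec, mulVec_mulVec, mulVec_mulVec, hS', Matrix.smul_mul,
        J_squared, smul_mulVec, neg_mulVec, one_mulVec, smul_neg, neg_neg]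
    have h4 := smul_right_injective _ hp0 h3
    rw [h4]
  · intro h y hy
    obtain ⟨z, rfl⟩ := mem_isoSubspace_iff.1 h
    obtain ⟨y, rfl⟩ := mem_isoSubspace_iff.1 hy
    rw [toBilin'_J_apply, ← cast_dotProduct_J,
      ← mulVec_transpose _ z, mulVec_mulVec, ← dotProduct_mulVec, mulVec_mulVec,
      ← Matrix.mul_assoc, hS, smul_mulVec, dotProduct_smul]
    simp

end Reduction

/-! ### Elements of the double coset of `T_p` -/

section HeckeElements

variable {n : Type} [Fintype n] [DecidableEq n] {p N : ℕ} [hp : Fact p.Prime] {σ : GSpPos n}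

theorem blockInt_tauP : BlockInt N (tauP n p).1.val := by
  refine ⟨fromBlocks 1 0 0 (diagonal fun _ => (p : ℤ)), ?_, fun i j => by simp⟩
  change fromBlocks 1 0 0 ((p : ℝ) • 1) = _
  rw [fromBlocks_map]
  congr 1
  · ext i j; simp [Matrix.one_apply, apply_ite]
  · ext i j; simp
  · ext i j; simp
  · ext i j; by_cases h : i = j <;> simp [h]

theorem blockInt_smul_inv_tauP : BlockInt N ((p : ℝ) • ((tauP n p)⁻¹).1.val) := by
  have hp0 : (p : ℝ) ≠ 0 := by exact_mod_cast hp.out.ne_zero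
  refine ⟨fromBlocks (diagonal fun _ => (p : ℤ)) 0 0 1, ?_, fun i j => by simp⟩
  change (p : ℝ) • fromBlocks 1 0 0 ((p : ℝ)⁻¹ • 1) = _
  rw [fromBlocks_map, fromBlocks_smul, smul_smul, mul_inv_cancel₀ hp0, one_smul]
  congr 1
  · ext i j; by_cases h : i = j <;> simp [h]
  · ext i j; simp
  · ext i j; simp
  · ext i j; simp [Matrix.one_apply, apply_ite]

theorem tauP_similitude :
    (tauP n p).1.val * J n ℝ * (tauP n p).1.valᵀ = (p : ℝ) • J n ℝ := by
  change fromBlocks 1 0 0 ((p : ℝ) • 1) * J n ℝ * (fromBlocks 1 0 0 ((p : ℝ) • 1))ᵀ = _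
  simp [fromBlocks_multiply, fromBlocks_transpose, J, fromBlocks_smul]

theorem similitude_mul {A B : GSpPos n} {c d : ℝ} (hA : A.1.val * J n ℝ * A.1.valᵀ = c • J n ℝ)
    (hB : B.1.val * J n ℝ * B.1.valᵀ = d • J n ℝ) :
    (A * B).1.val * J n ℝ * (A * B).1.valᵀ = (d * c) • J n ℝ := by
  rw [val_mul, transpose_mul]
  calc A.1.val * B.1.val * J n ℝ * (B.1.valᵀ * A.1.valᵀ)
      = A.1.val * (B.1.val * J n ℝ * B.1.valᵀ) * A.1.valᵀ := by simp only [Matrix.mul_assoc]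
    _ = (d * c) • J n ℝ := by rw [hB, Matrix.mul_smul, Matrix.smul_mul, hA, smul_smul]

theorem similitude_inv {A : GSpPos n} {c : ℝ} (hc : c ≠ 0)
    (hA : A.1.val * J n ℝ * A.1.valᵀ = c • J n ℝ) :
    (A⁻¹).1.val * J n ℝ * (A⁻¹).1.valᵀ = c⁻¹ • J n ℝ := by
  have h1 : J n ℝ = c⁻¹ • (A.1.val * J n ℝ * A.1.valᵀ) := by
    rw [hA, smul_smul, inv_mul_cancel₀ hc, one_smul]
  have h2 : (A.1.val)ᵀ * (A⁻¹).1.valᵀ = 1 := by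
    rw [← transpose_mul, val_inv_mul_val, transpose_one]
  calc (A⁻¹).1.val * J n ℝ * (A⁻¹).1.valᵀ
      = (A⁻¹).1.val * (c⁻¹ • (A.1.val * J n ℝ * A.1.valᵀ)) * (A⁻¹).1.valᵀ := by rw [← h1]
    _ = c⁻¹ • (((A⁻¹).1.val * A.1.val) * J n ℝ * (A.1.valᵀ * (A⁻¹).1.valᵀ)) := by
      simp only [Matrix.mul_smul, Matrix.smul_mul, Matrix.mul_assoc]
    _ = c⁻¹ • J n ℝ := by rw [val_inv_mul_val, h2, Matrix.one_mul, Matrix.mul_one]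

/-- The integrality properties of the elements of the double coset of `diag (1, …, 1, p, …, p)`. -/
theorem blockInt_of_mem_heckeTp (hσ : σ ∈ heckeTp n p N) :
    BlockInt N σ.1.val ∧ BlockInt N ((p : ℝ) • (σ⁻¹).1.val) ∧
      σ.1.val * J n ℝ * σ.1.valᵀ = (p : ℝ) • J n ℝ := by
  obtain ⟨γ, hγ, γ', hγ', rfl⟩ := DoubleCoset.mem_doubleCoset.1 hσ
  refine ⟨?_, ?_, ?_⟩
  · rw [val_mul, val_mul]
    exact ((blockInt_of_mem hγ).mul blockInt_tauP).mul (blockInt_of_mem hγ')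
  · have e : (γ * tauP n p * γ')⁻¹ = γ'⁻¹ * (tauP n p)⁻¹ * γ⁻¹ := by group
    rw [e, val_mul, val_mul, ← Matrix.smul_mul, ← Matrix.mul_smul]
    exact ((blockInt_of_mem (inv_mem hγ')).mul blockInt_smul_inv_tauP).mul
      (blockInt_of_mem (inv_mem hγ))
  · have h := similitude_mul (similitude_mul (similitude_of_mem hγ) (tauP_similitude (p := p)))
      (similitude_of_mem hγ')
    simpa using h

end HeckeElements

/-! ### The lattice `Λσ` -/

section FlagOfBad

set_option linter.unusedSectionVars false

variable {p Δ N : ℕ} [hp : Fact p.Prime] (hΔ : 0 < Δ)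
  {σ : GSpPos (Fin 2 ⊕ Fin 1)}

/-- The lattice `Λσ`, for `Λ = ℤ[√-Δ]³`. -/
noncomputable def latticeOf (σ : GSpPos (Fin 2 ⊕ Fin 1)) : AddSubgroup (Fin 2 ⊕ Fin 1 → ℂ) :=
  (stdLattice Δ).comap (rowAct hΔ (σ⁻¹).1.val).toAddMonoidHom

theorem mem_latticeOf {u : Fin 2 ⊕ Fin 1 → ℂ} :
    u ∈ latticeOf hΔ σ ↔ rowAct hΔ (σ⁻¹).1.val u ∈ stdLattice Δ := Iff.rfl

theorem phi_intCast_mem (z : (Fin 2 ⊕ Fin 1) ⊕ (Fin 2 ⊕ Fin 1) → ℤ) :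
    phi hΔ (fun i => (z i : ℝ)) ∈ stdLattice Δ := (phi_mem_stdLattice_iff hΔ _).2 ⟨z, rfl⟩

theorem cast_vecMul (R : Type) [CommRing R] {m : Type} [Fintype m] (x : m → ℤ) (A : Matrix m m ℤ) :
    (fun i => ((x ᵥ* A) i : R)) = (fun i => (x i : R)) ᵥ* A.map (Int.cast : ℤ → R) := by
  funext i
  simp [vecMul, dotProduct]

theorem Ers_apply (r s : ℕ) (R : Type) [CommRing R] (i j : Fin r ⊕ Fin s) :
    Ers r s R i j = ((if i = j then Sum.elim (fun _ => 1) (fun _ => -1) i else 0 : ℤ) : R) := by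
  rcases i with i | i <;> rcases j with j | j <;>
    simp only [Ers, fromBlocks_apply₁₁, fromBlocks_apply₁₂, fromBlocks_apply₂₁,
      fromBlocks_apply₂₂, Matrix.neg_apply, Matrix.one_apply, Matrix.zero_apply, Sum.inl.injEq,
      Sum.inr.injEq, reduceCtorEq, if_false, Sum.elim_inl, Sum.elim_inr, Int.cast_zero]
  all_goals split_ifs <;> simp

theorem rootMat_map (R : Type) [CommRing R] :
    (rootMat 2 1 (Δ : ℤ)).map (Int.cast : ℤ → R) = rootMat 2 1 (Δ : R) := by
  ext i j
  rw [rootMat_eq, rootMat_eq]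
  rcases i with i | i <;> rcases j with j | j <;>
    simp only [map_apply, fromBlocks_apply₁₁, fromBlocks_apply₁₂, fromBlocks_apply₂₁,
      fromBlocks_apply₂₂, Matrix.neg_apply, Matrix.smul_apply, Matrix.zero_apply, smul_eq_mul,
      Ers_apply] <;> simp

theorem phi_add_smul (x y : (Fin 2 ⊕ Fin 1) ⊕ (Fin 2 ⊕ Fin 1) → ℤ) (k : ℤ) :
    phi hΔ (fun i => ((x + k • y) i : ℝ)) =
      phi hΔ (fun i => (x i : ℝ)) + (k : ℂ) • phi hΔ (fun i => (y i : ℝ)) := by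
  have h : (fun i => ((x + k • y) i : ℝ)) = (fun i => (x i : ℝ)) + (k : ℝ) • fun i => (y i : ℝ) := by
    funext i
    simp
  rw [h, map_add, map_smul]
  rfl

theorem phi_vecMul_intCast (x : (Fin 2 ⊕ Fin 1) ⊕ (Fin 2 ⊕ Fin 1) → ℤ) :
    phi hΔ (fun i => ((x ᵥ* rootMat 2 1 (Δ : ℤ)) i : ℝ)) =
      rootC Δ • phi hΔ (fun i => (x i : ℝ)) := by
  rw [cast_vecMul, rootMat_map, phi_vecMul_rootMat]

theorem herm_mem_orderMul_iff (x y : (Fin 2 ⊕ Fin 1) ⊕ (Fin 2 ⊕ Fin 1) → ℤ) :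
    herm (phi hΔ fun i => (x i : ℝ)) (phi hΔ fun i => (y i : ℝ)) ∈ orderMul Δ p ↔
      ((fun i => (x i : ZMod p)) ᵥ* rootMat 2 1 (Δ : ZMod p)) ⬝ᵥ
          (J _ (ZMod p) *ᵥ fun i => (y i : ZMod p)) = 0 ∧
        (fun i => (x i : ZMod p)) ⬝ᵥ (J _ (ZMod p) *ᵥ fun i => (y i : ZMod p)) = 0 := by
  rw [herm_phi, ← rootMat_map ℝ, ← cast_vecMul, ← cast_dotProduct_J, ← cast_dotProduct_J,
    Complex.ofReal_intCast, Complex.ofReal_intCast, add_mul_rootC_mem_orderMul_iff hΔ,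
    ← rootMat_map (ZMod p), ← cast_vecMul, ← cast_dotProduct_J, ← cast_dotProduct_J,
    ZMod.intCast_zmod_eq_zero_iff_dvd, ZMod.intCast_zmod_eq_zero_iff_dvd]

/-- Vectors that are congruent modulo `p` differ by an element of `pΛ`. -/
theorem phi_eq_add_of_cast_eq {x y : (Fin 2 ⊕ Fin 1) ⊕ (Fin 2 ⊕ Fin 1) → ℤ}
    (h : (fun i => (x i : ZMod p)) = fun i => (y i : ZMod p)) :
    ∃ l ∈ stdLattice Δ, phi hΔ (fun i => (x i : ℝ)) = phi hΔ (fun i => (y i : ℝ)) + (p : ℂ) • l := by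
  have h1 : ∀ i, ∃ k, x i - y i = p * k := fun i => by
    have := congrFun h i
    rw [eq_comm, ZMod.intCast_eq_intCast_iff_dvd_sub] at this
    exact this
  choose k hk using h1
  refine ⟨phi hΔ fun i => (k i : ℝ), phi_intCast_mem hΔ k, ?_⟩
  have e : x = y + (p : ℤ) • k := by
    funext i
    have := hk i
    simp only [Pi.add_apply, Pi.smul_apply, smul_eq_mul]
    linarith
  rw [e, phi_add_smul]
  simp

variable {S : Matrix ((Fin 2 ⊕ Fin 1) ⊕ (Fin 2 ⊕ Fin 1)) ((Fin 2 ⊕ Fin 1) ⊕ (Fin 2 ⊕ Fin 1)) ℤ}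

theorem smul_mem_latticeOf (hσ : IntMat ((p : ℝ) • (σ⁻¹).1.val)) :
    ∀ u ∈ stdLattice Δ, (p : ℂ) • u ∈ latticeOf hΔ σ := fun u hu => by
  have h := (intMat_iff_rowAct hΔ).1 hσ u hu
  have e : (p : ℂ) • u = (p : ℝ) • u := by
    funext i
    simp
  rw [rowAct_smul_mat] at h
  rwa [mem_latticeOf, e, map_smul]

theorem rowAct_inv_val (u : Fin 2 ⊕ Fin 1 → ℂ) :
    rowAct hΔ (σ⁻¹).1.val (rowAct hΔ σ.1.val u) = u := by
  rw [← rowAct_mul, val_mul_val_inv, rowAct_one]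

theorem rowAct_val_inv (u : Fin 2 ⊕ Fin 1 → ℂ) :
    rowAct hΔ σ.1.val (rowAct hΔ (σ⁻¹).1.val u) = u := by
  rw [← rowAct_mul, val_inv_mul_val, rowAct_one]

theorem latticeOf_le (hσ : IntMat σ.1.val) : latticeOf hΔ σ ≤ stdLattice Δ := fun u hu => by
  have h := (intMat_iff_rowAct hΔ).1 hσ _ hu
  change rowAct hΔ σ.1.val (rowAct hΔ (σ⁻¹).1.val u) ∈ _ at h
  rwa [rowAct_val_inv] at h

/-- The image of `Λσ` in `Λ / p` is the isotropic subspace of `σ`. -/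
theorem phi_mem_latticeOf_iff (hS : σ.1.val = S.map (Int.cast : ℤ → ℝ))
    (hσ : IntMat ((p : ℝ) • (σ⁻¹).1.val)) (x : (Fin 2 ⊕ Fin 1) ⊕ (Fin 2 ⊕ Fin 1) → ℤ) :
    phi hΔ (fun i => (x i : ℝ)) ∈ latticeOf hΔ σ ↔
      (fun i => (x i : ZMod p)) ∈ isoSubspace p S := by
  have key : ∀ y : (Fin 2 ⊕ Fin 1) ⊕ (Fin 2 ⊕ Fin 1) → ℤ,
      phi hΔ (fun i => ((y ᵥ* S) i : ℝ)) = rowAct hΔ σ.1.val (phi hΔ fun i => (y i : ℝ)) := fun y => by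
    rw [rowAct_phi, hS, cast_vecMul]
  rw [mem_isoSubspace_iff]
  constructor
  · intro h
    obtain ⟨y, hy⟩ := (phi_mem_stdLattice_iff hΔ ((phi hΔ).symm (rowAct hΔ (σ⁻¹).1.val
      (phi hΔ fun i => (x i : ℝ))))).1 (by rw [LinearEquiv.apply_symm_apply]; exact h)
    refine ⟨y, ?_⟩
    rw [LinearEquiv.symm_apply_eq] at hy
    have h1 := key y
    rw [← hy, rowAct_val_inv] at h1
    have h2 := (phi hΔ).injective h1
    funext i
    have h3 := congrFun h2 i
    simp only [Int.cast_inj] at h3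
    rw [h3]
  · rintro ⟨y, hy⟩
    obtain ⟨l, hl, h⟩ := phi_eq_add_of_cast_eq hΔ hy
    rw [h]
    refine add_mem ?_ (smul_mem_latticeOf hΔ hσ l hl)
    rw [mem_latticeOf, key, rowAct_inv_val]
    exact phi_intCast_mem hΔ y

end FlagOfBad

/-! ### The line attached to a bad element -/

section ExistsFlag

variable {p Δ N : ℕ} [hp : Fact p.Prime] (hΔ : 0 < Δ)
  {σ : GSpPos (Fin 2 ⊕ Fin 1)}

/-- For a vector `a` that does not vanish modulo `p`, there is an isotropic integral vector whose
product with `a` does not vanish modulo `p`. -/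
theorem exists_isotropic_pairing (hinert : legendreSym p (-(Δ : ℤ)) = -1)
    {a : (Fin 2 ⊕ Fin 1) ⊕ (Fin 2 ⊕ Fin 1) → ℤ} (ha : (fun i => (a i : ZMod p)) ≠ 0) :
    ∃ f ∈ stdLattice Δ, herm f f = 0 ∧ herm (phi hΔ fun i => (a i : ℝ)) f ∉ orderMul Δ p := by
  by_contra! hcon
  have h2 : ((2 : ℤ) : ℂ) ∉ orderMul Δ p := by
    rw [intCast_mem_orderMul_iff hΔ]
    intro h
    exact ne_two_of_inert hinert ((Nat.prime_dvd_prime_iff_eq hp.out Nat.prime_two).1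
      (by exact_mod_cast h))
  have key : ∀ x y z : ℤ, x ^ 2 + y ^ 2 - z ^ 2 = 0 →
      (x : ℂ) * phi hΔ (fun i => (a i : ℝ)) (.inl 0) + y * phi hΔ (fun i => (a i : ℝ)) (.inl 1)
        - z * phi hΔ (fun i => (a i : ℝ)) (.inr 0) ∈ orderMul Δ p := by
    intro x y z hxyz
    have h1 := hcon (Sum.elim ![(x : ℂ), y] ![(z : ℂ)]) ?_ ?_
    · convert h1 using 1
      simp [herm_apply, sgn]
      ring
    · rintro (i | i) <;> fin_cases i <;> simp [intCast_mem]
    · have : (x : ℂ) ^ 2 + y ^ 2 - z ^ 2 = 0 := by exact_mod_cast hxyz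
      simp [herm_apply, sgn]
      linear_combination this
  have hmem := phi_intCast_mem hΔ a
  have k1 := key 1 0 1 (by norm_num)
  have k2 := key 1 0 (-1) (by norm_num)
  have k3 := key 0 1 1 (by norm_num)
  push_cast at k1 k2 k3
  have h0 : phi hΔ (fun i => (a i : ℝ)) (.inl 0) ∈ orderMul Δ p := by
    refine mem_orderMul_of_mul_mem hΔ hinert (hmem _) (intCast_mem _ 2) ?_ h2
    convert add_mem k1 k2 using 1
    push_cast
    ring
  have h3 : phi hΔ (fun i => (a i : ℝ)) (.inr 0) ∈ orderMul Δ p := by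
    convert sub_mem h0 k1 using 1
    ring
  have h1 : phi hΔ (fun i => (a i : ℝ)) (.inl 1) ∈ orderMul Δ p := by
    convert add_mem h3 k3 using 1
    ring
  have hall : ∀ i, phi hΔ (fun i => (a i : ℝ)) i ∈ orderMul Δ p := by
    rintro (i | i) <;> fin_cases i
    exacts [h0, h1, h3]
  refine ha (funext ?_)
  have hdvd : ∀ i, (p : ℤ) ∣ a (.inl i) ∧ (p : ℤ) ∣ a (.inr i) := by
    rintro (i | i)
    · have := hall (.inl i)
      rw [phi_apply, mul_comm] at this
      refine (add_mul_rootC_mem_orderMul_iff hΔ).1 (?_ : _ ∈ orderMul Δ p)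
      simpa [sgn] using this
    · have := hall (.inr i)
      rw [phi_apply, mul_comm] at this
      have h4 := (add_mul_rootC_mem_orderMul_iff (a := a (.inl (.inr i))) (b := - a (.inr (.inr i)))
        (p := p) hΔ).1 (by simpa [sgn] using this)
      exact ⟨h4.1, (dvd_neg).1 h4.2⟩
  rintro (i | i)
  · exact (ZMod.intCast_zmod_eq_zero_iff_dvd _ _).2 (hdvd i).1
  · exact (ZMod.intCast_zmod_eq_zero_iff_dvd _ _).2 (hdvd i).2

/-- An integral similitude satisfies the equation of a similitude, and the transposed one, over `ℤ`. -/
theorem int_similitude {n : Type} [Fintype n] [DecidableEq n] {σ : GSpPos n} {c : ℕ} (hc : c ≠ 0)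
    {S : Matrix (n ⊕ n) (n ⊕ n) ℤ} (hS : σ.1.val = S.map (Int.cast : ℤ → ℝ))
    (h : σ.1.val * J n ℝ * σ.1.valᵀ = (c : ℝ) • J n ℝ) :
    S * J n ℤ * Sᵀ = (c : ℤ) • J n ℤ ∧ Sᵀ * J n ℤ * S = (c : ℤ) • J n ℤ := by
  have h' := symp_transpose (by exact_mod_cast hc) h
  have e : (J n ℤ).map (Int.cast : ℤ → ℝ) = J n ℝ := map_J n (Int.castRingHom ℝ)
  have e2 : ((c : ℤ) • J n ℤ).map (Int.cast : ℤ → ℝ) = (c : ℝ) • J n ℝ := by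
    rw [← e]
    ext i j
    rw [map_apply, Matrix.smul_apply, Matrix.smul_apply, map_apply, smul_eq_mul, smul_eq_mul,
      Int.cast_mul, Int.cast_natCast]
  have e3 : (Sᵀ).map (Int.cast : ℤ → ℝ) = σ.1.valᵀ := by rw [transpose_map, ← hS]
  constructor
  · apply map_intCast_injective
    rw [intCast_map_mul, intCast_map_mul, ← hS, e, e2, e3, h]
  · apply map_intCast_injective
    rw [intCast_map_mul, intCast_map_mul, ← hS, e, e2, e3, h']

/-- For a bad `σ`, the `𝔽_{p²}`-line of `exists_line` has an isotropic generator `e` in `Λ`, and `Λ`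
has an isotropic vector `f` such that `e` and `f` span a hyperbolic plane modulo `p`. -/
theorem exists_flag (hinert : legendreSym p (-(Δ : ℤ)) = -1)
    (hσ : σ ∈ heckeTp (Fin 2 ⊕ Fin 1) p N) (hbad : IsBad 2 1 p Δ σ) :
    ∃ e f, IsFlag herm Δ p (stdLattice Δ) (latticeOf hΔ σ) e ∧ herm e e = 0 ∧
      f ∈ stdLattice Δ ∧ herm f f = 0 ∧ herm e f ∉ orderMul Δ p := by
  obtain ⟨S, hS, h3, h6⟩ := hbad
  obtain ⟨hσ1, hσ2, hσ3⟩ := blockInt_of_mem_heckeTp hσ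
  obtain ⟨hSJ, hSJ'⟩ := int_similitude hp.out.ne_zero hS hσ3
  obtain ⟨e, he0, heW, heωW, hspan, hperp⟩ := exists_line hinert
    (orthogonal_isoSubspace hSJ hSJ') h3 h6
  obtain ⟨a, rfl⟩ := exists_lift e
  have hmemiff := phi_mem_latticeOf_iff hΔ hS hσ2.intMat
  have hle := latticeOf_le hΔ hσ1.intMat
  have hpM := smul_mem_latticeOf hΔ hσ2.intMat
  have hint : ∀ u ∈ stdLattice Δ, ∃ x : (Fin 2 ⊕ Fin 1) ⊕ (Fin 2 ⊕ Fin 1) → ℤ,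
      u = phi hΔ fun i => (x i : ℝ) := fun u hu => by
    obtain ⟨x, rfl⟩ := (phi hΔ).surjective u
    obtain ⟨z, rfl⟩ := (phi_mem_stdLattice_iff hΔ x).1 hu
    exact ⟨z, rfl⟩
  have hcomb : ∀ (x y : (Fin 2 ⊕ Fin 1) ⊕ (Fin 2 ⊕ Fin 1) → ℤ) (k : ℤ),
      (fun i => ((x + k • y) i : ZMod p)) =
        (fun i => (x i : ZMod p)) + (k : ZMod p) • fun i => (y i : ZMod p) := fun x y k => by
    funext i
    simp
  have hroot : ∀ x : (Fin 2 ⊕ Fin 1) ⊕ (Fin 2 ⊕ Fin 1) → ℤ,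
      (fun i => ((x ᵥ* rootMat 2 1 (Δ : ℤ)) i : ZMod p)) =
        (fun i => (x i : ZMod p)) ᵥ* rootMat 2 1 (Δ : ZMod p) := fun x => by
    rw [cast_vecMul, rootMat_map]
  have hz : ∀ b c : ℤ, ((b : ℂ) + c * rootC Δ) • phi hΔ (fun i => (a i : ℝ)) =
      phi hΔ fun i => ((b • a + c • (a ᵥ* rootMat 2 1 (Δ : ℤ))) i : ℝ) := fun b c => by
    have h1 := phi_add_smul hΔ 0 a b
    rw [zero_add] at h1
    rw [phi_add_smul, phi_vecMul_intCast, h1, add_smul, mul_smul]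
    congr 1
    have : (fun i => (((0 : (Fin 2 ⊕ Fin 1) ⊕ (Fin 2 ⊕ Fin 1) → ℤ) i : ℤ) : ℝ)) = 0 := by
      funext i
      simp
    rw [this, map_zero, zero_add]
  have hzc : ∀ b c : ℤ, (fun i => ((b • a + c • (a ᵥ* rootMat 2 1 (Δ : ℤ))) i : ZMod p)) =
      (b : ZMod p) • (fun i => (a i : ZMod p)) +
        (c : ZMod p) • ((fun i => (a i : ZMod p)) ᵥ* rootMat 2 1 (Δ : ZMod p)) := fun b c => by
    rw [hcomb, hroot]
    congr 1
    funext i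
    simp
  have hflag : IsFlag herm Δ p (stdLattice Δ) (latticeOf hΔ σ) (phi hΔ fun i => (a i : ℝ)) := by
    refine ⟨phi_intCast_mem hΔ a, ?_, ?_, ?_, ?_⟩
    · intro u hu
      obtain ⟨x, rfl⟩ := hint u (hle hu)
      rw [herm_mem_orderMul_iff]
      exact (hspan _).1 (Submodule.mem_sup_left ((hmemiff x).1 hu))
    · rintro _ ⟨b, c, rfl⟩
      rw [hz, hmemiff, hzc]
      exact add_mem (Submodule.smul_mem _ _ heW) (Submodule.smul_mem _ _ heωW)
    · intro u hu hua
      obtain ⟨x, rfl⟩ := hint u hu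
      rw [herm_mem_orderMul_iff, ← hspan] at hua
      obtain ⟨y, hy, _, ⟨y', hy', rfl⟩, hyy⟩ := Submodule.mem_sup.1 hua
      obtain ⟨y, rfl⟩ := exists_lift y
      obtain ⟨y', rfl⟩ := exists_lift y'
      obtain ⟨l, hl, h⟩ := phi_eq_add_of_cast_eq hΔ (p := p) (x := x)
        (y := y + (1 : ℤ) • (y' ᵥ* rootMat 2 1 (Δ : ℤ))) (by
          rw [hcomb, hroot, ← hyy]
          simp)
      rw [phi_add_smul, phi_vecMul_intCast] at h
      refine ⟨_, add_mem ((hmemiff y).2 hy) (hpM l hl), _, (hmemiff y').2 hy', ?_⟩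
      rw [h]
      simp only [Int.cast_one, one_smul]
      abel
    · intro u hu hperp'
      obtain ⟨z, rfl⟩ := hint u hu
      obtain ⟨b, c, hbc⟩ := hperp (fun i => (z i : ZMod p)) fun y hy => by
        obtain ⟨y, rfl⟩ := exists_lift y
        exact (herm_mem_orderMul_iff hΔ z y).1 (hperp' _ ((hmemiff y).2 hy))
      obtain ⟨b, rfl⟩ := ZMod.intCast_surjective b
      obtain ⟨c, rfl⟩ := ZMod.intCast_surjective c
      obtain ⟨l, hl, h⟩ := phi_eq_add_of_cast_eq hΔ (hbc.trans (hzc b c).symm)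
      exact ⟨_, ⟨b, c, rfl⟩, l, hl, by rw [h, hz]⟩
  obtain ⟨f, hf, hff, haf⟩ := exists_isotropic_pairing hΔ hinert he0
  obtain ⟨e', he', hee, hef⟩ := exists_isotropic hΔ hinert (fun x y => herm_symm x y)
    smul_mem_stdLattice herm_mem_order hpM hle hflag hf hff haf
  exact ⟨e', f, he', hee, hf, hff, hef⟩

end ExistsFlag

/-! ### Transvections as elements of `GSp⁺` -/

section Transvections

variable {p Δ N : ℕ} [hp : Fact p.Prime] (hΔ : 0 < Δ)
  {v e f : Fin 2 ⊕ Fin 1 → ℂ}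

theorem rowAct_add
    (A B : Matrix ((Fin 2 ⊕ Fin 1) ⊕ (Fin 2 ⊕ Fin 1)) ((Fin 2 ⊕ Fin 1) ⊕ (Fin 2 ⊕ Fin 1)) ℝ)
    (u : Fin 2 ⊕ Fin 1 → ℂ) : rowAct hΔ (A + B) u = rowAct hΔ A u + rowAct hΔ B u := by
  obtain ⟨x, rfl⟩ := (phi hΔ).surjective u
  rw [rowAct_phi, rowAct_phi, rowAct_phi, vecMul_add, map_add]

theorem herm_transv (hv : herm v v = 0) (s : ℝ) (u w : Fin 2 ⊕ Fin 1 → ℂ) :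
    herm (transv herm Δ v s u) (transv herm Δ v s w) = herm u w := by
  simp only [transv, map_add, map_smul, LinearMap.add_apply, LinearMap.smul_apply,
    LinearMap.map_smulₛₗ, smul_eq_mul, hv, map_mul, Complex.conj_ofReal, conj_rootC, herm_symm v w,
    Complex.conj_conj]
  ring

theorem transv_smul (s : ℝ) (c : ℂ) (u : Fin 2 ⊕ Fin 1 → ℂ) :
    transv herm Δ v s (c • u) = c • transv herm Δ v s u := by
  simp only [transv, map_smul, LinearMap.smul_apply, smul_eq_mul, smul_add, smul_smul]
  congr 2
  ring

/-- The map `u ↦ c ⟨u, v⟩ v` as a real linear map. -/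
noncomputable def rankOne (v : Fin 2 ⊕ Fin 1 → ℂ) (c : ℂ) :
    (Fin 2 ⊕ Fin 1 → ℂ) →ₗ[ℝ] (Fin 2 ⊕ Fin 1 → ℂ) :=
  (((LinearMap.toSpanSingleton ℂ (Fin 2 ⊕ Fin 1 → ℂ) v).comp
    (c • (herm.flip v : (Fin 2 ⊕ Fin 1 → ℂ) →ₗ[ℂ] ℂ))).restrictScalars ℝ)

theorem rankOne_apply (v : Fin 2 ⊕ Fin 1 → ℂ) (c : ℂ) (u : Fin 2 ⊕ Fin 1 → ℂ) :
    rankOne v c u = (c * herm u v) • v := by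
  simp [rankOne]

/-- A unitary transvection is given by a symplectic matrix that commutes with `α(√-Δ)`. -/
theorem exists_transvG (hv : herm v v = 0) (s : ℝ) : ∃ g : GSpPos (Fin 2 ⊕ Fin 1),
    (∀ u, rowAct hΔ g.1.val u = transv herm Δ v s u) ∧
      g.1.val * rootMat 2 1 (Δ : ℝ) = rootMat 2 1 (Δ : ℝ) * g.1.val ∧
      g.1.val * J _ ℝ * g.1.valᵀ = (1 : ℝ) • J _ ℝ := by
  obtain ⟨A, hA⟩ := exists_mat hΔ (LinearMap.id + rankOne v (s * rootC Δ))
  have hA' : ∀ u, rowAct hΔ A u = transv herm Δ v s u := fun u => by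
    rw [hA, LinearMap.add_apply, rankOne_apply, LinearMap.id_apply, transv]
  obtain ⟨h1, h2⟩ := mat_of_herm hΔ (A := A) (fun u => by rw [hA', hA', transv_smul])
    (fun u w => by rw [hA', hA', herm_transv hv])
  exact ⟨ofSimilitude A 1 one_pos h2, hA', h1, h2⟩

/-- The symplectic matrix of a unitary transvection. -/
noncomputable def transvG (hv : herm v v = 0) (s : ℝ) : GSpPos (Fin 2 ⊕ Fin 1) :=
  Classical.choose (exists_transvG hΔ hv s)

theorem rowAct_transvG (hv : herm v v = 0) (s : ℝ) (u : Fin 2 ⊕ Fin 1 → ℂ) :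
    rowAct hΔ (transvG hΔ hv s).1.val u = transv herm Δ v s u :=
  (Classical.choose_spec (exists_transvG hΔ hv s)).1 u

theorem transvG_mul_rootMat (hv : herm v v = 0) (s : ℝ) :
    (transvG hΔ hv s).1.val * rootMat 2 1 (Δ : ℝ) =
      rootMat 2 1 (Δ : ℝ) * (transvG hΔ hv s).1.val :=
  (Classical.choose_spec (exists_transvG hΔ hv s)).2.1

theorem transvG_similitude (hv : herm v v = 0) (s : ℝ) :
    (transvG hΔ hv s).1.val * J _ ℝ * (transvG hΔ hv s).1.valᵀ = (1 : ℝ) • J _ ℝ :=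
  (Classical.choose_spec (exists_transvG hΔ hv s)).2.2

theorem transvG_inv (hv : herm v v = 0) (s : ℝ) : (transvG hΔ hv s)⁻¹ = transvG hΔ hv (-s) := by
  rw [inv_eq_iff_mul_eq_one]
  apply ext_val
  apply ext_rowAct hΔ
  intro u
  rw [val_mul, rowAct_mul, rowAct_transvG, rowAct_transvG, transv_neg_transv hv]
  exact (rowAct_one hΔ u).symm

theorem transvG_mul (hv : herm v v = 0) (s s' : ℝ) :
    transvG hΔ hv s * transvG hΔ hv s' = transvG hΔ hv (s + s') := by
  apply ext_val
  apply ext_rowAct hΔ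
  intro u
  rw [val_mul, rowAct_mul, rowAct_transvG, rowAct_transvG, rowAct_transvG, transv_add hv]

variable {σ : GSpPos (Fin 2 ⊕ Fin 1)}

/-- A transvection that preserves the lattice `Λσ`, and that is congruent to a scalar modulo `N`,
is conjugated into `Γ₀(N)` by `σ`. -/
theorem conj_transvG_mem (hN : ¬ p ∣ N) (hσ : σ ∈ heckeTp (Fin 2 ⊕ Fin 1) p N)
    (hv : herm v v = 0) (hvΛ : v ∈ stdLattice Δ) (d : ℤ)
    (hstab : ∀ u ∈ latticeOf hΔ σ, transv herm Δ v (N * d / p) u ∈ latticeOf hΔ σ) :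
    σ * transvG hΔ hv (N * d / p) * σ⁻¹ ∈ Gamma0 (Fin 2 ⊕ Fin 1) N := by
  have hp0 : (p : ℝ) ≠ 0 := by exact_mod_cast hp.out.ne_zero
  obtain ⟨hσ1, hσ2, hσ3⟩ := blockInt_of_mem_heckeTp hσ
  have hinv := similitude_inv hp0 hσ3
  refine mem_Gamma0_of_blockInt ?_ (BlockInt.of_smul (p := p) (k := 2) hN ?_ ?_)
  · have h := similitude_mul (similitude_mul hσ3 (transvG_similitude hΔ hv (N * d / p))) hinv
    rw [one_mul, inv_mul_cancel₀ hp0] at h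
    exact h
  · rw [intMat_iff_rowAct hΔ]
    intro u hu
    rw [val_mul, val_mul, rowAct_mul, rowAct_mul, rowAct_transvG]
    exact hstab _ (by rwa [mem_latticeOf, rowAct_inv_val])
  · obtain ⟨X, hX⟩ := exists_mat hΔ (rankOne v (d * rootC Δ))
    have hXint : IntMat X := by
      rw [intMat_iff_rowAct hΔ]
      intro u hu
      rw [hX, rankOne_apply]
      exact smul_mem_stdLattice _ (mul_mem (mul_mem (intCast_mem _ d) (rootC_mem Δ))
        (herm_mem_order _ hu _ hvΛ)) _ hvΛ
    have hg : (p : ℝ) • (transvG hΔ hv (N * d / p)).1.val =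
        ((p : ℤ) : ℝ) • (1 : Matrix _ _ ℝ) + (N : ℝ) • X := by
      apply ext_rowAct hΔ
      intro u
      rw [rowAct_add, rowAct_smul_mat, rowAct_smul_mat, rowAct_smul_mat, rowAct_one, hX,
        rankOne_apply, rowAct_transvG, transv, smul_add, Int.cast_natCast]
      congr 1
      have hpC : (p : ℂ) ≠ 0 := by exact_mod_cast hp0
      funext i
      simp only [Pi.smul_apply, smul_eq_mul, Complex.real_smul]
      push_cast
      field_simp
    have e : (p : ℝ) ^ 2 • (σ * transvG hΔ hv (N * d / p) * σ⁻¹).1.val =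
        σ.1.val * ((p : ℝ) • (transvG hΔ hv (N * d / p)).1.val) * ((p : ℝ) • (σ⁻¹).1.val) := by
      rw [val_mul, val_mul, Matrix.mul_smul, Matrix.mul_smul, Matrix.smul_mul, smul_smul, sq]
    rw [e, hg]
    exact (hσ1.mul (blockInt_one_add _ hXint)).mul hσ2

/-- As `e` spans the line in `Λσ / p` that is orthogonal to `Λσ`, the transvection along `e` preserves
`Λσ` although its parameter has denominator `p`. -/
theorem transv_mem_latticeOf_of_flag (hflag : IsFlag herm Δ p (stdLattice Δ) (latticeOf hΔ σ) e)
    {u : Fin 2 ⊕ Fin 1 → ℂ} (hu : u ∈ latticeOf hΔ σ) :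
    transv herm Δ e (N * (1 : ℤ) / p) u ∈ latticeOf hΔ σ := by
  have hp0 : (p : ℂ) ≠ 0 := by exact_mod_cast hp.out.ne_zero
  obtain ⟨w, hw, h⟩ := hflag.orth u hu
  refine add_mem hu ?_
  have e1 : (((N * (1 : ℤ) / p : ℝ)) : ℂ) * rootC Δ * herm u e = N * rootC Δ * w := by
    rw [h]
    push_cast
    field_simp
  rw [e1]
  exact hflag.smul_mem _ (mul_mem (mul_mem (natCast_mem _ N) (rootC_mem Δ)) hw)

/-- A transvection along a vector of `Λ` preserves `Λσ` if its parameter is divisible by `p`. -/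
theorem transv_mem_latticeOf (hσ : σ ∈ heckeTp (Fin 2 ⊕ Fin 1) p N) (hf : f ∈ stdLattice Δ) (k : ℤ)
    {u : Fin 2 ⊕ Fin 1 → ℂ} (hu : u ∈ latticeOf hΔ σ) :
    transv herm Δ f (N * (p ^ 2 * k : ℤ) / p) u ∈ latticeOf hΔ σ := by
  have hp0 : (p : ℂ) ≠ 0 := by exact_mod_cast hp.out.ne_zero
  obtain ⟨hσ1, hσ2, -⟩ := blockInt_of_mem_heckeTp hσ
  refine add_mem hu ?_
  have e1 : (((N * (p ^ 2 * k : ℤ) / p : ℝ)) : ℂ) * rootC Δ * herm u f =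
      p * (N * k * rootC Δ * herm u f) := by
    push_cast
    field_simp
  rw [e1, mul_smul]
  exact smul_mem_latticeOf hΔ hσ2.intMat _ (smul_mem_stdLattice _
    (mul_mem (mul_mem (mul_mem (natCast_mem _ N) (intCast_mem _ k)) (rootC_mem Δ))
      (herm_mem_order _ (latticeOf_le hΔ hσ1.intMat hu) _ hf)) _ hf)

end Transvections

/-! ### The `p + 1` representatives -/

section Representatives

set_option linter.unusedSectionVars false

variable {p Δ N : ℕ} [hp : Fact p.Prime] (hΔ : 0 < Δ) {e f : Fin 2 ⊕ Fin 1 → ℂ}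
  (he : herm e e = 0) (hf : herm f f = 0)

/-- The isometries that take `Λ` to the `p + 1` unimodular lattices between `Λσ` and `p⁻¹ Λσ`. -/
noncomputable def rep (p N : ℕ) : Option (Fin p) → GSpPos (Fin 2 ⊕ Fin 1)
  | none => 1
  | some s => transvG hΔ he (N / p) * transvG hΔ hf (-(p * N * (s : ℕ)))

theorem commute_rep (i : Option (Fin p)) : Commute (rep hΔ he hf p N i) (rootG 2 1 hΔ) := by
  rcases i with _ | s
  · exact Commute.one_left _
  · exact ((commute_rootG_iff hΔ).2 (transvG_mul_rootMat hΔ he _)).mul_left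
      ((commute_rootG_iff hΔ).2 (transvG_mul_rootMat hΔ hf _))

variable {σ : GSpPos (Fin 2 ⊕ Fin 1)}

/-- The representatives are conjugated into `Γ₀(N)` by `σ`, so that `σ • ρ • t` has the same class as
`σ • t`. -/
theorem conj_rep_mem (hN : ¬ p ∣ N) (hσ : σ ∈ heckeTp (Fin 2 ⊕ Fin 1) p N)
    (hflag : IsFlag herm Δ p (stdLattice Δ) (latticeOf hΔ σ) e) (hfΛ : f ∈ stdLattice Δ)
    (i : Option (Fin p)) :
    σ * rep hΔ he hf p N i * σ⁻¹ ∈ Gamma0 (Fin 2 ⊕ Fin 1) N := by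
  have hp0 : (p : ℝ) ≠ 0 := by exact_mod_cast hp.out.ne_zero
  rcases i with _ | s
  · simp [rep, one_mem]
  · have h1 := conj_transvG_mem hΔ hN hσ he hflag.mem 1
      fun u hu => transv_mem_latticeOf_of_flag hΔ hflag hu
    have h2 := conj_transvG_mem hΔ hN hσ hf hfΛ (p ^ 2 * (-(s : ℕ) : ℤ))
      fun u hu => transv_mem_latticeOf hΔ hσ hfΛ _ hu
    have e1 : (N * (1 : ℤ) / p : ℝ) = N / p := by simp
    have e2 : (N * (p ^ 2 * (-(s : ℕ) : ℤ) : ℤ) / p : ℝ) = -(p * N * (s : ℕ)) := by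
      push_cast
      field_simp
    rw [e1] at h1
    rw [e2] at h2
    have h3 := mul_mem h1 h2
    convert h3 using 1
    rw [rep]
    group

theorem rep_similitude (i : Option (Fin p)) :
    (rep hΔ he hf p N i).1.val * J _ ℝ * (rep hΔ he hf p N i).1.valᵀ = (1 : ℝ) • J _ ℝ := by
  rcases i with _ | s
  · simp [rep]
  · have h := similitude_mul (transvG_similitude hΔ he (N / p))
      (transvG_similitude hΔ hf (-(p * N * (s : ℕ))))
    rwa [one_mul] at h

/-- A unitary matrix `ρ` for which `Λρ` lies between `Λσ` and `p⁻¹ Λσ` is one of the given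
representatives, up to an integral matrix. -/
theorem exists_rep (hinert : legendreSym p (-(Δ : ℤ)) = -1) (hN : ¬ p ∣ N)
    (hσ : σ ∈ heckeTp (Fin 2 ⊕ Fin 1) p N)
    (hflag : IsFlag herm Δ p (stdLattice Δ) (latticeOf hΔ σ) e) (hfΛ : f ∈ stdLattice Δ)
    (hef : herm e f ∉ orderMul Δ p) {ρ : GSpPos (Fin 2 ⊕ Fin 1)}
    (hρ : Commute ρ (rootG 2 1 hΔ)) (hρJ : ρ.1.val * J _ ℝ * ρ.1.valᵀ = (1 : ℝ) • J _ ℝ)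
    (h1 : IntMat (σ * ρ⁻¹).1.val) (h2 : IntMat ((p : ℝ) • (ρ * σ⁻¹).1.val)) :
    ∃ i : Option (Fin p), IntMat (rep hΔ he hf p N i * ρ⁻¹).1.val := by
  obtain ⟨hσ1, hσ2, -⟩ := blockInt_of_mem_heckeTp hσ
  have hρc := (commute_rootG_iff hΔ).1 hρ
  have hρi := (commute_rootG_iff hΔ).1 hρ.inv_left
  have hρJ' : ∀ u v, herm (rowAct hΔ (ρ⁻¹).1.val u) (rowAct hΔ (ρ⁻¹).1.val v) = herm u v := by
    intro u v
    have h := similitude_inv one_ne_zero hρJ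
    rw [inv_one] at h
    rw [herm_rowAct hΔ hρi h, Complex.ofReal_one, one_mul]
  have key := le_or_exists_transv (H := herm) (L := latticeOf hΔ ρ) hΔ hinert hN
    (fun x y => herm_symm x y) smul_mem_stdLattice herm_mem_order
    (smul_mem_latticeOf hΔ hσ2.intMat) (latticeOf_le hΔ hσ1.intMat) hflag he hfΛ hef
    (fun z hz u hu => by
      rw [mem_latticeOf, rowAct_complex_smul hΔ hρi]
      exact smul_mem_stdLattice z hz _ hu)
    (fun u hu v hv => by
      rw [← hρJ']
      exact herm_mem_order _ hu _ hv)
    (fun u hu => by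
      have h := (intMat_iff_rowAct hΔ).1 h1 _ hu
      rwa [val_mul, rowAct_mul, LinearMap.toAddMonoidHom_coe, rowAct_val_inv] at h)
    (fun u hu => by
      have h := (intMat_iff_rowAct hΔ).1 h2 _ hu
      rw [val_mul, rowAct_smul_mat, rowAct_mul, LinearMap.toAddMonoidHom_coe, rowAct_val_inv] at h
      have e1 : (p : ℂ) • u = (p : ℝ) • u := by
        funext i
        simp
      rwa [mem_latticeOf, e1, map_smul])
  rcases key with h | ⟨s, hs, h⟩
  · refine ⟨none, ?_⟩
    rw [rep, one_mul]
    refine IntMat.inv hρJ ((intMat_iff_rowAct hΔ).2 fun u hu => h ?_)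
    rwa [mem_latticeOf, rowAct_inv_val]
  · refine ⟨some ⟨s, hs⟩, (intMat_iff_rowAct hΔ).2 fun u hu => ?_⟩
    rw [rep, val_mul, rowAct_mul, val_mul, rowAct_mul, rowAct_transvG, rowAct_transvG]
    exact h u hu

theorem intMat_transvG (hfΛ : f ∈ stdLattice Δ) (k : ℤ) :
    IntMat (transvG hΔ hf k).1.val := by
  refine (intMat_iff_rowAct hΔ).2 fun u hu => ?_
  rw [rowAct_transvG, transv]
  refine add_mem hu (smul_mem_stdLattice _ (mul_mem (mul_mem ?_ (rootC_mem Δ))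
      (herm_mem_order _ hu _ hfΛ)) _ hfΛ)
  simp [intCast_mem]

/-- Different representatives give different lattices. -/
theorem not_intMat_rep (hinert : legendreSym p (-(Δ : ℤ)) = -1) (hN : ¬ p ∣ N)
    (heΛ : e ∈ stdLattice Δ) (hfΛ : f ∈ stdLattice Δ) (hef : herm e f ∉ orderMul Δ p)
    {i k : Option (Fin p)} (hik : i ≠ k) :
    ¬ IntMat (rep hΔ he hf p N i * (rep hΔ he hf p N k)⁻¹).1.val := by
  have hnone : ∀ s : Fin p, ¬ IntMat (rep hΔ he hf p N (some s)).1.val := by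
    intro s h
    refine transv_not_mem hΔ hinert hN (fun x y => herm_symm x y) herm_mem_order heΛ hfΛ hf hef ?_
    have h1 := h.mul (intMat_transvG hΔ hf hfΛ (p * N * (s : ℕ)))
    rw [← rowAct_transvG hΔ he]
    refine (intMat_iff_rowAct hΔ).1 ?_ _ hfΛ
    have e1 : ((p * N * (s : ℕ) : ℤ) : ℝ) = p * N * (s : ℕ) := by push_cast; rfl
    rwa [← val_mul, rep, ← transvG_inv, e1, inv_mul_cancel_right] at h1
  rcases i with _ | s <;> rcases k with _ | t
  · exact absurd rfl hik
  · intro h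
    rw [rep, one_mul] at h
    refine hnone t ?_
    have h1 := IntMat.inv (g := (rep hΔ he hf p N (some t))⁻¹) ?_ h
    · rwa [inv_inv] at h1
    · have h2 := similitude_inv one_ne_zero (rep_similitude hΔ he hf (N := N) (some t))
      rwa [inv_one] at h2
  · rw [rep, inv_one, mul_one]
    exact hnone s
  · intro h
    have hst : ¬ (p : ℤ) ∣ ((t : ℕ) : ℤ) - ((s : ℕ) : ℤ) := by
      intro hdvd
      have h1 := Int.eq_zero_of_abs_lt_dvd hdvd (by
        rw [abs_lt]
        constructor <;> have := s.2 <;> have := t.2 <;> omega)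
      exact hik (congrArg some (Fin.ext (by omega)))
    refine transv_conj_not_mem hΔ hinert hN (fun x y => herm_symm x y) herm_mem_order heΛ he hfΛ hf
      hef hst ?_
    rw [← rowAct_transvG hΔ he, ← rowAct_transvG hΔ hf, ← rowAct_transvG hΔ he, ← rowAct_mul,
      ← rowAct_mul, ← val_mul, ← val_mul]
    refine (intMat_iff_rowAct hΔ).1 ?_ _ hfΛ
    convert h using 3
    rw [rep, rep, _root_.mul_inv_rev, transvG_inv, transvG_inv, mul_assoc (transvG hΔ he _),
      ← mul_assoc (transvG hΔ hf _) (transvG hΔ hf _), transvG_mul]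
    congr 3
    push_cast
    ring

end Representatives

/-! ### Existence and invariance of bad elements -/

section BadElements

variable {p Δ N : ℕ} [hp : Fact p.Prime] {σ σ' : GSpPos (Fin 2 ⊕ Fin 1)}

theorem isoSubspace_eq_range {m : Type} [Fintype m] (S : Matrix m m ℤ) :
    isoSubspace p S = LinearMap.range (S.map (Int.cast : ℤ → ZMod p)).vecMulLinear := by
  rw [_root_.range_vecMulLinear]
  rfl

theorem isUnit_of_similitude {n R : Type} [Fintype n] [DecidableEq n] [CommRing R] (c : Rˣ)
    {A : Matrix (n ⊕ n) (n ⊕ n) R} (h : A * J n R * Aᵀ = c.val • J n R) : IsUnit A := by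
  rw [Matrix.isUnit_iff_isUnit_det]
  have h1 := congrArg det h
  rw [det_mul, det_mul, det_smul, det_transpose] at h1
  have h2 : IsUnit (det A * det (J n R) * det A) := by
    rw [h1]
    exact (c.isUnit.pow _).mul (isUnit_det_J n R)
  exact isUnit_of_mul_isUnit_right h2

theorem alpha_map {r s : ℕ} {R R' : Type} [CommRing R] [CommRing R'] (g : R →+* R') (δ : R)
    (h k : Matrix (Fin r ⊕ Fin s) (Fin r ⊕ Fin s) R) :
    (alpha r s δ h k).map g = alpha r s (g δ) (h.map g) (k.map g) := by
  have hE : (Ers r s R).map g = Ers r s R' := by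
    ext i j
    rw [map_apply, Ers_apply, Ers_apply, map_intCast]
  have hneg : ∀ A : Matrix (Fin r ⊕ Fin s) (Fin r ⊕ Fin s) R, (-A).map g = -(A.map g) := fun A => by
    ext i j
    simp
  have hsm : ∀ A : Matrix (Fin r ⊕ Fin s) (Fin r ⊕ Fin s) R, (δ • A).map g = g δ • A.map g :=
    fun A => by
      ext i j
      simp
  rw [alpha, alpha, fromBlocks_map, hneg, hsm, Matrix.map_mul, Matrix.map_mul, Matrix.map_mul,
    Matrix.map_mul, hE]

/-- Badness depends on the D-equivalence class only. -/
theorem isBad_of_dEquiv (hbad : IsBad 2 1 p Δ σ) (h : DEquiv 2 1 p Δ σ σ') : IsBad 2 1 p Δ σ' := by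
  obtain ⟨S, hS, h3, h6⟩ := hbad
  obtain ⟨S₁, S₂, hS₁, hS₂, a, b, c, hU, u, hu⟩ := h
  obtain rfl : S = S₁ := map_intCast_injective (hS.symm.trans hS₁)
  set A := (alpha 2 1 (Δ : ℤ_[p]) a b).map PadicInt.toZMod with hA
  set U := u.val.map PadicInt.toZMod with hUdef
  have hAu : IsUnit A :=
    (isUnit_of_similitude c (alpha_similitude hU)).map (RingHom.mapMatrix (PadicInt.toZMod (p := p)))
  have hUu : IsUnit U := u.isUnit.map (RingHom.mapMatrix (PadicInt.toZMod (p := p)))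
  have hcast : ∀ T : Matrix ((Fin 2 ⊕ Fin 1) ⊕ (Fin 2 ⊕ Fin 1)) ((Fin 2 ⊕ Fin 1) ⊕ (Fin 2 ⊕ Fin 1)) ℤ,
      (T.map (Int.cast : ℤ → ℤ_[p])).map PadicInt.toZMod = T.map (Int.cast : ℤ → ZMod p) := fun T => by
    ext i j
    simp
  have hrel : S.map (Int.cast : ℤ → ZMod p) * A = U * S₂.map (Int.cast : ℤ → ZMod p) := by
    have h1 := congrArg (fun X => X.map PadicInt.toZMod) hu
    simp only [Matrix.map_mul, hcast] at h1
    exact h1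
  have hcomm : A * rootMat 2 1 (Δ : ZMod p) = rootMat 2 1 (Δ : ZMod p) * A := by
    rw [hA, alpha_map, map_natCast, alpha_mul_rootMat]
  have hAinj : Function.Injective A.vecMulLinear := Matrix.vecMul_injective_of_isUnit hAu
  have hW : (isoSubspace p S).map A.vecMulLinear = isoSubspace p S₂ := by
    have hUsurj : Function.Surjective U.vecMulLinear := Matrix.vecMul_surjective_iff_isUnit.2 hUu
    rw [isoSubspace_eq_range, isoSubspace_eq_range, ← LinearMap.range_comp]
    have e1 : A.vecMulLinear ∘ₗ (S.map (Int.cast : ℤ → ZMod p)).vecMulLinear =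
        (S₂.map (Int.cast : ℤ → ZMod p)).vecMulLinear ∘ₗ U.vecMulLinear := by
      apply LinearMap.ext
      intro x
      simp only [LinearMap.comp_apply, Matrix.vecMulLinear_apply, vecMul_vecMul, hrel]
    rw [e1, LinearMap.range_comp_of_range_eq_top _ (LinearMap.range_eq_top.2 hUsurj)]
  have hdim : dimOKSpan 2 1 p Δ S₂ = dimOKSpan 2 1 p Δ S := by
    have e2 : (isoSubspace p S ⊔ (isoSubspace p S).map (rootMat 2 1 (Δ : ZMod p)).vecMulLinear).map
        A.vecMulLinear =
        isoSubspace p S₂ ⊔ (isoSubspace p S₂).map (rootMat 2 1 (Δ : ZMod p)).vecMulLinear := by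
      rw [Submodule.map_sup, ← hW, ← Submodule.map_comp, ← Submodule.map_comp]
      congr 2
      apply LinearMap.ext
      intro x
      simp only [LinearMap.comp_apply, Matrix.vecMulLinear_apply, vecMul_vecMul, hcomm]
    change Module.finrank (ZMod p) ↥(isoSubspace p S₂ ⊔
      (isoSubspace p S₂).map (rootMat 2 1 (Δ : ZMod p)).vecMulLinear) = _
    rw [← e2]
    exact (Submodule.equivMapOfInjective _ hAinj _).finrank_eq.symm
  exact ⟨S₂, hS₂, by rwa [hdim], by rwa [hdim]⟩

/-- An element of `Γ₀(N)` whose first three rows modulo `p` span, for `p d - b N = 1`, a maximal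
isotropic subspace that is neither stable nor in general position with respect to `√-Δ`. -/
def mixedMat (p N : ℕ) (b d : ℤ) :
    Matrix ((Fin 2 ⊕ Fin 1) ⊕ (Fin 2 ⊕ Fin 1)) ((Fin 2 ⊕ Fin 1) ⊕ (Fin 2 ⊕ Fin 1)) ℤ :=
  fromBlocks (fromBlocks 1 !![1; 0] 0 !![(p : ℤ)]) (fromBlocks 0 0 !![-b, 0] !![b])
    (fromBlocks 0 0 0 !![(N : ℤ)]) (fromBlocks 1 0 !![-d, 0] !![d])

theorem mixedMat_mem {p N : ℕ} {b d : ℤ} (hbd : p * d - b * N = 1) :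
    mixedMat p N b d ∈ symplecticGroup (Fin 2 ⊕ Fin 1) ℤ := by
  rw [SymplecticGroup.mem_iff, mixedMat, J, fromBlocks_transpose, fromBlocks_multiply,
    fromBlocks_multiply, fromBlocks_inj]
  refine ⟨?_, ?_, ?_, ?_⟩
  all_goals
    ext i j
    rcases i with i | i <;> rcases j with j | j <;> fin_cases i <;> fin_cases j <;>
      (simp [Matrix.mul_apply, Matrix.one_apply]; try linarith)

/-- There are bad elements: `diag (1, 1, 1, p, p, p) γ`, with `γ` given by `mixedMat`. -/
theorem exists_bad (hN : ¬ p ∣ N) :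
    ∃ σ ∈ heckeTp (Fin 2 ⊕ Fin 1) p N, IsBad 2 1 p Δ σ := by
  obtain ⟨d, b', hdb⟩ : IsCoprime (p : ℤ) (N : ℤ) :=
    Nat.isCoprime_iff_coprime.2 ((Nat.Prime.coprime_iff_not_dvd hp.out).2 hN)
  set b := -b' with hb
  have hbd : p * d - b * N = 1 := by rw [hb]; linarith
  set G := mixedMat p N b d with hG
  have hGJ : G.map (Int.cast : ℤ → ℝ) * J _ ℝ * (G.map (Int.cast : ℤ → ℝ))ᵀ = (1 : ℝ) • J _ ℝ := by
    have h := congrArg (fun X => X.map (Int.castRingHom ℝ))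
      (SymplecticGroup.mem_iff.1 (mixedMat_mem hbd))
    simp only [Matrix.map_mul, map_J] at h
    rw [one_smul]
    exact h
  set γ := ofSimilitude _ 1 one_pos hGJ with hγ
  have hγΓ : γ ∈ Gamma0 (Fin 2 ⊕ Fin 1) N := by
    refine ⟨G, mixedMat_mem hbd, ?_, rfl⟩
    rintro (i | i) (j | j) <;> simp [hG, mixedMat]
  set S : Matrix ((Fin 2 ⊕ Fin 1) ⊕ (Fin 2 ⊕ Fin 1)) ((Fin 2 ⊕ Fin 1) ⊕ (Fin 2 ⊕ Fin 1)) ℤ :=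
    fromBlocks G.toBlocks₁₁ G.toBlocks₁₂ ((p : ℤ) • G.toBlocks₂₁) ((p : ℤ) • G.toBlocks₂₂) with hSdef
  have hσ : tauP (Fin 2 ⊕ Fin 1) p * γ ∈ heckeTp (Fin 2 ⊕ Fin 1) p N :=
    DoubleCoset.mem_doubleCoset.2 ⟨1, one_mem _, γ, hγΓ, by rw [one_mul]⟩
  have hS : (tauP (Fin 2 ⊕ Fin 1) p * γ).1.val = S.map (Int.cast : ℤ → ℝ) := by
    rw [val_mul]
    change fromBlocks 1 0 0 ((p : ℝ) • 1) * G.map (Int.cast : ℤ → ℝ) = _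
    conv_lhs => rw [← fromBlocks_toBlocks G, fromBlocks_map, fromBlocks_multiply]
    rw [hSdef, fromBlocks_map, fromBlocks_inj]
    refine ⟨by simp, by simp, ?_, ?_⟩ <;>
    · ext i j
      simp only [Matrix.zero_mul, zero_add, Matrix.smul_mul, Matrix.one_mul, Matrix.smul_apply,
        map_apply, smul_eq_mul, Int.cast_mul, Int.cast_natCast]
  obtain ⟨hSJ, hSJ'⟩ := int_similitude hp.out.ne_zero hS (blockInt_of_mem_heckeTp hσ).2.2
  have hW := orthogonal_isoSubspace hSJ hSJ'
  refine ⟨_, hσ, S, hS, fun h3 => ?_, fun h6 => ?_⟩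
  · have hsup := Submodule.eq_of_le_of_finrank_eq
      (le_sup_left : isoSubspace p S ≤
        isoSubspace p S ⊔ (isoSubspace p S).map (rootMat 2 1 (Δ : ZMod p)).vecMulLinear)
      ((finrank_eq_three hW).trans h3.symm)
    have hx : (Pi.single (.inl (.inl 1)) 1 : (Fin 2 ⊕ Fin 1) ⊕ (Fin 2 ⊕ Fin 1) → ZMod p) ∈
        isoSubspace p S := by
      refine Submodule.subset_span ⟨.inl (.inl 1), ?_⟩
      funext i
      rcases i with (i | i) | (i | i) <;> fin_cases i <;> simp [hSdef, hG, mixedMat]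
    have hxω : (Pi.single (.inl (.inl 1)) 1 : (Fin 2 ⊕ Fin 1) ⊕ (Fin 2 ⊕ Fin 1) → ZMod p) ᵥ*
        rootMat 2 1 (Δ : ZMod p) ∈ isoSubspace p S := by
      rw [hsup]
      exact Submodule.mem_sup_right ⟨_, hx, rfl⟩
    rw [← hW, LinearMap.BilinForm.mem_orthogonal_iff] at hxω
    have h0 := hxω _ hx
    rw [toBilin'_J_apply, single_one_vecMul, single_one_dotProduct] at h0
    simp [J, mulVec, dotProduct, rootMat_eq, Ers, Matrix.one_apply] at h0
  · have hlin : ∀ x ∈ isoSubspace p S, x (.inl (.inl 0)) = x (.inl (.inr 0)) ∧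
        x (.inr (.inl 0)) + x (.inr (.inr 0)) = 0 := by
      intro x hx
      refine Submodule.span_induction ?_ (by simp) ?_ ?_ hx
      · rintro _ ⟨i, rfl⟩
        rcases i with (i | i) | i
        · fin_cases i <;> simp [hSdef, hG, mixedMat]
        · fin_cases i
          simp [hSdef, hG, mixedMat]
        · simp only [hSdef, fromBlocks_apply₂₁, fromBlocks_apply₂₂, Matrix.smul_apply,
            smul_eq_mul, Int.cast_mul, Int.cast_natCast, CharP.cast_eq_zero, zero_mul, add_zero,
            and_self]
      · intro x y _ _ hx hy
        refine ⟨by simp only [Pi.add_apply, hx.1, hy.1], ?_⟩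
        simp only [Pi.add_apply]
        linear_combination hx.2 + hy.2
      · intro c x _ hx
        refine ⟨by simp only [Pi.smul_apply, hx.1], ?_⟩
        simp only [Pi.smul_apply, smul_eq_mul]
        linear_combination c * hx.2
    have htop : isoSubspace p S ⊔ (isoSubspace p S).map (rootMat 2 1 (Δ : ZMod p)).vecMulLinear = ⊤ :=
      Submodule.eq_top_of_finrank_eq (h6.trans (by simp))
    have hmem : (Pi.single (.inl (.inl 0)) 1 : (Fin 2 ⊕ Fin 1) ⊕ (Fin 2 ⊕ Fin 1) → ZMod p) ∈
        isoSubspace p S ⊔ (isoSubspace p S).map (rootMat 2 1 (Δ : ZMod p)).vecMulLinear := by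
      rw [htop]
      trivial
    obtain ⟨x, hx, _, ⟨y, hy, rfl⟩, hxy⟩ := Submodule.mem_sup.1 hmem
    have h1 := congrFun hxy (.inl (.inl 0))
    have h2 := congrFun hxy (.inl (.inr 0))
    simp [vecMul, dotProduct, rootMat_eq, Ers, Matrix.one_apply] at h1 h2
    refine one_ne_zero (α := ZMod p) ?_
    linear_combination h2 - h1 + (hlin x hx).1 - Δ * (hlin y hy).2

end BadElements

/-! ### Elements that fix a generic point -/

section Rigidity

variable {p Δ N : ℕ} [hp : Fact p.Prime]

theorem toVariety_eq_iff {n : Type} [Fintype n] [DecidableEq n] {Z Z' : SiegelSpace n} :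
    toVariety N Z = toVariety N Z' ↔ ∃ γ ∈ Gamma0 n N, γ • Z' = Z := by
  rw [toVariety, toVariety, Quotient.eq'', MulAction.orbitRel_apply]
  constructor
  · rintro ⟨γ, hγ⟩
    exact ⟨γ.1, γ.2, hγ⟩
  · rintro ⟨γ, hγ, h⟩
    exact ⟨⟨γ, hγ⟩, h⟩

variable {σ : GSpPos (Fin 2 ⊕ Fin 1)} {Z : SiegelSpace (Fin 2 ⊕ Fin 1)}

theorem rootMat_apply_diag (i j : Fin 2 ⊕ Fin 1) :
    rootMat 2 1 (Δ : ℝ) (.inl i) (.inl j) = 0 := by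
  simp [rootMat_eq]

theorem rootMat_apply_one : rootMat 2 1 (Δ : ℝ) (.inl (.inl 0)) (.inr (.inl 0)) = 1 := by
  simp [rootMat_eq, Ers]

/-- `1` and `√-Δ` are linearly independent over `ℝ`. -/
theorem eq_of_comb {x y x' y' : ℝ}
    (h : x • (1 : Matrix _ _ ℝ) + y • rootMat 2 1 (Δ : ℝ) = x' • 1 + y' • rootMat 2 1 (Δ : ℝ)) :
    x = x' ∧ y = y' := by
  have h1 := congrFun (congrFun h (.inl (.inl 0))) (.inl (.inl 0))
  have h2 := congrFun (congrFun h (.inl (.inl 0))) (.inr (.inl 0))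
  simp only [Matrix.add_apply, Matrix.smul_apply, rootMat_apply_diag, rootMat_apply_one,
    Matrix.one_apply_eq, smul_eq_mul, mul_one, mul_zero, add_zero] at h1 h2
  simp at h2
  exact ⟨h1, h2⟩

/-- A linear relation `m = x + y a` may be tested after conjugation. -/
theorem conj_val {g m : GSpPos (Fin 2 ⊕ Fin 1)} {x y : ℝ} {a : GSpPos (Fin 2 ⊕ Fin 1)}
    (h : (g * m * g⁻¹).1.val = x • 1 + y • (g * a * g⁻¹).1.val) :
    m.1.val = x • 1 + y • a.1.val := by
  have e : ∀ b : GSpPos (Fin 2 ⊕ Fin 1), b.1.val = (g⁻¹).1.val * (g * b * g⁻¹).1.val * g.1.val := by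
    intro b
    rw [← val_mul, ← val_mul]
    congr 2
    group
  rw [e m, h, Matrix.mul_add, Matrix.add_mul, Matrix.mul_smul, Matrix.smul_mul, Matrix.mul_one,
    val_inv_mul_val, Matrix.mul_smul, Matrix.smul_mul, ← e a]

/-- Elements of the double coset of `T_p` conjugate `√-Δ` to an element with denominator `p`. -/
theorem conj_rootG_mem_heckeSet (hΔ : 0 < Δ) (hσ : σ ∈ heckeTp (Fin 2 ⊕ Fin 1) p N) :
    σ * rootG 2 1 hΔ * σ⁻¹ ∈ heckeSet (Fin 2 ⊕ Fin 1) p Δ := by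
  have hp0 : (p : ℝ) ≠ 0 := by exact_mod_cast hp.out.ne_zero
  obtain ⟨hσ1, hσ2, hσ3⟩ := blockInt_of_mem_heckeTp hσ
  constructor
  · have hrootJ : (rootG 2 1 hΔ).1.val * J _ ℝ * ((rootG 2 1 hΔ).1.val)ᵀ = (Δ : ℝ) • J _ ℝ := by
      rw [rootG_val, rootMat_similitude]
    refine ⟨Δ, by exact_mod_cast hΔ, le_rfl, ?_⟩
    have h := similitude_mul (similitude_mul hσ3 hrootJ) (similitude_inv hp0 hσ3)
    rw [h, mul_comm (Δ : ℝ), inv_mul_cancel_left₀ hp0]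
  · have hroot : IntMat (rootG 2 1 hΔ).1.val := by
      rw [rootG_val]
      exact ⟨rootMat 2 1 (Δ : ℤ), (rootMat_map ℝ).symm⟩
    rw [val_mul, val_mul, ← Matrix.mul_smul]
    exact (hσ1.intMat.mul hroot).mul hσ2.intMat

/-- At a generic point, the elements of `heckeSet` that fix it are, up to conjugation, in the
field `ℝ(√-Δ)`. -/
theorem exists_comb_of_generic (hΔ : 0 < Δ) (hσ : σ ∈ heckeTp (Fin 2 ⊕ Fin 1) p N)
    (hZ : Z ∈ domainV 2 1 Δ) (hgen : Generic p Δ (σ • Z)) {m : GSpPos (Fin 2 ⊕ Fin 1)}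
    (hm : σ * m * σ⁻¹ ∈ heckeSet (Fin 2 ⊕ Fin 1) p Δ) (hmZ : m • Z = Z) :
    ∃ x y : ℝ, m.1.val = x • 1 + y • rootMat 2 1 (Δ : ℝ) := by
  have hfix : ∀ g : GSpPos (Fin 2 ⊕ Fin 1), g • Z = Z → (σ * g * σ⁻¹) • σ • Z = σ • Z := by
    intro g hg
    rw [mul_smul, mul_smul, inv_smul_smul, hg]
  rcases hgen _ (conj_rootG_mem_heckeSet hΔ hσ) (hfix _ (rootG_smul_of_mem hΔ hZ)) _ hm
    (hfix m hmZ) with ⟨x, hx⟩ | ⟨x, y, hxy⟩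
  · -- `√-Δ` is not a scalar matrix
    exfalso
    have h := conj_val (g := σ) (m := rootG 2 1 hΔ) (a := 1) (x := x) (y := 0) (by rw [hx]; simp)
    rw [zero_smul, add_zero, rootG_val] at h
    have h2 := eq_of_comb (Δ := Δ) (x := 0) (y := 1) (x' := x) (y' := 0) (by rw [h]; simp)
    exact one_ne_zero h2.2
  · exact ⟨x, y, conj_val hxy⟩

/-- An element of `GSp⁺` that conjugates `√-Δ` into `ℝ(√-Δ)` commutes with `√-Δ`. -/
theorem commute_of_conj_eq (hΔ : 0 < Δ) {ρ : GSpPos (Fin 2 ⊕ Fin 1)} {x y : ℝ}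
    (h : (ρ⁻¹ * rootG 2 1 hΔ * ρ).1.val = x • 1 + y • rootMat 2 1 (Δ : ℝ)) :
    Commute ρ (rootG 2 1 hΔ) := by
  have hΔ' : (0 : ℝ) < Δ := by exact_mod_cast hΔ
  have hsq : (ρ⁻¹ * rootG 2 1 hΔ * ρ).1.val * (ρ⁻¹ * rootG 2 1 hΔ * ρ).1.val = -((Δ : ℝ) • 1) := by
    have e : (ρ⁻¹ * rootG 2 1 hΔ * ρ) * (ρ⁻¹ * rootG 2 1 hΔ * ρ) =
        ρ⁻¹ * (rootG 2 1 hΔ * rootG 2 1 hΔ) * ρ := by group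
    rw [← val_mul, e, val_mul, val_mul, val_mul, rootG_val, rootMat_mul_self, Matrix.mul_neg,
      Matrix.mul_smul, Matrix.mul_one, Matrix.neg_mul, Matrix.smul_mul, val_inv_mul_val]
  have hsq' : (x ^ 2 - Δ * y ^ 2) • (1 : Matrix _ _ ℝ) + (2 * x * y) • rootMat 2 1 (Δ : ℝ) =
      (-(Δ : ℝ)) • 1 + (0 : ℝ) • rootMat 2 1 (Δ : ℝ) := by
    rw [zero_smul, add_zero, neg_smul, ← hsq, h, Matrix.add_mul, Matrix.mul_add, Matrix.mul_add,
      Matrix.smul_mul, Matrix.smul_mul, Matrix.smul_mul, Matrix.smul_mul, Matrix.mul_smul,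
      Matrix.mul_smul, Matrix.mul_smul, Matrix.mul_smul, rootMat_mul_self, Matrix.one_mul,
      Matrix.one_mul, Matrix.mul_one]
    module
  obtain ⟨h1, h2⟩ := eq_of_comb hsq'
  have hy : y ≠ 0 := by
    rintro rfl
    nlinarith [sq_nonneg x]
  have hx : x = 0 := by simpa [hy] using h2
  subst hx
  have hy2 : (y - 1) * (y + 1) = 0 := by
    have : (Δ : ℝ) * ((y - 1) * (y + 1)) = 0 := by linarith
    exact (mul_eq_zero.1 this).resolve_left hΔ'.ne'
  have hmul : (rootG 2 1 hΔ * ρ).1.val = y • (ρ.1.val * rootMat 2 1 (Δ : ℝ)) := by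
    have e : rootG 2 1 hΔ * ρ = ρ * (ρ⁻¹ * rootG 2 1 hΔ * ρ) := by group
    rw [e, val_mul, h, zero_smul, zero_add, Matrix.mul_smul]
  rw [val_mul, rootG_val] at hmul
  rcases mul_eq_zero.1 hy2 with hy1 | hy1
  · rw [commute_rootG_iff, hmul, sub_eq_zero.1 hy1, one_smul]
  · refine (ne_neg_of_signature hΔ ρ ?_).elim
    rw [hmul, eq_neg_of_add_eq_zero_left hy1, neg_smul, one_smul, neg_neg]

/-- An element of `ℝ(√-Δ)` of norm one with denominator `p²` is integral, as `p` is inert. -/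
theorem intMat_of_norm_eq_one (hinert : legendreSym p (-(Δ : ℤ)) = -1)
    {κ : GSpPos (Fin 2 ⊕ Fin 1)} {x y : ℝ} (h : κ.1.val = x • 1 + y • rootMat 2 1 (Δ : ℝ))
    (hJ : κ.1.val * J _ ℝ * κ.1.valᵀ = (1 : ℝ) • J _ ℝ)
    (hint : IntMat ((p : ℝ) ^ 2 • κ.1.val)) : IntMat κ.1.val := by
  have hp0 : (p : ℝ) ≠ 0 := by exact_mod_cast hp.out.ne_zero
  obtain ⟨S, hS⟩ := hint
  have hx : (p : ℝ) ^ 2 * x = S (.inl (.inl 0)) (.inl (.inl 0)) := by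
    have h1 := congrFun (congrFun hS (.inl (.inl 0))) (.inl (.inl 0))
    rw [h] at h1
    simpa [rootMat_apply_diag] using h1
  have hy : (p : ℝ) ^ 2 * y = S (.inl (.inl 0)) (.inr (.inl 0)) := by
    have h1 := congrFun (congrFun hS (.inl (.inl 0))) (.inr (.inl 0))
    rw [h] at h1
    simpa [rootMat_apply_one] using h1
  have hnorm : x ^ 2 + Δ * y ^ 2 = 1 := by
    have e : J _ ℝ * (rootMat 2 1 (Δ : ℝ))ᵀ = -(rootMat 2 1 (Δ : ℝ) * J _ ℝ) := by
      rw [rootMat_mul_J_eq, neg_neg]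
    rw [h, transpose_add, transpose_smul, transpose_smul, transpose_one, Matrix.mul_assoc,
      Matrix.mul_add, Matrix.mul_smul, Matrix.mul_smul, Matrix.mul_one, e] at hJ
    have e2 : (x • (1 : Matrix _ _ ℝ) + y • rootMat 2 1 (Δ : ℝ)) *
        (x • J _ ℝ + y • -(rootMat 2 1 (Δ : ℝ) * J _ ℝ)) = (x ^ 2 + Δ * y ^ 2) • J _ ℝ := by
      rw [Matrix.add_mul, Matrix.mul_add, Matrix.mul_add]
      simp only [Matrix.smul_mul, Matrix.mul_smul, Matrix.one_mul, Matrix.mul_neg]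
      rw [← Matrix.mul_assoc, rootMat_mul_self, Matrix.neg_mul, Matrix.smul_mul, Matrix.one_mul]
      module
    rw [e2] at hJ
    have h1 := congrFun (congrFun hJ (.inr (.inl 0))) (.inl (.inl 0))
    simpa [J] using h1
  generalize S (.inl (.inl 0)) (.inl (.inl 0)) = X at hx
  generalize S (.inl (.inl 0)) (.inr (.inl 0)) = Y at hy
  have hXY : X ^ 2 + Δ * Y ^ 2 = (p : ℤ) ^ 4 := by
    have : (X : ℝ) ^ 2 + Δ * Y ^ 2 = p ^ 4 := by
      rw [← hx, ← hy]
      linear_combination (p : ℝ) ^ 4 * hnorm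
    exact_mod_cast this
  have hpp : (p : ℤ) ≠ 0 := by exact_mod_cast hp.out.ne_zero
  obtain ⟨⟨X, rfl⟩, ⟨Y, rfl⟩⟩ := dvd_of_dvd_norm hinert (a := X) (b := Y) ⟨p ^ 3, by rw [hXY]; ring⟩
  have hXY' : X ^ 2 + Δ * Y ^ 2 = (p : ℤ) ^ 2 := by
    apply mul_left_cancel₀ (pow_ne_zero 2 hpp)
    linear_combination hXY
  obtain ⟨⟨X, rfl⟩, ⟨Y, rfl⟩⟩ := dvd_of_dvd_norm hinert (a := X) (b := Y) ⟨p, by rw [hXY']; ring⟩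
  have hx' : x = X := by
    apply mul_left_cancel₀ (pow_ne_zero 2 hp0)
    rw [hx]
    push_cast
    ring
  have hy' : y = Y := by
    apply mul_left_cancel₀ (pow_ne_zero 2 hp0)
    rw [hy]
    push_cast
    ring
  refine ⟨Matrix.of fun i j => X * (if i = j then 1 else 0) + Y * rootMat 2 1 (Δ : ℤ) i j, ?_⟩
  rw [h, hx', hy', ← rootMat_map ℝ]
  ext i j
  simp [Matrix.one_apply]

end Rigidity

/-! ### The fibre over a generic point -/

section FibreCount

variable {p Δ N : ℕ} [hp : Fact p.Prime] (hΔ : 0 < Δ) {e f : Fin 2 ⊕ Fin 1 → ℂ}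
  (he : herm e e = 0) (hf : herm f f = 0) {σ : GSpPos (Fin 2 ⊕ Fin 1)}
  {t t' : SiegelSpace (Fin 2 ⊕ Fin 1)}

/-- Any preimage of the class of `σ • t` in `V` is the class of one of the points `ρ • t`, where
`ρ` runs through the `p + 1` representatives. -/
theorem exists_rep_of_toVariety_eq (hinert : legendreSym p (-(Δ : ℤ)) = -1) (hN : ¬ p ∣ N)
    (hσ : σ ∈ heckeTp (Fin 2 ⊕ Fin 1) p N)
    (hflag : IsFlag herm Δ p (stdLattice Δ) (latticeOf hΔ σ) e) (hfΛ : f ∈ stdLattice Δ)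
    (hef : herm e f ∉ orderMul Δ p) (ht : t ∈ domainV 2 1 Δ) (ht' : t' ∈ domainV 2 1 Δ)
    (hgen : Generic p Δ (σ • t)) {σ' : GSpPos (Fin 2 ⊕ Fin 1)}
    (hσ' : σ' ∈ heckeTp (Fin 2 ⊕ Fin 1) p N)
    (h : toVariety N (σ' • t') = toVariety N (σ • t)) :
    ∃ i, toVariety N t' = toVariety N (rep hΔ he hf p N i • t) := by
  have hp0 : (p : ℝ) ≠ 0 := by exact_mod_cast hp.out.ne_zero
  obtain ⟨γ, hγ, hγt⟩ := toVariety_eq_iff.1 h.symm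
  obtain ⟨hσ1, hσ2, hσ3⟩ := blockInt_of_mem_heckeTp hσ
  obtain ⟨hσ1', hσ2', hσ3'⟩ := blockInt_of_mem_heckeTp hσ'
  set ρ := σ'⁻¹ * γ⁻¹ * σ with hρ
  have hρt : ρ • t = t' := by
    rw [hρ, mul_smul, mul_smul, ← hγt, inv_smul_smul, inv_smul_smul]
  have hρJ : ρ.1.val * J _ ℝ * ρ.1.valᵀ = (1 : ℝ) • J _ ℝ := by
    have h1 := similitude_mul (similitude_mul (similitude_inv hp0 hσ3')
      (similitude_of_mem (inv_mem hγ))) hσ3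
    rwa [one_mul, mul_inv_cancel₀ hp0] at h1
  have hcomm : Commute ρ (rootG 2 1 hΔ) := by
    obtain ⟨x, y, hxy⟩ := exists_comb_of_generic hΔ hσ ht hgen (m := ρ⁻¹ * rootG 2 1 hΔ * ρ) (by
      have e1 : σ * (ρ⁻¹ * rootG 2 1 hΔ * ρ) * σ⁻¹ =
          (γ⁻¹)⁻¹ * (σ' * rootG 2 1 hΔ * σ'⁻¹) * γ⁻¹ := by
        rw [hρ]
        group
      rw [e1]
      exact conj_mem_heckeSet (inv_mem hγ) (conj_rootG_mem_heckeSet hΔ hσ')) (by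
      rw [mul_smul, mul_smul, hρt, rootG_smul_of_mem hΔ ht', ← hρt, inv_smul_smul])
    exact commute_of_conj_eq hΔ hxy
  have e1 : σ * ρ⁻¹ = γ * σ' := by
    rw [hρ]
    group
  have e2 : ρ * σ⁻¹ = σ'⁻¹ * γ⁻¹ := by
    rw [hρ]
    group
  obtain ⟨i, hi⟩ := exists_rep hΔ he hf hinert hN hσ hflag hfΛ hef hcomm hρJ
    (by
      rw [e1, val_mul]
      exact (blockInt_of_mem hγ).intMat.mul hσ1'.intMat)
    (by
      rw [e2, val_mul, ← Matrix.smul_mul]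
      exact hσ2'.intMat.mul (blockInt_of_mem (inv_mem hγ)).intMat)
  refine ⟨i, (toVariety_eq_iff.2 ⟨rep hΔ he hf p N i * ρ⁻¹, ?_, ?_⟩).symm⟩
  · refine mem_Gamma0_of_blockInt ?_ (BlockInt.of_smul (p := p) (k := 1) hN hi ?_)
    · have h1 := similitude_mul (rep_similitude hΔ he hf (N := N) i)
        (similitude_inv one_ne_zero hρJ)
      rwa [inv_one, one_mul] at h1
    · have e3 : rep hΔ he hf p N i * ρ⁻¹ =
          σ⁻¹ * ((σ * rep hΔ he hf p N i * σ⁻¹) * γ * σ') := by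
        rw [hρ]
        group
      rw [e3, pow_one, val_mul, ← Matrix.smul_mul]
      refine hσ2.mul ?_
      rw [val_mul, val_mul]
      exact ((blockInt_of_mem (conj_rep_mem hΔ he hf hN hσ hflag hfΛ i)).mul
        (blockInt_of_mem hγ)).mul hσ1'
  · rw [mul_smul, ← hρt, inv_smul_smul]

/-- Over a generic point, the `p + 1` representatives give different points of `V`. -/
theorem rep_injective (hinert : legendreSym p (-(Δ : ℤ)) = -1) (hN : ¬ p ∣ N)
    (hσ : σ ∈ heckeTp (Fin 2 ⊕ Fin 1) p N)
    (hflag : IsFlag herm Δ p (stdLattice Δ) (latticeOf hΔ σ) e) (hfΛ : f ∈ stdLattice Δ)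
    (hef : herm e f ∉ orderMul Δ p) (ht : t ∈ domainV 2 1 Δ) (hgen : Generic p Δ (σ • t)) :
    Function.Injective fun i => toVariety N (rep hΔ he hf p N i • t) := by
  intro i k hik
  by_contra hne
  have hp0 : (p : ℝ) ≠ 0 := by exact_mod_cast hp.out.ne_zero
  obtain ⟨δ, hδ, hδt⟩ := toVariety_eq_iff.1 hik.symm
  obtain ⟨hσ1, hσ2, hσ3⟩ := blockInt_of_mem_heckeTp hσ
  set ρ := rep hΔ he hf p N with hρ
  have hconj : ∀ l, σ * ρ l * σ⁻¹ ∈ Gamma0 (Fin 2 ⊕ Fin 1) N := conj_rep_mem hΔ he hf hN hσ hflag hfΛ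
  have hρJ : ∀ l, (ρ l).1.val * J _ ℝ * (ρ l).1.valᵀ = (1 : ℝ) • J _ ℝ := rep_similitude hΔ he hf
  set κ := (ρ k)⁻¹ * δ * ρ i with hκ
  have hκt : κ • t = t := by
    rw [hκ, mul_smul, mul_smul, hδt, inv_smul_smul]
  have hinvJ := similitude_inv one_ne_zero (hρJ k)
  have hκJ : κ.1.val * J _ ℝ * κ.1.valᵀ = (1 : ℝ) • J _ ℝ := by
    have h1 := similitude_mul (similitude_mul hinvJ (similitude_of_mem hδ)) (hρJ i)
    rwa [inv_one, one_mul, one_mul] at h1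
  have hheck : σ * κ * σ⁻¹ ∈ heckeSet (Fin 2 ⊕ Fin 1) p Δ := by
    constructor
    · refine ⟨1, one_pos, by exact_mod_cast hΔ, ?_⟩
      have h1 := similitude_mul (similitude_mul hσ3 hκJ) (similitude_inv hp0 hσ3)
      rwa [one_mul, inv_mul_cancel₀ hp0] at h1
    · have e1 : σ * κ * σ⁻¹ = (σ * ρ k * σ⁻¹)⁻¹ * σ * δ * (σ⁻¹ * (σ * ρ i * σ⁻¹)) := by
        rw [hκ]
        group
      rw [e1, val_mul, ← Matrix.mul_smul, val_mul, val_mul, val_mul, ← Matrix.smul_mul]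
      exact (((blockInt_of_mem (inv_mem (hconj k))).intMat.mul hσ1.intMat).mul
        (blockInt_of_mem hδ).intMat).mul (hσ2.intMat.mul (blockInt_of_mem (hconj i)).intMat)
  obtain ⟨x, y, hxy⟩ := exists_comb_of_generic hΔ hσ ht hgen hheck hκt
  have hint : IntMat κ.1.val := by
    refine intMat_of_norm_eq_one hinert hxy hκJ ?_
    have e1 : κ = (σ⁻¹ * ((σ * ρ k * σ⁻¹)⁻¹ * σ * δ)) * (σ⁻¹ * ((σ * ρ i * σ⁻¹) * σ)) := by
      rw [hκ]
      group
    rw [e1, val_mul, sq, mul_smul, ← Matrix.mul_smul, ← Matrix.smul_mul, val_mul, val_mul, val_mul,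
      val_mul, val_mul, ← Matrix.smul_mul, ← Matrix.smul_mul]
    exact (hσ2.intMat.mul (((blockInt_of_mem (inv_mem (hconj k))).intMat.mul hσ1.intMat).mul
        (blockInt_of_mem hδ).intMat)).mul
      (hσ2.intMat.mul ((blockInt_of_mem (hconj i)).intMat.mul hσ1.intMat))
  -- `κ` lies in `ℝ(√-Δ)` and hence commutes with the representatives
  have hcomm : ∀ l, Commute κ (ρ l) := fun l => by
    refine ext_val ?_
    have h1 : (ρ l).1.val * rootMat 2 1 (Δ : ℝ) = rootMat 2 1 (Δ : ℝ) * (ρ l).1.val :=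
      (commute_rootG_iff hΔ).1 (commute_rep hΔ he hf l)
    rw [val_mul κ, val_mul _ κ, hxy, Matrix.add_mul, Matrix.mul_add, Matrix.smul_mul, Matrix.mul_smul,
      Matrix.smul_mul, Matrix.mul_smul, Matrix.one_mul, Matrix.mul_one, h1]
  refine not_intMat_rep hΔ he hf hinert hN hflag.mem hfΛ hef (Ne.symm hne) ?_
  have e2 : ρ k * (ρ i)⁻¹ = κ⁻¹ * δ := by
    have h1 : δ * ρ i = κ * ρ k := by
      rw [(hcomm k).eq, hκ]
      group
    rw [mul_inv_eq_iff_eq_mul, mul_assoc, h1, inv_mul_cancel_left]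
  change IntMat (ρ k * (ρ i)⁻¹).1.val
  rw [e2, val_mul]
  exact (IntMat.inv hκJ hint).mul (blockInt_of_mem hδ).intMat

end FibreCount

/-! ### The degree of the second projection -/

section Degree

theorem isOpen_generic_variety {p Δ N : ℕ} {n : Type} [Fintype n] [DecidableEq n] (hp0 : p ≠ 0) :
    IsOpen {x : SiegelVariety n N | ∀ Z, toVariety N Z = x → Generic p Δ Z} := by
  rw [← isQuotientMap_quotient_mk'.isOpen_preimage]
  convert isOpen_generic (n := n) (Δ := Δ) hp0 using 1
  ext Z
  constructor
  · intro h
    exact h Z rfl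
  · intro h Z' hZ'
    obtain ⟨γ, hγ, rfl⟩ := toVariety_eq_iff.1 hZ'
    exact Generic.smul hγ h

/-- The degree of `π₂` is `p + 1` for any set of bad elements: the fibre over a generic point is in
bijection with the `p + 1` representatives, and the generic points are open and dense. -/
theorem hasDegree_piTwo {p Δ N : ℕ} [hp : Fact p.Prime] (hΔ : 0 < Δ)
    (hinert : legendreSym p (-(Δ : ℤ)) = -1) (hN : ¬ p ∣ N)
    {Sg : Set (GSpPos (Fin 2 ⊕ Fin 1))}
    (hSg : ∀ σ ∈ Sg, σ ∈ heckeTp (Fin 2 ⊕ Fin 1) p N ∧ IsBad 2 1 p Δ σ) :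
    HasDegree (piTwo 2 1 Δ N Sg) (p + 1) := by
  have hp0 := hp.out.ne_zero
  refine ⟨Subtype.val ⁻¹' {x | ∀ Z, toVariety N Z = x → Generic p Δ Z},
    (isOpen_generic_variety hp0).preimage continuous_subtype_val, ?_, ?_⟩
  · rw [dense_iff_inter_open]
    rintro O hO ⟨⟨_, t, ht, σ, hσ, rfl⟩, hyO⟩
    obtain ⟨O', hO', rfl⟩ := isOpen_induced_iff.1 hO
    have hopen : IsOpen ((fun Z : SiegelSpace (Fin 2 ⊕ Fin 1) => toVariety N (σ • Z)) ⁻¹' O') :=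
      hO'.preimage (continuous_quotient_mk'.comp (continuous_const_smul σ))
    obtain ⟨z, hz, hzO, hgen⟩ := exists_generic hΔ hp0 σ ht hopen hyO
    refine ⟨⟨toVariety N (σ • z), z, hz, σ, hσ, rfl⟩, hzO, fun Z hZ => ?_⟩
    obtain ⟨γ, hγ, rfl⟩ := toVariety_eq_iff.1 hZ
    exact Generic.smul hγ hgen
  · rintro ⟨_, t, ht, σ, hσ, rfl⟩ hgen
    have hgen' : Generic p Δ (σ • t) := hgen _ rfl
    obtain ⟨hσT, hbad⟩ := hSg σ hσ
    obtain ⟨e, f, hflag, he, hfΛ, hf, hef⟩ := exists_flag hΔ hinert hσT hbad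
    have hmem : ∀ i, (toVariety N (rep hΔ he hf p N i • t), toVariety N (σ • t)) ∈
        heckeGraph 2 1 Δ N Sg := fun i => by
      refine ⟨rep hΔ he hf p N i • t, smul_mem_domainV hΔ (commute_rep hΔ he hf i) ht, σ, hσ, ?_⟩
      refine Prod.ext rfl (toVariety_eq_iff.2 ⟨_, conj_rep_mem hΔ he hf hN hσT hflag hfΛ i, ?_⟩).symm
      rw [mul_smul, inv_smul_smul, mul_smul]
    have hinj : Function.Injective fun i => (⟨_, hmem i⟩ : heckeGraph 2 1 Δ N Sg) := by
      intro i k hik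
      exact rep_injective hΔ he hf hinert hN hσT hflag hfΛ hef ht hgen'
        (congrArg (fun q => q.1.1) hik)
    have hrange : piTwo 2 1 Δ N Sg ⁻¹' {⟨_, t, ht, σ, hσ, rfl⟩} =
        Set.range fun i => (⟨_, hmem i⟩ : heckeGraph 2 1 Δ N Sg) := by
      ext ⟨q, hq⟩
      constructor
      · intro h
        have hq2 : q.2 = toVariety N (σ • t) := congrArg Subtype.val h
        obtain ⟨t', ht', σ', hσ', rfl⟩ := id hq
        obtain ⟨i, hi⟩ := exists_rep_of_toVariety_eq hΔ he hf hinert hN hσT hflag hfΛ hef ht ht'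
          hgen' (hSg σ' hσ').1 hq2
        exact ⟨i, Subtype.ext (Prod.ext hi.symm hq2.symm)⟩
      · rintro ⟨i, hi⟩
        refine Subtype.ext ?_
        rw [← hi]
        rfl
    rw [hrange, ← Set.image_univ, hinj.encard_image, Set.encard_univ]
    simp

end Degree

end PicardHecke


theorem proposition3p4p3 (p : ℕ) [Fact p.Prime] (Δ N : ℕ) (hΔ : 0 < Δ)
    (hinert : legendreSym p (-(Δ : ℤ)) = -1) (hN : ¬ p ∣ N) :
    (∃ σ ∈ heckeTp (Fin 2 ⊕ Fin 1) p N, IsBad 2 1 p Δ σ) ∧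
    ∀ σ ∈ heckeTp (Fin 2 ⊕ Fin 1) p N, IsBad 2 1 p Δ σ →
      HasDegree (piTwo 2 1 Δ N {σ' ∈ heckeTp (Fin 2 ⊕ Fin 1) p N | DEquiv 2 1 p Δ σ σ'}) (p + 1) ∧
      HasDegree (piTwo 2 1 Δ N {σ}) (p + 1) := by
  refine ⟨PicardHecke.exists_bad hN, fun σ hσ hbad => ⟨?_, ?_⟩⟩
  · exact PicardHecke.hasDegree_piTwo hΔ hinert hN fun σ' hσ' =>
      ⟨hσ'.1, PicardHecke.isBad_of_dEquiv hbad hσ'.2⟩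
  · refine PicardHecke.hasDegree_piTwo hΔ hinert hN ?_
    rintro σ' rfl
    exact ⟨hσ, hbad⟩
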